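/- Let $\varphi = \frac{1+\sqrt5}{2}$. There are a deterministic algorithm and a polynomial $p$ such that the algorithm, given integers $n, d \ge 0$ and the adjacency matrix of a directed graph $G$ on $n$ vertices (loops allowed), decides in time at most $\varphi^{2d}\, p(n)$ whether $G$ contains a simple directed cycle of length $d$, that is, a closed walk with $d \ge 1$ edges whose $d$ starting vertices are pairwise distinct. The same holds for simple undirected graphs $G$ on $n$ vertices and simple undirected cycles of length $d$ (which have $d \ge 3$). Here an algorithm is a program for a random access machine on integers, and its running time is bit cost: each executed instruction or test is charged according to the bit lengths of all integers it handles, addresses included (the product of the bit lengths of the operands for multiplication, division and remainder). -/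

import Mathlib

/-! ### The machine model: random access machines with logarithmic cost

A machine has integer registers (a program names finitely many of them) and a memory of
integer cells with integer addresses.  Programs are built from single machine instructions
by sequencing, branching and unbounded loops.  Running time is bit cost: every executed
instruction, and every executed test, is charged according to the bit lengths of all the
integers it handles, including addresses. -/

namespace Ram

/-- Arithmetic instructions.  `div` and `mod` are integer division and remainder. -/
inductive Op where
  | add | sub | mul | div | mod

/-- The integer computed by an arithmetic instruction. -/
def Op.eval : Op → ℤ → ℤ → ℤ
  | .add, a, b => a + b
  | .sub, a, b => a - b
  | .mul, a, b => a * b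
  | .div, a, b => a / b
  | .mod, a, b => a % b

/-- The bit length of an integer: the number of binary digits of its absolute value,
plus one bit for the sign. -/
def bitLen (a : ℤ) : ℕ := a.natAbs.size + 1

/-- The cost of an arithmetic instruction: linear in the bit lengths of the operands for
addition and subtraction, the product of the bit lengths (schoolbook arithmetic) for
multiplication, division and remainder. -/
def Op.cost : Op → ℤ → ℤ → ℕ
  | .add, a, b => bitLen a + bitLen b
  | .sub, a, b => bitLen a + bitLen b
  | .mul, a, b => bitLen a * bitLen b
  | .div, a, b => bitLen a * bitLen b
  | .mod, a, b => bitLen a * bitLen b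

/-- Programs.  The arguments `x y z : ℕ` are names of registers. -/
inductive Prog where
  /-- do nothing -/
  | skip
  /-- `x := c` -/
  | const (x : ℕ) (c : ℤ)
  /-- `x := y o z` -/
  | arith (o : Op) (x y z : ℕ)
  /-- `x := memory[y]` -/
  | load (x y : ℕ)
  /-- `memory[x] := y` -/
  | store (x y : ℕ)
  /-- run `P`, then `Q` -/
  | seq (P Q : Prog)
  /-- if `0 < x` then run `P`, else run `Q` -/
  | cond (x : ℕ) (P Q : Prog)
  /-- as long as `0 < x`, run `P` -/
  | loop (x : ℕ) (P : Prog)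

/-- The contents of the registers and of the memory cells. -/
structure State where
  reg : ℕ → ℤ
  mem : ℤ → ℤ

/-- The state after register `x` has been set to `a`. -/
def State.setReg (s : State) (x : ℕ) (a : ℤ) : State :=
  { s with reg := Function.update s.reg x a }

/-- The state after memory cell `i` has been set to `a`. -/
def State.setMem (s : State) (i a : ℤ) : State :=
  { s with mem := Function.update s.mem i a }

/-- `Run P s s' t`: started in state `s`, the program `P` halts in state `s'`, and the total
cost of the instructions and tests that it executes is `t`. -/
inductive Run : Prog → State → State → ℕ → Prop where
  | skip (s : State) : Run .skip s s 1
  | const (s : State) (x : ℕ) (c : ℤ) :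
      Run (.const x c) s (s.setReg x c) (bitLen c)
  | arith (s : State) (o : Op) (x y z : ℕ) :
      Run (.arith o x y z) s (s.setReg x (o.eval (s.reg y) (s.reg z)))
        (o.cost (s.reg y) (s.reg z))
  | load (s : State) (x y : ℕ) :
      Run (.load x y) s (s.setReg x (s.mem (s.reg y)))
        (bitLen (s.reg y) + bitLen (s.mem (s.reg y)))
  | store (s : State) (x y : ℕ) :
      Run (.store x y) s (s.setMem (s.reg x) (s.reg y)) (bitLen (s.reg x) + bitLen (s.reg y))
  | seq {P Q : Prog} {s s' s'' : State} {t t' : ℕ} :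
      Run P s s' t → Run Q s' s'' t' → Run (.seq P Q) s s'' (t + t')
  | cond_pos {x : ℕ} {P Q : Prog} {s s' : State} {t : ℕ} :
      0 < s.reg x → Run P s s' t → Run (.cond x P Q) s s' (bitLen (s.reg x) + t)
  | cond_neg {x : ℕ} {P Q : Prog} {s s' : State} {t : ℕ} :
      ¬ 0 < s.reg x → Run Q s s' t → Run (.cond x P Q) s s' (bitLen (s.reg x) + t)
  | loop_pos {x : ℕ} {P : Prog} {s s' s'' : State} {t t' : ℕ} :
      0 < s.reg x → Run P s s' t → Run (.loop x P) s' s'' t' →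
      Run (.loop x P) s s'' (bitLen (s.reg x) + t + t')
  | loop_neg {x : ℕ} {P : Prog} {s : State} :
      ¬ 0 < s.reg x → Run (.loop x P) s s (bitLen (s.reg x))

/-- The machine is deterministic: the final state and the running time are determined by the
program and the initial state. -/
theorem Run.deterministic {P : Prog} {s s₁ s₂ : State} {t₁ t₂ : ℕ}
    (h₁ : Run P s s₁ t₁) (h₂ : Run P s s₂ t₂) : s₁ = s₂ ∧ t₁ = t₂ := by
  induction h₁ generalizing s₂ t₂ with
  | skip | const | arith | load | store => cases h₂; exact ⟨rfl, rfl⟩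
  | seq _ _ ih ih' =>
    cases h₂ with
    | seq a b =>
      obtain ⟨rfl, rfl⟩ := ih a
      obtain ⟨rfl, rfl⟩ := ih' b
      exact ⟨rfl, rfl⟩
  | cond_pos h _ ih =>
    cases h₂ with
    | cond_pos _ a =>
      obtain ⟨rfl, rfl⟩ := ih a
      exact ⟨rfl, rfl⟩
    | cond_neg h' _ => exact absurd h h'
  | cond_neg h _ ih =>
    cases h₂ with
    | cond_pos h' _ => exact absurd h' h
    | cond_neg _ a =>
      obtain ⟨rfl, rfl⟩ := ih a
      exact ⟨rfl, rfl⟩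
  | loop_pos h _ _ ih ih' =>
    cases h₂ with
    | loop_pos _ a b =>
      obtain ⟨rfl, rfl⟩ := ih a
      obtain ⟨rfl, rfl⟩ := ih' b
      exact ⟨rfl, rfl⟩
    | loop_neg h' => exact absurd h h'
  | loop_neg h =>
    cases h₂ with
    | loop_pos h' _ _ => exact absurd h' h
    | loop_neg _ => exact ⟨rfl, rfl⟩

open Classical in
/-- The input: register `0` holds `n`, register `1` holds `d`, memory cells
`0, …, n * n - 1` hold the adjacency matrix (row by row) of a relation on `Fin n`, and
everything else is `0`. -/
noncomputable def graphInput (n d : ℕ) (adj : Fin n → Fin n → Prop) : State where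
  reg := fun x => if x = 0 then (n : ℤ) else if x = 1 then (d : ℤ) else 0
  mem := fun a =>
    if ∃ i j : Fin n, adj i j ∧ a = (i : ℤ) * (n : ℤ) + (j : ℤ) then 1 else 0

/-- Started in state `s`, the program `P` halts after time at most `T`, and then register `0`
holds the correct answer to the question whether `A` is true: `1` for yes, `0` for no. -/
def DecidesWithin (P : Prog) (s : State) (A : Prop) (T : ℝ) : Prop :=
  ∃ (s' : State) (t : ℕ), Run P s s' t ∧ (t : ℝ) ≤ T ∧
    (A → s'.reg 0 = 1) ∧ (¬ A → s'.reg 0 = 0)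

end Ram

/-- The directed graph `G` contains a simple (directed) cycle of length `d`: a closed walk
`v 0 → v 1 → ⋯ → v d = v 0` with `d ≥ 1` edges whose vertices `v 0, …, v (d - 1)` are
pairwise distinct. -/
def Digraph.HasSimpleCycle {V : Type*} (G : Digraph V) (d : ℕ) : Prop :=
  1 ≤ d ∧ ∃ v : ℕ → V, v d = v 0 ∧ (∀ i < d, G.Adj (v i) (v (i + 1))) ∧
    Set.InjOn v (Set.Iio d)

/-- The undirected graph `G` contains a simple cycle of length `d`. -/
def SimpleGraph.HasSimpleCycle {V : Type*} (G : SimpleGraph V) (d : ℕ) : Prop :=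
  ∃ (u : V) (w : G.Walk u u), w.IsCycle ∧ w.length = d

/-! ### Cost calculus for programs -/

namespace Ram

/-! Fix a start vertex u and give the vertices distinct integer labels, u itself getting 0. Weigh a
closed walk of length d from u by the product of the squared label differences over all pairs of its
d starting vertices. A repeated vertex makes the weight 0. All weights are nonnegative, so nothing
cancels, and the total weight is positive exactly when a simple cycle of length d passes through u
(`walkWeight_pos_iff`, `hasSimpleCycle_iff_exists_walkWeight_pos`). The task is to compute this sum
deterministically.

A dynamic program over the labels met so far would need too many label sets. However, if t is one of
the remembered labels and r inner vertices are still to come, the weight is a polynomial in t of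
degree at most 2r (`exists_polynomial_walkWeight`). Hence true labels can be replaced by small
integers, and recovered by interpolation. Let E(S, v) (`tableEntry`) be the weight of the
continuations from v to u with the set S of naturals remembered and d - |S| inner vertices to come.
The result wanted is E({0}, u), and for |S| = d the entry is an adjacency bit.

Let k = |S| < d. Then E(S, v) is a sum over the successors w of v of P(a)^2 F(a), where a is the
label of w, P(t) is the product of t - i over i in S, and F(t) is the weight from w with S and t
remembered. The polynomial P F has degree at most 2d - k - 2. It vanishes on S, and elsewhere its
value at j comes from E(S ∪ {j}, w), so it can be interpolated at the nodes 0, ..., 2d - k - 2.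
Multiplying its value at a by P(a) gives the summand without division (`halts_edgeStep`). If S lies
in {0, ..., 2d - k - 1}, the sets S ∪ {j} have size k + 1 and lie in the same range. This suggests
storing all S contained in {0, ..., 2d - |S|}. The stored sets of size k that contain the top
element z = 2d - k are treated differently: as a function of z, with the rest T of S fixed, the
entry times the product of z - i over i in T is a polynomial of degree less than z, so it is
extrapolated from the sets T ∪ {j} with j < z, of the same size (`halts_extrapCell`).

The number of stored sets is a sum of binomial coefficients along a diagonal of Pascal's triangle,
namely the Fibonacci number with index 2d + 2 (`List.length_le_fib`), which is at most 2 φ^(2d).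
Each entry takes polynomially many operations on integers with polynomially many bits, since d ≤ n
may be assumed: for d = 0 or d > n the answer is no, and the cost of reading d is absorbed by
φ^(2d). -/

theorem bitLen_le {b : ℕ} {a : ℤ} (h : |a| < 2 ^ b) : bitLen a ≤ b + 1 := by
  rw [bitLen, Nat.add_le_add_iff_right, Nat.size_le]
  rw [Int.abs_eq_natAbs] at h
  exact_mod_cast h

/-- Started in state `s`, the program `P` halts in a state satisfying `Q`, after time at most the
cost of `k` instructions on integers of absolute value less than `2 ^ b`. -/
def Halts (b : ℕ) (P : Prog) (k : ℕ) (Q : State → Prop) (s : State) : Prop :=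
  ∃ (s' : State) (t : ℕ), Run P s s' t ∧ t ≤ k * (2 * (b + 1) ^ 2) ∧ Q s'

section Halts

variable {b k k' : ℕ} {P P' : Prog} {Q R : State → Prop} {s : State}

theorem Halts.mono (h : Halts b P k R s) (hk : k ≤ k') (hR : ∀ s', R s' → Q s') :
    Halts b P k' Q s := by
  obtain ⟨s', t, h1, h2, h3⟩ := h
  exact ⟨s', t, h1, h2.trans (Nat.mul_le_mul_right _ hk), hR _ h3⟩

theorem Halts.seq (h : Halts b P k R s) (h' : ∀ s', R s' → Halts b P' k' Q s') :
    Halts b (.seq P P') (k + k') Q s := by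
  obtain ⟨s', t, h1, h2, h3⟩ := h
  obtain ⟨s'', t', h1', h2', h3'⟩ := h' s' h3
  exact ⟨s'', t + t', .seq h1 h1', by rw [add_mul]; omega, h3'⟩

theorem halts_skip (h : Q s) : Halts b .skip 1 Q s :=
  ⟨s, 1, .skip s, by have := Nat.one_le_pow 2 (b + 1) (by omega); linarith, h⟩

theorem halts_const {x : ℕ} {c : ℤ} (hc : |c| < 2 ^ b) (h : Q (s.setReg x c)) :
    Halts b (.const x c) 1 Q s :=
  ⟨_, _, .const s x c, by have := bitLen_le hc; nlinarith, h⟩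

/-- Addition costs at most 2 (b + 1) and multiplication at most (b + 1) ^ 2; the unit `2 * (b + 1) ^
2` covers both, so that afterwards only instructions need counting. -/
theorem Op.cost_le {a c : ℤ} (o : Op) (ha : |a| < 2 ^ b) (hc : |c| < 2 ^ b) :
    o.cost a c ≤ 2 * (b + 1) ^ 2 := by
  have h1 := bitLen_le ha
  have h2 := bitLen_le hc
  have h3 := Nat.mul_le_mul h1 h2
  cases o <;> simp only [Op.cost] <;> nlinarith

theorem halts_arith {o : Op} {x y z : ℕ} (a c : ℤ) (hy : s.reg y = a) (hz : s.reg z = c)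
    (ha : |a| < 2 ^ b) (hc : |c| < 2 ^ b) (h : Q (s.setReg x (o.eval a c))) :
    Halts b (.arith o x y z) 1 Q s := by
  subst hy hz
  exact ⟨_, _, .arith s o x y z, by rw [one_mul]; exact o.cost_le ha hc, h⟩

theorem halts_load {x y : ℕ} (a c : ℤ) (hy : s.reg y = a) (hz : s.mem a = c)
    (ha : |a| < 2 ^ b) (hc : |c| < 2 ^ b) (h : Q (s.setReg x c)) : Halts b (.load x y) 1 Q s := by
  subst hy hz
  exact ⟨_, _, .load s x y, by rw [one_mul]; exact Op.add.cost_le ha hc, h⟩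

theorem halts_store {x y : ℕ} (a c : ℤ) (hx : s.reg x = a) (hy : s.reg y = c)
    (ha : |a| < 2 ^ b) (hc : |c| < 2 ^ b) (h : Q (s.setMem a c)) :
    Halts b (.store x y) 1 Q s := by
  subst hx hy
  exact ⟨_, _, .store s x y, by rw [one_mul]; exact Op.add.cost_le ha hc, h⟩

theorem halts_cond {x : ℕ} (hx : |s.reg x| < 2 ^ b) (h : 0 < s.reg x → Halts b P k Q s)
    (h' : ¬ 0 < s.reg x → Halts b P' k Q s) : Halts b (.cond x P P') (k + 1) Q s := by
  have hc : bitLen (s.reg x) ≤ 1 * (2 * (b + 1) ^ 2) := by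
    have := bitLen_le hx
    nlinarith
  by_cases h0 : 0 < s.reg x
  · obtain ⟨s', t, h1, h2, h3⟩ := h h0
    exact ⟨s', _, .cond_pos h0 h1, by rw [add_mul]; omega, h3⟩
  · obtain ⟨s', t, h1, h2, h3⟩ := h' h0
    exact ⟨s', _, .cond_neg h0 h1, by rw [add_mul]; omega, h3⟩

/-- A loop that runs at most `N` times, with an invariant `I` indexed by the number of rounds
that may remain. -/
theorem halts_loop {x : ℕ} (I : ℕ → State → Prop) (N : ℕ) (hb : ∀ j s, I j s → |s.reg x| < 2 ^ b)
    (h0 : ∀ s, I 0 s → ¬ 0 < s.reg x)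
    (step : ∀ j < N, ∀ s, I (j + 1) s → 0 < s.reg x → Halts b P k (I j) s) (hs : I N s)
    (hQ : ∀ j s, I j s → ¬ 0 < s.reg x → Q s) : Halts b (.loop x P) (N * (k + 1) + 1) Q s := by
  induction N generalizing s with
  | zero =>
    refine ⟨s, _, .loop_neg (h0 s hs), ?_, hQ 0 s hs (h0 s hs)⟩
    have := bitLen_le (hb 0 s hs)
    nlinarith
  | succ N ih =>
    have hc := bitLen_le (hb _ s hs)
    by_cases hx : 0 < s.reg x
    · obtain ⟨s', t, h1, h2, h3⟩ := step N (by omega) s hs hx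
      obtain ⟨s'', t', h1', h2', h3'⟩ := ih (fun j hj => step j (by omega)) h3
      refine ⟨s'', _, .loop_pos hx h1 h1', ?_, h3'⟩
      nlinarith
    · refine ⟨s, _, .loop_neg hx, ?_, hQ _ s hs hx⟩
      have : 1 * (2 * (b + 1) ^ 2) ≤ ((N + 1) * (k + 1) + 1) * (2 * (b + 1) ^ 2) :=
        Nat.mul_le_mul_right _ (by omega)
      nlinarith

/-- A loop whose register `x` is a counter that runs down to `0`. -/
theorem halts_loop_counter {x : ℕ} (I : ℕ → State → Prop) (N : ℕ) (hN : (N : ℤ) < 2 ^ b)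
    (step : ∀ j < N, ∀ s, s.reg x = ((j + 1 : ℕ) : ℤ) → I (j + 1) s →
      Halts b P k (fun s' => s'.reg x = (j : ℤ) ∧ I j s') s)
    (hx : s.reg x = N) (hs : I N s) (hQ : ∀ s, s.reg x = 0 → I 0 s → Q s) :
    Halts b (.loop x P) (N * (k + 1) + 1) Q s := by
  refine halts_loop (fun j s => j ≤ N ∧ s.reg x = (j : ℤ) ∧ I j s) N (fun j s h => ?_) (fun s h => ?_)
    (fun j hj s h _ => ?_) ⟨le_rfl, hx, hs⟩ (fun j s h h' => ?_)
  · rw [h.2.1, abs_of_nonneg (by positivity)]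
    exact lt_of_le_of_lt (by exact_mod_cast h.1) hN
  · simp [h.2.1]
  · exact (step j hj s h.2.1 h.2.2).mono le_rfl fun s' h' => ⟨hj.le, h'⟩
  · obtain rfl : j = 0 := by
      have := h.2.1
      omega
    exact hQ s h.2.1 h.2.2

/-- This lemma and the next three execute the first instruction of a sequence symbolically. Since
the count has the form `k + 1`, later proofs first rewrite their time bound by `Halts.mono` as a sum
whose shape follows the program. -/
theorem Halts.seq_const {x : ℕ} {c : ℤ} (hc : |c| < 2 ^ b) (h : Halts b P k Q (s.setReg x c)) :
    Halts b (.seq (.const x c) P) (k + 1) Q s :=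
  Nat.add_comm 1 k ▸ (halts_const hc rfl : Halts b (.const x c) 1 (· = _) s).seq fun _ h' => h' ▸ h

theorem Halts.seq_arith {o : Op} {x y z : ℕ} (a c : ℤ) (hy : s.reg y = a) (hz : s.reg z = c)
    (ha : |a| < 2 ^ b) (hc : |c| < 2 ^ b) (h : Halts b P k Q (s.setReg x (o.eval a c))) :
    Halts b (.seq (.arith o x y z) P) (k + 1) Q s :=
  Nat.add_comm 1 k ▸ (halts_arith a c hy hz ha hc rfl : Halts b (.arith o x y z) 1 (· = _) s).seq
    fun _ h' => h' ▸ h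

theorem Halts.seq_load {x y : ℕ} (a c : ℤ) (hy : s.reg y = a) (hz : s.mem a = c)
    (ha : |a| < 2 ^ b) (hc : |c| < 2 ^ b) (h : Halts b P k Q (s.setReg x c)) :
    Halts b (.seq (.load x y) P) (k + 1) Q s :=
  Nat.add_comm 1 k ▸ (halts_load a c hy hz ha hc rfl : Halts b (.load x y) 1 (· = _) s).seq
    fun _ h' => h' ▸ h

theorem Halts.seq_store {x y : ℕ} (a c : ℤ) (hy : s.reg x = a) (hz : s.reg y = c)
    (ha : |a| < 2 ^ b) (hc : |c| < 2 ^ b) (h : Halts b P k Q (s.setMem a c)) :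
    Halts b (.seq (.store x y) P) (k + 1) Q s :=
  Nat.add_comm 1 k ▸ (halts_store a c hy hz ha hc rfl : Halts b (.store x y) 1 (· = _) s).seq
    fun _ h' => h' ▸ h

end Halts

@[simp] theorem State.reg_setReg (s : State) (x y : ℕ) (a : ℤ) :
    (s.setReg x a).reg y = if y = x then a else s.reg y := by
  simp [State.setReg, Function.update_apply]

@[simp] theorem State.mem_setReg (s : State) (x : ℕ) (a : ℤ) : (s.setReg x a).mem = s.mem := rfl

@[simp] theorem State.reg_setMem (s : State) (i a : ℤ) : (s.setMem i a).reg = s.reg := rfl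

@[simp] theorem State.mem_setMem (s : State) (i a : ℤ) :
    (s.setMem i a).mem = Function.update s.mem i a := rfl

end Ram

/-! ### Sets of natural numbers as bit masks -/

/-- The integer whose binary digits describe the finite set `S`. -/
def bitMask (S : Finset ℕ) : ℕ := ∑ i ∈ S, 2 ^ i

theorem bitMask_injective : Function.Injective bitMask := Finset.geomSum_injective le_rfl

theorem bitMask_insert {S : Finset ℕ} {i : ℕ} (hi : i ∉ S) :
    bitMask (insert i S) = bitMask S + 2 ^ i := by
  rw [bitMask, Finset.sum_insert hi, add_comm, bitMask]

theorem bitMask_range (N : ℕ) : bitMask (Finset.range N) + 1 = 2 ^ N := by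
  induction N with
  | zero => rfl
  | succ N ih =>
    rw [Finset.range_add_one, bitMask_insert (by simp), pow_succ]
    omega

theorem bitMask_mono {S T : Finset ℕ} (h : S ⊆ T) : bitMask S ≤ bitMask T :=
  Finset.sum_le_sum_of_subset h

/-- Each element i of S contributes 2 ^ i to the mask, while all elements below N together
contribute 2 ^ N - 1. Containment in an initial segment is thus tested by one comparison of
integers. -/
theorem bitMask_lt_iff {S : Finset ℕ} {N : ℕ} : bitMask S < 2 ^ N ↔ S ⊆ Finset.range N := by
  constructor
  · intro h i hi
    rw [Finset.mem_range]
    have h1 : 2 ^ i ≤ bitMask S := Finset.single_le_sum (f := fun i => 2 ^ i) (by simp) hi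
    exact (Nat.pow_lt_pow_iff_right (by norm_num)).1 (h1.trans_lt h)
  · intro h
    have := bitMask_mono h
    have := bitMask_range N
    omega

/-- The product of `t - i` over all positions `i` of digits `1` of `m`. -/
def bitProd (m : ℕ) (t : ℤ) : ℤ := (m.bitIndices.map fun i : ℕ => t - i).prod

theorem bitProd_bitMask (S : Finset ℕ) (t : ℤ) : bitProd (bitMask S) t = ∏ i ∈ S, (t - i) := by
  have h := Finset.toFinset_bitIndices_sum_two_pow S
  conv_rhs => rw [← h]
  rw [List.prod_toFinset _ Nat.bitIndices_nodup]
  rfl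

theorem bitProd_zero (t : ℤ) : bitProd 0 t = 1 := by simp [bitProd]

/-- Halving the mask moves every position down by one, which is compensated by passing from t to t -
1. This is one round of `bitProdProg`. -/
theorem bitProd_step (m : ℕ) (t : ℤ) :
    bitProd m t = (if 0 < m % 2 then t else 1) * bitProd (m / 2) (t - 1) := by
  have hsh : ∀ l : List ℕ, (l.map fun i : ℕ => t - ((i + 1 : ℕ) : ℤ)) =
      l.map fun i : ℕ => t - 1 - i := by
    intro l
    refine List.map_congr_left fun i _ => ?_
    push_cast
    ring
  obtain ⟨k, rfl | rfl⟩ : ∃ k, m = 2 * k ∨ m = 2 * k + 1 := ⟨m / 2, by omega⟩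
  · rw [if_neg (by omega), one_mul, Nat.mul_div_cancel_left k (by norm_num), bitProd, bitProd,
      Nat.bitIndices_two_mul, List.map_map, ← hsh]
    rfl
  · rw [if_pos (by omega), show (2 * k + 1) / 2 = k by omega, bitProd, bitProd,
      Nat.bitIndices_two_mul_add_one, List.map_cons, List.prod_cons, List.map_map, ← hsh]
    simp [Function.comp_def]

/-- One round of `bitProd_step` increases |t| by at most one and removes one digit, so |t| + h does
not grow and bounds every factor. -/
theorem abs_bitProd_le {K h m : ℕ} {t : ℤ} (hm : m < 2 ^ h) (ht : |t| + h ≤ 2 ^ K) :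
    |bitProd m t| ≤ 2 ^ (K * h) := by
  induction h generalizing m t with
  | zero =>
    obtain rfl : m = 0 := by simpa using hm
    simp [bitProd_zero]
  | succ h ih =>
    have h1 : |t - 1| + h ≤ 2 ^ K := by
      refine le_trans ?_ ht
      have := abs_sub t 1
      push_cast
      simp at this
      linarith
    rw [bitProd_step, abs_mul, Nat.mul_succ, add_comm, pow_add]
    refine mul_le_mul ?_ (ih (by rw [pow_succ] at hm; omega) h1) (abs_nonneg _) (by positivity)
    split_ifs
    · push_cast at ht
      have : (0 : ℤ) ≤ h := by positivity
      linarith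
    · rw [abs_one]; exact one_le_pow₀ (by norm_num)

/-! ### Weighted sums over walks -/

open Polynomial in
/-- The sum, over all walks with `r + 1` edges from `v` to `u`, of the squared differences of the
labels of all pairs formed by an inner vertex of the walk and an earlier inner vertex or an element
of `M`. -/
def walkWeight {V : Type*} [Fintype V] (adj : V → V → Prop) [DecidableRel adj] (a : V → ℤ) (u : V) :
    ℕ → V → Multiset ℤ → ℤ
  | 0, v, _ => if adj v u then 1 else 0
  | r + 1, v, M => ∑ w, if adj v w then
      (M.map fun x => (a w - x) ^ 2).prod * walkWeight adj a u r w (a w ::ₘ M) else 0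

section WalkWeight

variable {V : Type*} [Fintype V] (adj : V → V → Prop) [DecidableRel adj] (a : V → ℤ) (u : V)

theorem Multiset.prod_map_sq_nonneg (M : Multiset ℤ) (b : ℤ) :
    0 ≤ (M.map fun x => (b - x) ^ 2).prod := by
  refine Multiset.prod_nonneg fun x hx => ?_
  obtain ⟨y, -, rfl⟩ := Multiset.mem_map.1 hx
  exact sq_nonneg _

/-- This is what the squares are for: without cancellation, one good walk suffices to make the sum
positive. -/
theorem walkWeight_nonneg (r : ℕ) (v : V) (M : Multiset ℤ) : 0 ≤ walkWeight adj a u r v M := by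
  induction r generalizing v M with
  | zero => rw [walkWeight]; split_ifs <;> simp
  | succ r ih =>
    rw [walkWeight]
    refine Finset.sum_nonneg fun w _ => ?_
    split_ifs
    · exact mul_nonneg (M.prod_map_sq_nonneg _) (ih _ _)
    · exact le_rfl

-- Each of the r inner vertices still to be chosen contributes one factor (a w - t) ^ 2 that
-- involves t, hence degree two per vertex.
open Polynomial in
theorem exists_polynomial_walkWeight (r : ℕ) (v : V) (M : Multiset ℤ) :
    ∃ p : ℤ[X], p.natDegree ≤ 2 * r ∧ ∀ t, walkWeight adj a u r v (t ::ₘ M) = p.eval t := by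
  induction r generalizing v M with
  | zero => exact ⟨C (if adj v u then 1 else 0), (natDegree_C _).le, fun t => by
      rw [walkWeight, eval_C]⟩
  | succ r ih =>
    choose p hp hp' using fun w => ih w (a w ::ₘ M)
    refine ⟨∑ w, if adj v w then
      (C (a w) - X) ^ 2 * (C (M.map fun x => (a w - x) ^ 2).prod * p w) else 0, ?_, fun t => ?_⟩
    · refine natDegree_sum_le_of_forall_le _ _ fun w _ => ?_
      split_ifs
      · refine natDegree_mul_le.trans ?_
        have h1 : ((C (a w) - X : ℤ[X]) ^ 2).natDegree ≤ 2 :=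
          natDegree_pow_le_of_le 2 (m := 1) (by
            refine (natDegree_sub_le _ _).trans ?_
            simp)
        have h2 := (natDegree_C_mul_le (M.map fun x => (a w - x) ^ 2).prod (p w)).trans (hp w)
        omega
      · simp
    · rw [walkWeight, eval_finsetSum]
      refine Finset.sum_congr rfl fun w _ => ?_
      split_ifs
      · rw [Multiset.cons_swap, hp' w]
        simp only [Multiset.map_cons, Multiset.prod_cons, eval_mul, eval_pow, eval_sub, eval_C,
          eval_X]
        ring
      · simp

/-- Each of the r choices has at most `Fintype.card V` possibilities and multiplies the weight by at
most m squares, each at most A ^ 2. -/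
theorem walkWeight_le {A : ℤ} (hA : 1 ≤ A) (ha : ∀ w w', |a w - a w'| ≤ A) (m r : ℕ) (v : V)
    (M : Multiset ℤ) (hM : ∀ x ∈ M, ∀ w, |a w - x| ≤ A) (hm : M.card + r ≤ m) :
    walkWeight adj a u r v M ≤ (Fintype.card V * A ^ (2 * m)) ^ r := by
  induction r generalizing v M with
  | zero => rw [walkWeight]; split_ifs <;> simp
  | succ r ih =>
    rw [walkWeight, pow_succ', mul_assoc, ← nsmul_eq_mul, ← Finset.card_univ]
    refine Finset.sum_le_card_nsmul _ _ _ fun w _ => ?_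
    have h0 : 0 ≤ A ^ (2 * m) * (Fintype.card V * A ^ (2 * m)) ^ r := by positivity
    split_ifs
    · refine mul_le_mul ?_ (ih w _ ?_ ?_) (walkWeight_nonneg _ _ _ _ _ _) (by positivity)
      · have key : ∀ L : Multiset ℤ, (∀ x ∈ L, |a w - x| ≤ A) →
            (L.map fun x => (a w - x) ^ 2).prod ≤ A ^ (2 * L.card) := by
          intro L
          induction L using Multiset.induction with
          | empty => simp
          | cons y L ih =>
            intro h
            rw [Multiset.map_cons, Multiset.prod_cons, Multiset.card_cons, Nat.mul_succ, add_comm,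
              pow_add]
            refine mul_le_mul ?_ (ih fun x hx => h x (Multiset.mem_cons_of_mem hx))
              (L.prod_map_sq_nonneg _) (by positivity)
            rw [← sq_abs]
            exact pow_le_pow_left₀ (abs_nonneg _) (h y (Multiset.mem_cons_self _ _)) 2
        exact (key M fun x hx => hM x hx w).trans (pow_le_pow_right₀ hA (by omega))
      · intro x hx w'
        rcases Multiset.mem_cons.1 hx with rfl | hx
        · exact ha _ _
        · exact hM x hx w'
      · rw [Multiset.card_cons]; omega
    · exact h0

/-- A product of squared differences vanishes exactly when a label is repeated. The indices in
`Set.Ioc 0 r` are those of the inner vertices; the end points v and u are constrained only through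
M. -/
theorem walkWeight_pos_iff (ha : Function.Injective a) (r : ℕ) (v : V) (M : Multiset ℤ) :
    0 < walkWeight adj a u r v M ↔ ∃ w : ℕ → V, w 0 = v ∧ w (r + 1) = u ∧
      (∀ i < r + 1, adj (w i) (w (i + 1))) ∧ (∀ i ∈ Set.Ioc 0 r, a (w i) ∉ M) ∧
      Set.InjOn w (Set.Ioc 0 r) := by
  induction r generalizing v M with
  | zero =>
    rw [walkWeight]
    constructor
    · intro h
      have h' : adj v u := by
        by_contra h'
        simp [h'] at h
      exact ⟨fun i => if i = 0 then v else u, by simp, by simp, by simpa using h', by simp,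
        by simp⟩
    · rintro ⟨w, rfl, rfl, h, -⟩
      have := h 0 (by simp)
      simp_all
  | succ r ih =>
    have hnn : ∀ w ∈ Finset.univ, 0 ≤ if adj v w then
        (M.map fun x => (a w - x) ^ 2).prod * walkWeight adj a u r w (a w ::ₘ M) else 0 := by
      intro w _
      split_ifs
      · exact mul_nonneg (M.prod_map_sq_nonneg _) (walkWeight_nonneg _ _ _ _ _ _)
      · exact le_rfl
    have hprod : ∀ w, 0 < (M.map fun x => (a w - x) ^ 2).prod ↔ a w ∉ M := by
      intro w
      rw [(M.prod_map_sq_nonneg _).lt_iff_ne, ne_comm, Ne, Multiset.prod_eq_zero_iff,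
        Multiset.mem_map]
      simp only [ne_eq, OfNat.ofNat_ne_zero, not_false_eq_true, pow_eq_zero_iff, sub_eq_zero,
        exists_eq_right']
    have hpos : 0 < walkWeight adj a u (r + 1) v M ↔
        ∃ w, adj v w ∧ a w ∉ M ∧ 0 < walkWeight adj a u r w (a w ::ₘ M) := by
      rw [walkWeight, Finset.sum_pos_iff_of_nonneg hnn]
      refine exists_congr fun w => ?_
      rw [← hprod]
      by_cases h : adj v w
      · simp only [Finset.mem_univ, h, if_true, true_and]
        constructor
        · intro h'
          have h1 := pos_of_mul_pos_left h' (walkWeight_nonneg _ _ _ _ _ _)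
          exact ⟨h1, pos_of_mul_pos_right h' h1.le⟩
        · exact fun h' => mul_pos h'.1 h'.2
      · simp [h]
    rw [hpos]
    constructor
    · rintro ⟨w, hw, hwM, h⟩
      obtain ⟨f, rfl, hfu, hf, hfM, hfi⟩ := (ih _ _).1 h
      -- The walk from w is prolonged by v at the front, which shifts its indices by one.
      refine ⟨fun i => if i = 0 then v else f (i - 1), by simp, by simpa using hfu, ?_, ?_, ?_⟩
      · rintro (_ | i) hi
        · simpa using hw
        · simpa using hf i (by omega)
      · rintro (_ | _ | i) hi
        · simp at hi
        · simpa using hwM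
        · have := hfM (i + 1) ⟨by omega, by have := hi.2; omega⟩
          simp only [Multiset.mem_cons, not_or] at this
          simpa using this.2
      · rintro (_ | i) hi (_ | j) hj hij
        · rfl
        · simp at hi
        · simp at hj
        · simp only [Nat.add_eq_zero_iff, one_ne_zero, and_false, if_false,
            Nat.add_sub_cancel] at hij
          simp only [Set.mem_Ioc] at hi hj
          rcases Nat.eq_zero_or_pos i with rfl | hi0 <;> rcases Nat.eq_zero_or_pos j with rfl | hj0
          · rfl
          · exact absurd (Multiset.mem_cons.2 (Or.inl (congrArg a hij.symm)))
              (hfM j ⟨hj0, by omega⟩)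
          · exact absurd (Multiset.mem_cons.2 (Or.inl (congrArg a hij)))
              (hfM i ⟨hi0, by omega⟩)
          · rw [hfi ⟨hi0, by omega⟩ ⟨hj0, by omega⟩ hij]
    · rintro ⟨f, rfl, hfu, hf, hfM, hfi⟩
      refine ⟨f 1, hf 0 (by omega), hfM 1 ⟨by omega, by omega⟩, (ih _ _).2
        ⟨fun i => f (i + 1), rfl, hfu, fun i hi => hf (i + 1) (by omega), fun i hi => ?_, ?_⟩⟩
      · have h1 := hi.1
        have h2 := hi.2
        rw [Multiset.mem_cons, not_or]
        refine ⟨fun h => ?_, hfM (i + 1) ⟨by omega, by omega⟩⟩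
        have := hfi (x₁ := i + 1) ⟨by omega, by omega⟩ (x₂ := 1) ⟨by omega, by omega⟩ (ha h)
        omega
      · intro i hi j hj hij
        have h1 := hi.2
        have h2 := hj.2
        have := hfi (x₁ := i + 1) ⟨by omega, by omega⟩ (x₂ := j + 1) ⟨by omega, by omega⟩ hij
        omega

/-- Remembering the label of u from the start keeps the inner vertices away from u. The labelling
may depend on u, which allows u to have label 0. -/
theorem hasSimpleCycle_iff_exists_walkWeight_pos (G : Digraph V) [DecidableRel G.Adj]
    (a : V → V → ℤ) (ha : ∀ u, Function.Injective (a u)) (r : ℕ) :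
    G.HasSimpleCycle (r + 1) ↔ ∃ u, 0 < walkWeight G.Adj (a u) u r u {a u u} := by
  simp only [walkWeight_pos_iff _ _ _ (ha _), Digraph.HasSimpleCycle]
  constructor
  · rintro ⟨-, w, h, hw, hi⟩
    refine ⟨w 0, w, rfl, h, hw, fun i hir => ?_, hi.mono fun i hir => ?_⟩
    · rw [Multiset.mem_singleton]
      intro h'
      have h1 := hir.1
      have h2 := hir.2
      have := hi (x₁ := i) (by simp only [Set.mem_Iio]; omega) (x₂ := 0) (by simp) (ha _ h')
      omega
    · have h2 := hir.2
      simp only [Set.mem_Iio]; omega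
  · rintro ⟨u, w, rfl, h, hw, hM, hi⟩
    refine ⟨by omega, w, h, hw, fun i hir j hjr hij => ?_⟩
    simp only [Set.mem_Iio] at hir hjr
    rcases Nat.eq_zero_or_pos i with rfl | hi0 <;> rcases Nat.eq_zero_or_pos j with rfl | hj0
    · rfl
    · exact absurd (Multiset.mem_singleton.2 (by rw [hij])) (hM j ⟨hj0, by omega⟩)
    · exact absurd (Multiset.mem_singleton.2 (by rw [hij])) (hM i ⟨hi0, by omega⟩)
    · exact hi ⟨hi0, by omega⟩ ⟨hj0, by omega⟩ hij

end WalkWeight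

/-! ### Undirected cycles as directed cycles -/

/-- An undirected edge yields a directed cycle of length 2, so `3 ≤ d` has to be required
separately. For larger d it is enough that the closed walk without its first edge is a path. -/
theorem SimpleGraph.hasSimpleCycle_iff {V : Type*} (G : SimpleGraph V) (d : ℕ) :
    G.HasSimpleCycle d ↔ 3 ≤ d ∧ (Digraph.mk G.Adj).HasSimpleCycle d := by
  constructor
  · rintro ⟨u, w, hw, rfl⟩
    refine ⟨hw.three_le_length, by have := hw.three_le_length; omega, w.getVert, by simp,
      fun i hi => w.adj_getVert_succ hi, fun i hi j hj hij => ?_⟩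
    simp only [Set.mem_Iio] at hi hj
    exact hw.getVert_injOn' (by simp; omega) (by simp; omega) hij
  · rintro ⟨hd, -, w, h0, hadj, hi⟩
    have key : ∀ k ≤ d, ∃ p : G.Walk (w 0) (w k), p.length = k ∧ ∀ i ≤ k, p.getVert i = w i := by
      clear hd hi h0
      intro k
      induction k with
      | zero => exact fun _ => ⟨SimpleGraph.Walk.nil, rfl, fun i hi => by simp_all⟩
      | succ k ih =>
        intro hk
        obtain ⟨p, hp, hp'⟩ := ih (by omega)
        refine ⟨p.concat (hadj k (by omega)), by simp [hp], fun i hik => ?_⟩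
        rw [SimpleGraph.Walk.concat_eq_append, SimpleGraph.Walk.getVert_append]
        split_ifs with h
        · exact hp' i (by omega)
        · obtain rfl | rfl : i = k ∨ i = k + 1 := by omega
          · simp [hp]
          · simp [hp]
    obtain ⟨p, hp, hp'⟩ := key d le_rfl
    refine ⟨w 0, p.copy rfl h0, ?_, by simp [hp]⟩
    rw [SimpleGraph.Walk.isCycle_iff_isPath_tail_and_le_length]
    refine ⟨?_, by simpa [hp] using hd⟩
    rw [← SimpleGraph.Walk.IsPath.getVert_injOn_iff]
    have hlen := (p.copy rfl h0).length_tail_add_one (by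
      rw [SimpleGraph.Walk.not_nil_iff_lt_length, SimpleGraph.Walk.length_copy]; omega)
    rw [SimpleGraph.Walk.length_copy, hp] at hlen
    intro i hi' j hj' hij
    simp only [Set.mem_ofPred_eq] at hi' hj'
    rw [SimpleGraph.Walk.getVert_tail, SimpleGraph.Walk.getVert_tail,
      SimpleGraph.Walk.getVert_copy, SimpleGraph.Walk.getVert_copy, hp' _ (by omega),
      hp' _ (by omega)] at hij
    have hw : ∀ k < d, ∀ l < d, w k = w l → k = l := fun k hk l hl h => hi hk hl h
    -- The tail visits w 1, ..., w d; its last vertex is w 0, so the index d has to be treated as 0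
    -- before injectivity below d applies.
    rcases Nat.lt_or_ge (i + 1) d with h1 | h1 <;> rcases Nat.lt_or_ge (j + 1) d with h2 | h2
    · have := hw _ h1 _ h2 hij
      omega
    · obtain rfl : d = j + 1 := by omega
      rw [h0] at hij
      have := hw _ h1 0 (by omega) hij
      omega
    · obtain rfl : d = i + 1 := by omega
      rw [h0] at hij
      have := hw 0 (by omega) _ h2 hij
      omega
    · omega

/-! ### Lagrange interpolation at consecutive integers -/

section Interpolation

open Polynomial

/-- Interpolation is stated over ℚ, where the Lagrange basis lives; the left side is nevertheless an
integer, which later makes the only division exact. -/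
theorem Polynomial.eval_eq_sum_nodes (G : ℤ[X]) {N : ℕ} (hG : G.natDegree < N) (t : ℤ) :
    ((G.eval t : ℤ) : ℚ) = ∑ j ∈ Finset.range N, ((G.eval (j : ℤ) : ℤ) : ℚ) *
      ((∏ i ∈ (Finset.range N).erase j, ((t : ℚ) - i)) /
        ∏ i ∈ (Finset.range N).erase j, ((j : ℚ) - i)) := by
  have hinj : Set.InjOn (fun i : ℕ => (i : ℚ)) (Finset.range N) :=
    fun i _ j _ h => Nat.cast_injective h
  have hdeg : (G.map (Int.castRingHom ℚ)).degree < (Finset.range N).card := by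
    rw [Finset.card_range]
    refine (degree_map_le).trans_lt ?_
    exact (degree_le_natDegree).trans_lt (by exact_mod_cast hG)
  have h := congrArg (eval (t : ℚ)) (Lagrange.eq_interpolate hinj hdeg)
  have hev : ∀ x : ℤ, (G.map (Int.castRingHom ℚ)).eval (x : ℚ) = ((G.eval x : ℤ) : ℚ) := by
    intro x
    rw [eval_map, ← eq_intCast (Int.castRingHom ℚ) x, eval₂_at_apply, eq_intCast]
  rw [hev] at h
  rw [h, Lagrange.interpolate_apply, eval_finsetSum]
  refine Finset.sum_congr rfl fun j _ => ?_
  rw [eval_mul, eval_C, Lagrange.basis, eval_prod, ← Finset.prod_div_distrib]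
  congr 1
  · simp
  · refine Finset.prod_congr rfl fun i _ => ?_
    simp [Lagrange.basisDivisor, div_eq_inv_mul]

end Interpolation

/-! ### The number of stored sets -/

section Count

/-- A set of size c in the list is a c-subset of a range of m + 1 - c elements. Summing these
binomial coefficients over an antidiagonal gives a Fibonacci number. -/
theorem List.length_le_fib (m : ℕ) (l : List (Finset ℕ)) (hl : l.Nodup)
    (h : ∀ S ∈ l, S ⊆ Finset.range (m + 1 - S.card)) : l.length ≤ Nat.fib (m + 2) := by
  rw [← List.toFinset_card_of_nodup hl, Nat.fib_succ_eq_sum_choose,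
    Finset.Nat.sum_antidiagonal_eq_sum_range_succ_mk]
  have hsub : l.toFinset ⊆ (Finset.range (m + 2)).biUnion fun k =>
      (Finset.range k).powersetCard (m + 1 - k) := by
    intro S hS
    have h' := h S (List.mem_toFinset.1 hS)
    have hc := Finset.card_le_card h'
    rw [Finset.card_range] at hc
    refine Finset.mem_biUnion.2 ⟨m + 1 - S.card, by simp; omega, ?_⟩
    exact Finset.mem_powersetCard.2 ⟨h', by omega⟩
  refine (Finset.card_le_card hsub).trans (Finset.card_biUnion_le.trans ?_)
  simp

theorem Nat.fib_succ_le_goldenRatio_pow (m : ℕ) : (Nat.fib (m + 1) : ℝ) ≤ Real.goldenRatio ^ m := by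
  induction m using Nat.twoStepInduction with
  | zero => simp
  | one => simpa using Real.one_lt_goldenRatio.le
  | more m h1 h2 =>
    rw [Nat.fib_add_two, Nat.cast_add, pow_add, Real.goldenRatio_sq, mul_add, mul_one, ← pow_succ]
    linarith

theorem Nat.fib_le_two_mul_goldenRatio_pow (d : ℕ) :
    (Nat.fib (2 * d + 2) : ℝ) ≤ 2 * Real.goldenRatio ^ (2 * d) := by
  refine (Nat.fib_succ_le_goldenRatio_pow _).trans ?_
  rw [pow_succ, mul_comm]
  exact mul_le_mul_of_nonneg_right Real.goldenRatio_lt_two.le (by have := Real.goldenRatio_pos; positivity)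

/-- This pays for handling the number d itself when d exceeds n, where no polynomial in n bounds its
bit length. -/
theorem succ_sq_le_two_mul_goldenRatio_pow (d : ℕ) :
    ((d : ℝ) + 1) ^ 2 ≤ 2 * Real.goldenRatio ^ (2 * d) := by
  have h2 : (5 / 2 : ℝ) ≤ Real.goldenRatio ^ 2 := by
    rw [Real.goldenRatio_sq, Real.goldenRatio]
    have : (2 : ℝ) ≤ √5 := Real.le_sqrt_of_sq_le (by norm_num)
    linarith
  rw [pow_mul]
  refine le_trans ?_ (mul_le_mul_of_nonneg_left (pow_le_pow_left₀ (by norm_num) h2 d) zero_le_two)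
  induction d with
  | zero => norm_num
  | succ d ih =>
    rcases Nat.lt_or_ge d 2 with h | h
    · interval_cases d <;> norm_num
    · have h' : (2 : ℝ) ≤ d := by exact_mod_cast h
      rw [pow_succ (5 / 2 : ℝ)]
      push_cast
      nlinarith

end Count

/-! ### Bit bounds and the interpolation subroutine -/

namespace Ram

infixr:60 " ;; " => Prog.seq

/-- The number of bits of a product of `2 * n + 1` integers of absolute value at most
`4 * n + 1`. -/
def prodBits (n : ℕ) : ℕ := (n + 2) * (2 * n + 1)

/-- A bound on the number of bits of all integers that occur for a graph with `n` vertices. -/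
def allBits (n : ℕ) : ℕ := prodBits n * (4 * n + 8)

theorem two_mul_lt_pow_prodBits (n : ℕ) : (8 * n + 8 : ℤ) * 2 ^ (2 * n + 1) ≤ 2 ^ (2 * prodBits n) := by
  have h1 : (n + 1 : ℤ) ≤ 2 ^ n := by exact_mod_cast Nat.lt_two_pow_self
  have h2 : (8 * n + 8 : ℤ) ≤ 2 ^ (n + 3) := by rw [pow_add]; linarith
  calc (8 * n + 8 : ℤ) * 2 ^ (2 * n + 1) ≤ 2 ^ (n + 3) * 2 ^ (2 * n + 1) := by gcongr
    _ = 2 ^ (n + 3 + (2 * n + 1)) := (pow_add _ _ _).symm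
    _ ≤ 2 ^ (2 * prodBits n) := by
      refine pow_le_pow_right₀ (by norm_num) ?_
      rw [prodBits]
      nlinarith

/-- Large integers are measured in blocks of `prodBits n` bits. The longest operands, numerators in
the interpolation, need 3n + 4 blocks, well within the 4n + 8 available. -/
theorem lt_pow_allBits {n c : ℕ} {a : ℤ} (h : |a| ≤ 2 ^ (prodBits n * c)) (hc : c < 4 * n + 8) :
    |a| < 2 ^ allBits n := by
  refine h.trans_lt (pow_lt_pow_right₀ (by norm_num) ?_)
  exact (Nat.mul_lt_mul_left (by rw [prodBits]; positivity)).2 hc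

theorem lt_pow_allBits_of_le {n : ℕ} {a : ℤ} (h : |a| ≤ (8 * n + 8) * 2 ^ (2 * n + 1)) :
    |a| < 2 ^ allBits n :=
  lt_pow_allBits (c := 2) (by rw [mul_comm]; exact h.trans (two_mul_lt_pow_prodBits n)) (by omega)

theorem lt_pow_allBits_of_le' {n : ℕ} {a : ℤ} (h : |a| ≤ 8 * n + 8) : |a| < 2 ^ allBits n := by
  refine lt_pow_allBits_of_le (h.trans ?_)
  have : (1 : ℤ) ≤ 2 ^ (2 * n + 1) := one_le_pow₀ (by norm_num)
  nlinarith

theorem abs_bitProd_le_prodBits {n m : ℕ} {t : ℤ} (hm : m < 2 ^ (2 * n + 1)) (ht : |t| ≤ 2 * n) :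
    |bitProd m t| ≤ 2 ^ prodBits n := by
  refine abs_bitProd_le hm ?_
  have h1 : (n + 1 : ℤ) ≤ 2 ^ n := by exact_mod_cast Nat.lt_two_pow_self
  rw [pow_add]
  push_cast
  linarith

/-- Computes `bitProd m t` in register `42`, where `m` and `t` are the contents of the registers
`40` and `41`. -/
def bitProdProg : Prog :=
  .const 42 1 ;; .loop 40 (.arith .mod 43 40 3 ;; .arith .div 40 40 3 ;;
    .cond 43 (.arith .mul 42 42 41) .skip ;; .arith .sub 41 41 2)

theorem halts_bitProdProg {n m : ℕ} {t : ℤ} {s : State} (h2 : s.reg 2 = 1) (h3 : s.reg 3 = 2)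
    (h40 : s.reg 40 = m) (h41 : s.reg 41 = t) (hm : m < 2 ^ (2 * n + 1)) (ht : |t| ≤ 2 * n) :
    Halts (allBits n) bitProdProg ((2 * n + 1) * 6 + 2) (fun s' => s'.reg 42 = bitProd m t ∧
      (∀ r < 40, s'.reg r = s.reg r) ∧ s'.mem = s.mem) s := by
  have hK : (4 * n + 1 : ℤ) ≤ 2 ^ (n + 2) := by
    have h1 : (n + 1 : ℤ) ≤ 2 ^ n := by exact_mod_cast Nat.lt_two_pow_self
    rw [pow_add]
    linarith
  have small : ∀ a : ℤ, |a| ≤ 8 * n + 8 → |a| < 2 ^ allBits n := fun a => lt_pow_allBits_of_le'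
  refine Halts.seq_const (small _ (by rw [abs_one]; linarith)) ?_
  -- With at most j digits left, the accumulated product times `bitProd` of the remaining data is
  -- constant. The bound |t'| + j ≤ 4n + 1 keeps each factor below 2 ^ (n + 2).
  refine halts_loop (k := 5) (fun j s' => j ≤ 2 * n + 1 ∧ ∃ (m' : ℕ) (t' : ℤ), s'.reg 40 = m' ∧
    m' < 2 ^ j ∧ s'.reg 41 = t' ∧ |t'| + j ≤ 4 * n + 1 ∧ s'.reg 42 * bitProd m' t' = bitProd m t ∧
    |s'.reg 42| ≤ 2 ^ ((n + 2) * (2 * n + 1 - j)) ∧ (∀ r < 40, s'.reg r = s.reg r) ∧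
    s'.mem = s.mem) (2 * n + 1) ?_ ?_ ?_ ?_ ?_
  · rintro j s' ⟨hj, m', t', h1, h2, -⟩
    rw [h1, Nat.abs_cast]
    refine lt_of_le_of_lt (le_abs_self _) (lt_pow_allBits_of_le ?_)
    rw [Nat.abs_cast]
    have : m' < 2 ^ (2 * n + 1) := h2.trans_le (Nat.pow_le_pow_right (by norm_num) hj)
    have h4 : (m' : ℤ) ≤ 2 ^ (2 * n + 1) := by exact_mod_cast this.le
    nlinarith
  · rintro s' ⟨-, m', t', h1, h2, -⟩
    obtain rfl : m' = 0 := by simpa using h2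
    simp [h1]
  · rintro j hj s' ⟨-, m', t', h40', hm', h41', ht', hp, hb, hr, hmem⟩ hpos
    have r2 : s'.reg 2 = 1 := by rw [hr 2 (by norm_num), h2]
    have r3 : s'.reg 3 = 2 := by rw [hr 3 (by norm_num), h3]
    have b40 : |(m' : ℤ)| < 2 ^ allBits n := by
      refine lt_pow_allBits_of_le ?_
      rw [Nat.abs_cast]
      have : m' < 2 ^ (2 * n + 1) := hm'.trans_le (Nat.pow_le_pow_right (by norm_num) (by omega))
      have h4 : (m' : ℤ) ≤ 2 ^ (2 * n + 1) := by exact_mod_cast this.le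
      nlinarith
    have b41 : |t'| ≤ 4 * n := by push_cast at ht'; linarith
    have b41' : |t'| < 2 ^ allBits n := small _ (by linarith)
    have b2 : |(2 : ℤ)| < 2 ^ allBits n := small _ (by norm_num; linarith)
    have b1 : |(1 : ℤ)| < 2 ^ allBits n := small _ (by norm_num; linarith)
    have b42 : |s'.reg 42| < 2 ^ allBits n := by
      refine lt_pow_allBits (c := 1) (hb.trans (pow_le_pow_right₀ (by norm_num) ?_)) (by omega)
      rw [mul_one, prodBits]
      exact Nat.mul_le_mul_left _ (by omega)
    have hstep := bitProd_step m' t'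
    have ht1 : |t' - 1| + j ≤ 4 * n + 1 := by
      have := abs_sub t' 1
      push_cast at ht'
      simp at this
      linarith
    have hle : (2 : ℤ) ^ ((n + 2) * (2 * n + 1 - (j + 1))) ≤
        2 ^ ((n + 2) * (2 * n + 1 - j)) := pow_le_pow_right₀ (by norm_num)
          (Nat.mul_le_mul_left _ (by omega))
    have hmod : (m' : ℤ) % 2 = ((m' % 2 : ℕ) : ℤ) := by push_cast; rfl
    have hdiv : (m' : ℤ) / 2 = ((m' / 2 : ℕ) : ℤ) := by push_cast; rfl
    have hlt : m' / 2 < 2 ^ j := by rw [pow_succ] at hm'; omega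
    refine Halts.seq_arith m' 2 (by simp [h40']) (by simp [r3]) b40 b2 ?_
    refine Halts.seq_arith m' 2 (by simp [h40']) (by simp [r3]) b40 b2 ?_
    refine Halts.seq (k := 2) (k' := 1) (R := fun s'' => s''.reg 42 = s'.reg 42 * (if 0 < m' % 2 then t' else 1) ∧
      s''.reg 40 = (m' / 2 : ℕ) ∧ s''.reg 41 = t' ∧ (∀ r < 40, s''.reg r = s'.reg r) ∧
      s''.mem = s'.mem) ?_ ?_
    · refine halts_cond ?_ (fun hc => ?_) fun hc => ?_
      · simp only [State.reg_setReg, Op.eval, hmod, Nat.reduceEqDiff, ↓reduceIte]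
        exact small _ (by rw [Nat.abs_cast]; omega)
      · refine halts_arith (s'.reg 42) t' (by simp) (by simp [h41']) b42 b41' ?_
        simp only [State.reg_setReg, State.mem_setReg, Op.eval, hmod, hdiv,
          Nat.reduceEqDiff, ↓reduceIte] at hc ⊢
        rw [if_pos (by omega)]
        refine ⟨rfl, trivial, h41', fun r hr => ?_, trivial⟩
        rw [if_neg (by omega), if_neg (by omega), if_neg (by omega)]
      · refine halts_skip ?_
        simp only [State.reg_setReg, State.mem_setReg, Op.eval, hmod, hdiv,
          Nat.reduceEqDiff, ↓reduceIte] at hc ⊢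
        rw [if_neg (by omega)]
        refine ⟨by rw [mul_one], trivial, h41', fun r hr => ?_, trivial⟩
        rw [if_neg (by omega), if_neg (by omega)]
    · rintro s'' ⟨e42, e40, e41, er, emem⟩
      refine halts_arith t' 1 e41 (by rw [er 2 (by norm_num), r2]) b41' b1 ?_
      refine ⟨by omega, m' / 2, t' - 1, by simp [e40], hlt,
        by simp [Op.eval], ht1, ?_, ?_, fun r hr' => ?_, ?_⟩
      · simp only [State.reg_setReg]
        norm_num
        rw [e42, mul_assoc, ← hstep, hp]
      · simp only [State.reg_setReg]
        norm_num
        rw [e42, abs_mul, show 2 * n + 1 - j = 2 * n + 1 - (j + 1) + 1 by omega, Nat.mul_succ,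
          pow_add]
        refine mul_le_mul hb ?_ (abs_nonneg _) (by positivity)
        split_ifs
        · linarith
        · rw [abs_one]; exact one_le_pow₀ (by norm_num)
      · simp only [State.reg_setReg]
        rw [if_neg (by omega), er r hr', hr r hr']
      · rw [State.mem_setReg, emem, hmem]
  · refine ⟨le_rfl, m, t, by simp [h40], hm, by simp [h41], by push_cast; linarith, by simp,
      by simp, fun r hr => by simp; omega, rfl⟩
  · rintro j s' ⟨-, m', t', h40', hm', -, -, hp, -, hr, hmem⟩ hpos
    refine ⟨?_, hr, hmem⟩
    obtain rfl : m' = 0 := by rw [h40'] at hpos; omega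
    rwa [bitProd_zero, mul_one] at hp

/-- The contents of the registers that stay fixed throughout the main part of the program. -/
structure Setup (n d : ℕ) (s : State) : Prop where
  r0 : s.reg 0 = n
  r1 : s.reg 1 = d
  r2 : s.reg 2 = 1
  r3 : s.reg 3 = 2
  r4 : s.reg 4 = 0
  r5 : s.reg 5 = (n : ℤ) * n
  r7 : s.reg 7 = 2 * (d : ℤ)

theorem Setup.congr {n d : ℕ} {s s' : State} (h : Setup n d s) (hr : ∀ r < 8, s'.reg r = s.reg r) :
    Setup n d s' where
  r0 := (hr 0 (by norm_num)).trans h.r0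
  r1 := (hr 1 (by norm_num)).trans h.r1
  r2 := (hr 2 (by norm_num)).trans h.r2
  r3 := (hr 3 (by norm_num)).trans h.r3
  r4 := (hr 4 (by norm_num)).trans h.r4
  r5 := (hr 5 (by norm_num)).trans h.r5
  r7 := (hr 7 (by norm_num)).trans h.r7

/-- Computes `bitProd m t` in register `x`, where `m` and `t` are the contents of the registers
`y` and `z`. -/
def bitProdCall (x y z : ℕ) : Prog :=
  .arith .add 40 y 4 ;; .arith .add 41 z 4 ;; bitProdProg ;; .arith .add x 42 4

def bitProdCallTime (n : ℕ) : ℕ := (2 * n + 1) * 6 + 5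

theorem cast_lt_pow_allBits {n m : ℕ} (hm : m < 2 ^ (2 * n + 1)) : |(m : ℤ)| < 2 ^ allBits n := by
  refine lt_pow_allBits_of_le ?_
  rw [Nat.abs_cast]
  have h4 : (m : ℤ) ≤ 2 ^ (2 * n + 1) := by exact_mod_cast hm.le
  nlinarith

theorem halts_bitProdCall {n d m x y z : ℕ} {t : ℤ} {s : State} (hs : Setup n d s)
    (hz' : z < 40) (hy : s.reg y = m) (hz : s.reg z = t)
    (hm : m < 2 ^ (2 * n + 1)) (ht : |t| ≤ 2 * n) :
    Halts (allBits n) (bitProdCall x y z) (bitProdCallTime n)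
      (fun s' => (∀ r < 40, s'.reg r = if r = x then bitProd m t else s.reg r) ∧
        s'.mem = s.mem) s := by
  have b0 : |(0 : ℤ)| < 2 ^ allBits n := lt_pow_allBits_of_le' (by norm_num; linarith)
  refine Halts.seq_arith m 0 hy hs.r4 (cast_lt_pow_allBits hm) b0 ?_
  refine Halts.seq_arith t 0 (by simp [hz, hz'.ne]) (by simp [hs.r4])
    (lt_pow_allBits_of_le' (by linarith)) b0 ?_
  refine Halts.seq (k' := 1) (halts_bitProdProg (n := n) (m := m) (t := t) (by simp [hs.r2])
    (by simp [hs.r3]) (by simp [Op.eval]) (by simp [Op.eval]) hm ht) ?_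
  rintro s' ⟨h42, hr, hmem⟩
  refine halts_arith (bitProd m t) 0 h42 (by rw [hr 4 (by norm_num)]; simp [hs.r4])
    (lt_pow_allBits (c := 1) (by simpa using abs_bitProd_le_prodBits hm ht) (by omega)) b0 ?_
  refine ⟨fun r hr' => ?_, by simp [hmem]⟩
  have h1 : r ≠ 40 := by omega
  have h2 : r ≠ 41 := by omega
  simp [Op.eval, hr r hr', h1, h2]

/-- The address of the table entry for the mask `m` and the vertex `v`. -/
def tableAddr (n m v : ℕ) : ℤ := (m : ℤ) * n + v + (n : ℤ) * n

/-- The bound on m is twice the bound on masks because the interpolation also forms S + 2 ^ j for j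
in S, where a carry occurs. -/
theorem tableAddr_bounds {n m v : ℕ} (hm : m ≤ 2 * 2 ^ (2 * n + 1)) (hv : v < n) :
    |(m : ℤ)| < 2 ^ allBits n ∧ |(m : ℤ) * n| < 2 ^ allBits n ∧
    |(m : ℤ) * n + v| < 2 ^ allBits n ∧ |(n : ℤ) * n| < 2 ^ allBits n ∧
    |tableAddr n m v| < 2 ^ allBits n ∧ |(v : ℤ)| < 2 ^ allBits n := by
  have hm' : (m : ℤ) ≤ 2 * 2 ^ (2 * n + 1) := by exact_mod_cast hm
  have hv' : (v : ℤ) ≤ n := by exact_mod_cast hv.le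
  have hn : (n : ℤ) ≤ 2 ^ (2 * n + 1) := by
    exact_mod_cast Nat.lt_two_pow_self.le.trans (Nat.pow_le_pow_right (n := 2) (by norm_num) (by omega))
  have h1 : (m : ℤ) * n ≤ 2 * 2 ^ (2 * n + 1) * n := by gcongr
  have h2 : (n : ℤ) * n ≤ 2 ^ (2 * n + 1) * n := by gcongr
  have h3 : (1 : ℤ) ≤ n := by exact_mod_cast (Nat.zero_le _).trans_lt hv
  have h4 : (0 : ℤ) ≤ m * n := by positivity
  have h5 : (0 : ℤ) ≤ n * n := by positivity
  have h6 : (2 : ℤ) ^ (2 * n + 1) ≤ 2 ^ (2 * n + 1) * n := le_mul_of_one_le_right (by positivity) h3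
  have key : ∀ a : ℤ, 0 ≤ a → a ≤ m + m * n + v + n * n → |a| < 2 ^ allBits n := by
    refine fun a ha h => lt_pow_allBits_of_le ?_
    rw [abs_of_nonneg ha]
    linarith
  have h7 : (0 : ℤ) ≤ m := by positivity
  have h8 : (0 : ℤ) ≤ v := by positivity
  refine ⟨key _ ?_ ?_, key _ ?_ ?_, key _ ?_ ?_, key _ ?_ ?_, key _ ?_ ?_, key _ ?_ ?_⟩ <;>
    (try rw [tableAddr]) <;> linarith

/-- Computes in register `x` the address of the table entry for the mask in register `y` and the
vertex in register `z`. -/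
def addrProg (x y z : ℕ) : Prog :=
  .arith .mul x y 0 ;; .arith .add x x z ;; .arith .add x x 5

theorem halts_addrProg {n d m v x y z : ℕ} {s : State} (hs : Setup n d s)
    (hm : m ≤ 2 * 2 ^ (2 * n + 1)) (hv : v < n) (hx : 7 < x) (hz' : z ≠ x)
    (hy : s.reg y = m) (hz : s.reg z = v) :
    Halts (allBits n) (addrProg x y z) 3
      (fun s' => (∀ r, s'.reg r = if r = x then tableAddr n m v else s.reg r) ∧
        s'.mem = s.mem) s := by
  obtain ⟨b1, b2, b3, b4, b5, b6⟩ := tableAddr_bounds hm hv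
  refine Halts.seq_arith m n hy hs.r0 b1 (lt_pow_allBits_of_le' (by rw [Nat.abs_cast]; linarith)) ?_
  refine Halts.seq_arith (m * n) v (by simp [Op.eval]) (by simp [hz, hz']) b2 b6 ?_
  have h5 : 5 ≠ x := by omega
  refine halts_arith (m * n + v) (n * n) (by simp [Op.eval]) (by simp [h5, hs.r5]) b3 b4 ?_
  refine ⟨fun r => ?_, rfl⟩
  by_cases h : r = x
  · simp [h, Op.eval, tableAddr]
  · simp [h]

theorem pow_two_lt_pow_allBits {n j : ℕ} (hj : j ≤ 2 * n + 1) : |(2 : ℤ) ^ j| < 2 ^ allBits n := by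
  refine lt_pow_allBits_of_le ?_
  rw [abs_of_nonneg (by positivity)]
  refine (pow_le_pow_right₀ (by norm_num) hj : (2 : ℤ) ^ j ≤ 2 ^ (2 * n + 1)).trans ?_
  have : (0 : ℤ) ≤ 2 ^ (2 * n + 1) := by positivity
  nlinarith

/-- One round of the interpolation: the node `j` is accounted for, where `j + 1` is the content of
register `29`. -/
def interpStep : Prog :=
  .arith .sub 29 29 2 ;; .arith .div 31 31 3 ;; .arith .sub 30 32 31 ;;
  bitProdCall 33 22 29 ;; bitProdCall 34 30 23 ;; bitProdCall 35 30 29 ;;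
  .arith .add 36 22 31 ;; addrProg 36 36 25 ;; .load 36 36 ;;
  .arith .mul 33 33 34 ;; .arith .mul 33 33 36 ;; .arith .mul 33 33 28 ;;
  .arith .mul 27 27 35 ;; .arith .add 27 27 33 ;; .arith .mul 28 28 35

/-- Lagrange interpolation at the nodes `0, …, N - 1`.  The values at the nodes are the products of
`bitProd S j` and of the table entry for the mask `S + 2 ^ j` and the vertex `w`, and the result
is the value at `t`.  Here `S`, `t`, `N`, `w`, `2 ^ N` are the contents of the registers
`22, …, 26`.  The result appears in register `27`. -/
def interpProg : Prog :=
  .const 27 0 ;; .const 28 1 ;; .arith .sub 32 26 2 ;; .arith .add 29 24 4 ;;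
  .arith .add 31 26 4 ;; .loop 29 interpStep ;; .arith .div 27 27 28

def interpStepTime (n : ℕ) : ℕ := 3 * bitProdCallTime n + 14

def interpTime (n : ℕ) : ℕ := 2 * n * (interpStepTime n + 1) + 7

theorem abs_mul_le_pow {L i j : ℕ} {a c : ℤ} (ha : |a| ≤ 2 ^ (L * i)) (hc : |c| ≤ 2 ^ (L * j)) :
    |a * c| ≤ 2 ^ (L * (i + j)) := by
  rw [abs_mul, mul_add, pow_add]
  exact mul_le_mul ha hc (abs_nonneg _) (by positivity)

/-- The mask with all digits below N except the j-th lets one subroutine compute both the numerators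
and the denominators of the Lagrange basis. -/
theorem prod_erase_eq_bitProd {N j : ℕ} (hj : j < N) (t : ℤ) :
    bitProd (2 ^ N - 1 - 2 ^ j) t = ∏ i ∈ (Finset.range N).erase j, (t - i) := by
  rw [← bitProd_bitMask]
  congr 1
  have h1 := bitMask_insert (Finset.notMem_erase j (Finset.range N))
  rw [Finset.insert_erase (Finset.mem_range.2 hj)] at h1
  have := bitMask_range N
  omega

-- Registers 27 and 28 hold numerator a and denominator D of a partial sum. Adding p / q turns them
-- into a q + p D and D q; fractions are never reduced, so all arithmetic here is integral.
set_option maxHeartbeats 400000 in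
theorem halts_interpStep {n d N S w j : ℕ} {t a D : ℤ} {s : State} (hs : Setup n d s)
    (hN : N ≤ 2 * n) (hj : j < N) (hw : w < n) (hS : S < 2 ^ (2 * n + 1)) (ht : |t| ≤ 2 * n)
    (h22 : s.reg 22 = S) (h23 : s.reg 23 = t) (h25 : s.reg 25 = w)
    (h27 : s.reg 27 = a) (h28 : s.reg 28 = D) (h29 : s.reg 29 = (j + 1 : ℕ))
    (h31 : s.reg 31 = 2 ^ (j + 1)) (h32 : s.reg 32 = 2 ^ N - 1)
    (hmb : ∀ a, |s.mem a| ≤ 2 ^ (prodBits n * n))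
    (ha : |a| ≤ 2 ^ (prodBits n * (3 * n + 3))) (hD : |D| ≤ 2 ^ (prodBits n * (2 * n))) :
    Halts (allBits n) interpStep (interpStepTime n) (fun s' => s'.reg 29 = j ∧ s'.reg 31 = 2 ^ j ∧
      s'.reg 32 = 2 ^ N - 1 ∧ s'.reg 28 = D * ∏ i ∈ (Finset.range N).erase j, ((j : ℤ) - i) ∧
      s'.reg 27 = a * ∏ i ∈ (Finset.range N).erase j, ((j : ℤ) - i) +
        bitProd S j * (∏ i ∈ (Finset.range N).erase j, (t - i)) *
          s.mem (tableAddr n (S + 2 ^ j) w) * D ∧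
      (∀ r < 27, s'.reg r = s.reg r) ∧ s'.mem = s.mem) s := by
  have small : ∀ a : ℤ, |a| ≤ 8 * n + 8 → |a| < 2 ^ allBits n := fun a => lt_pow_allBits_of_le'
  have b1 : |(1 : ℤ)| < 2 ^ allBits n := small _ (by norm_num; linarith)
  have b2 : |(2 : ℤ)| < 2 ^ allBits n := small _ (by norm_num; linarith)
  have bj : |((j : ℕ) : ℤ)| ≤ 2 * n := by rw [Nat.abs_cast]; norm_cast; omega
  have hj2 : (2 : ℤ) ^ (j + 1) / 2 = 2 ^ j := by
    rw [pow_succ, Int.mul_ediv_cancel _ (by norm_num)]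
  have hcj : 2 ^ j ≤ 2 ^ N - 1 := by
    have := Nat.pow_lt_pow_right (a := 2) (by norm_num) hj
    omega
  have hmask : (2 : ℤ) ^ N - 1 - 2 ^ j = ((2 ^ N - 1 - 2 ^ j : ℕ) : ℤ) := by
    rw [Nat.cast_sub hcj, Nat.cast_sub Nat.one_le_two_pow]
    push_cast
    rfl
  have hmlt : 2 ^ N - 1 - 2 ^ j < 2 ^ (2 * n + 1) := by
    have h1 : 2 ^ N ≤ 2 ^ (2 * n + 1) := Nat.pow_le_pow_right (by norm_num) (by omega)
    have h2 : 0 < 2 ^ N := by positivity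
    exact lt_of_le_of_lt (Nat.sub_le _ _) (by omega)
  have hS' : S + 2 ^ j ≤ 2 * 2 ^ (2 * n + 1) := by
    have h1 : 2 ^ j ≤ 2 ^ (2 * n + 1) := Nat.pow_le_pow_right (by norm_num) (by omega)
    omega
  rw [← prod_erase_eq_bitProd hj, ← prod_erase_eq_bitProd hj]
  set c := 2 ^ N - 1 - 2 ^ j
  have e1 := abs_bitProd_le_prodBits hS bj
  have e2 := abs_bitProd_le_prodBits hmlt ht
  have e3 := abs_bitProd_le_prodBits hmlt bj
  rw [← mul_one (prodBits n)] at e1 e2 e3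
  refine Halts.mono (k := bitProdCallTime n + (bitProdCallTime n + (bitProdCallTime n + 11)) + 3)
    ?_ (by rw [interpStepTime]; omega) fun _ h => h
  refine Halts.seq_arith (j + 1 : ℕ) 1 h29 hs.r2 (small _ (by
    rw [Nat.abs_cast]; norm_cast; omega)) b1 ?_
  refine Halts.seq_arith (2 ^ (j + 1)) 2 (by simp [h31]) (by simp [hs.r3])
    (pow_two_lt_pow_allBits (by omega)) b2 ?_
  refine Halts.seq_arith (2 ^ N - 1) (2 ^ j) (by simp [h32]) (by simp [Op.eval, hj2])
    ?_ (pow_two_lt_pow_allBits (by omega)) ?_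
  · have h1 := pow_two_lt_pow_allBits (n := n) (j := N) (by omega)
    rw [abs_of_nonneg (by positivity)] at h1
    have h2 : (0 : ℤ) < 2 ^ N := by positivity
    rw [abs_of_nonneg (by omega)]
    omega
  refine Halts.seq (halts_bitProdCall (d := d) (m := S) (t := j) ?_ (by norm_num)
    (by simp [h22]) (by simp [Op.eval]) hS bj) ?_
  · exact hs.congr fun r h => by
      simp only [State.reg_setReg]
      rw [if_neg (by omega), if_neg (by omega), if_neg (by omega)]
  rintro s₁ ⟨hr₁, hm₁⟩
  have hs₁ : Setup n d s₁ := hs.congr fun r h => by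
    rw [hr₁ r (by omega)]
    simp only [State.reg_setReg]
    rw [if_neg (by omega), if_neg (by omega), if_neg (by omega), if_neg (by omega)]
  refine Halts.seq (halts_bitProdCall (d := d) (m := c) (t := t) hs₁ (by norm_num)
    (by rw [hr₁ 30 (by norm_num)]; simp [Op.eval, hmask])
    (by rw [hr₁ 23 (by norm_num)]; simp [h23]) hmlt ht) ?_
  rintro s₂ ⟨hr₂, hm₂⟩
  have hs₂ : Setup n d s₂ := hs₁.congr fun r h => by
    rw [hr₂ r (by omega), if_neg (by omega)]
  refine Halts.seq (halts_bitProdCall (d := d) (m := c) (t := j) hs₂ (by norm_num)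
    (by rw [hr₂ 30 (by norm_num), hr₁ 30 (by norm_num)]; simp [Op.eval, hmask])
    (by rw [hr₂ 29 (by norm_num), hr₁ 29 (by norm_num)]; simp [Op.eval]) hmlt bj) ?_
  rintro s₃ ⟨hr₃, hm₃⟩
  have hs₃ : Setup n d s₃ := hs₂.congr fun r h => by
    rw [hr₃ r (by omega), if_neg (by omega)]
  have hm : s₃.mem = s.mem := by simp [hm₃, hm₂, hm₁]
  have hr : ∀ r < 29, s₃.reg r = s.reg r := fun r h => by
    rw [hr₃ r (by omega), if_neg (by omega), hr₂ r (by omega), if_neg (by omega),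
      hr₁ r (by omega), if_neg (by omega)]
    simp only [State.reg_setReg]
    rw [if_neg (by omega), if_neg (by omega), if_neg (by omega)]
  have f29 : s₃.reg 29 = j := by simp [hr₃, hr₂, hr₁, Op.eval]
  have f31 : s₃.reg 31 = 2 ^ j := by simp [hr₃, hr₂, hr₁, Op.eval, hj2]
  have f32 : s₃.reg 32 = 2 ^ N - 1 := by simp [hr₃, hr₂, hr₁, h32]
  have f33 : s₃.reg 33 = bitProd S j := by simp [hr₃, hr₂, hr₁]
  have f34 : s₃.reg 34 = bitProd c t := by simp [hr₃, hr₂]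
  have f35 : s₃.reg 35 = bitProd c j := by simp [hr₃]
  clear hr₁ hr₂ hr₃ hm₁ hm₂ hm₃ hs₁ hs₂
  obtain ⟨bA, -, -, -, bA4, -⟩ := tableAddr_bounds hS' hw
  have bnd : ∀ {x : ℤ} {i : ℕ}, |x| ≤ 2 ^ (prodBits n * i) → i ≤ 4 * n + 7 →
    |x| < 2 ^ allBits n := fun h h' => lt_pow_allBits h (by omega)
  refine Halts.mono (k := 3 + 7 + 1) ?_ (by norm_num) fun _ h => h
  refine Halts.seq_arith S (2 ^ j) (by rw [hr 22 (by norm_num), h22]) f31 (cast_lt_pow_allBits hS)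
    (pow_two_lt_pow_allBits (by omega)) ?_
  refine Halts.seq (halts_addrProg (m := S + 2 ^ j) (d := d) (hs₃.congr fun r h => ?_) hS' hw
    (by norm_num) (by norm_num) (by simp [Op.eval]) (by simp [hr, h25])) ?_
  · rw [State.reg_setReg, if_neg (by omega)]
  rintro s₄ ⟨hr₄, hm₄⟩
  rw [State.mem_setReg, hm] at hm₄
  have hr' : ∀ r < 36, s₄.reg r = s₃.reg r := fun r h => by
    rw [hr₄, if_neg (by omega), State.reg_setReg, if_neg (by omega)]
  refine Halts.seq_load (tableAddr n (S + 2 ^ j) w) (s.mem (tableAddr n (S + 2 ^ j) w))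
    (by simp [hr₄]) (by rw [hm₄]) bA4 (bnd (hmb _) (by omega)) ?_
  have g1 := abs_mul_le_pow e1 e2
  have g2 := abs_mul_le_pow g1 (hmb (tableAddr n (S + 2 ^ j) w))
  have g3 := abs_mul_le_pow g2 hD
  have g4 := abs_mul_le_pow ha e3
  refine Halts.seq_arith (bitProd S j) (bitProd c t) (by simp [hr', f33]) (by simp [hr', f34])
    (bnd e1 (by omega)) (bnd e2 (by omega)) ?_
  refine Halts.seq_arith (bitProd S j * bitProd c t) (s.mem (tableAddr n (S + 2 ^ j) w))
    (by simp [Op.eval]) (by simp) (bnd g1 (by omega)) (bnd (hmb _) (by omega)) ?_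
  refine Halts.seq_arith (bitProd S j * bitProd c t * s.mem (tableAddr n (S + 2 ^ j) w)) D
    (by simp [Op.eval]) (by simp [hr', hr, h28]) (bnd g2 (by omega)) (bnd hD (by omega)) ?_
  refine Halts.seq_arith a (bitProd c j) (by simp [hr', hr, h27]) (by simp [hr', f35])
    (bnd ha (by omega)) (bnd e3 (by omega)) ?_
  refine Halts.seq_arith (a * bitProd c j)
    (bitProd S j * bitProd c t * s.mem (tableAddr n (S + 2 ^ j) w) * D)
    (by simp [Op.eval]) (by simp [Op.eval]) (bnd g4 (by omega)) (bnd g3 (by omega)) ?_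
  refine halts_arith D (bitProd c j) (by simp [hr', hr, h28]) (by simp [hr', f35])
    (bnd hD (by omega)) (bnd e3 (by omega)) ?_
  refine ⟨by simp [hr', f29], by simp [hr', f31], by simp [hr', f32], by simp [Op.eval], by simp [Op.eval],
    fun r h => ?_, by simp [hm₄]⟩
  simp only [State.reg_setReg]
  rw [if_neg (by omega), if_neg (by omega), if_neg (by omega), if_neg (by omega),
    if_neg (by omega), if_neg (by omega), if_neg (by omega), hr' r (by omega), hr r (by omega)]

open Polynomial in
-- The Lagrange sum is accumulated as a single fraction. Its value is an integer because G has
-- integer coefficients, so the final integer division is exact. At a node in S the table cell does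
-- not matter, its factor `bitProd S j` being zero.
theorem halts_interpProg {n d N S w : ℕ} {t : ℤ} {G : ℤ[X]} {s : State} (hs : Setup n d s)
    (hN : N ≤ 2 * n) (hw : w < n) (hS : S < 2 ^ (2 * n + 1)) (ht : |t| ≤ 2 * n)
    (h22 : s.reg 22 = S) (h23 : s.reg 23 = t) (h24 : s.reg 24 = N) (h25 : s.reg 25 = w)
    (h26 : s.reg 26 = 2 ^ N) (hmb : ∀ a, |s.mem a| ≤ 2 ^ (prodBits n * n)) (hG : G.natDegree < N)
    (hval : ∀ j < N, bitProd S j * s.mem (tableAddr n (S + 2 ^ j) w) = G.eval (j : ℤ)) :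
    Halts (allBits n) interpProg (interpTime n) (fun s' => s'.reg 27 = G.eval t ∧
      (∀ r < 27, s'.reg r = s.reg r) ∧ s'.mem = s.mem) s := by
  obtain ⟨L, hL⟩ : ∃ L, L = prodBits n := ⟨_, rfl⟩
  have small : ∀ a : ℤ, |a| ≤ 8 * n + 8 → |a| < 2 ^ allBits n := fun a => lt_pow_allBits_of_le'
  have b0 : |(0 : ℤ)| < 2 ^ allBits n := small _ (by norm_num; linarith)
  have b1 : |(1 : ℤ)| < 2 ^ allBits n := small _ (by norm_num; linarith)
  have bN : |(N : ℤ)| < 2 ^ allBits n := small _ (by rw [Nat.abs_cast]; norm_cast; omega)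
  -- The sum has at most 2n terms, a factor that fits into one additional block.
  have h2nL : ((2 * n : ℕ) : ℤ) ≤ 2 ^ (L * 1) := by
    have h1 : (2 * n : ℕ) < 2 ^ (2 * n) := Nat.lt_two_pow_self
    have h2 : 2 * n ≤ L * 1 := by rw [hL, prodBits]; nlinarith
    exact_mod_cast h1.le.trans (Nat.pow_le_pow_right (by norm_num) h2)
  set T : ℕ → ℚ := fun j => ((G.eval (j : ℤ) : ℤ) : ℚ) *
      ((∏ i ∈ (Finset.range N).erase j, ((t : ℚ) - i)) /
        ∏ i ∈ (Finset.range N).erase j, ((j : ℚ) - i))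
  have hsum : ((G.eval t : ℤ) : ℚ) = ∑ j ∈ Finset.Ico 0 N, T j := by
    rw [← Finset.range_eq_Ico]
    exact G.eval_eq_sum_nodes hG t
  refine Halts.mono (k := N * (interpStepTime n + 1) + 1 + 1 + 5) (R := fun s' => s'.reg 27 = G.eval t ∧
      (∀ r < 27, s'.reg r = s.reg r) ∧ s'.mem = s.mem) ?_ ?_ fun _ h => h
  swap
  · have := Nat.mul_le_mul_right (interpStepTime n + 1) hN
    rw [interpTime]
    omega
  refine Halts.seq_const b0 ?_
  refine Halts.seq_const b1 ?_
  refine Halts.seq_arith (2 ^ N) 1 (by simp [h26]) (by simp [hs.r2]) (pow_two_lt_pow_allBits (by omega)) b1 ?_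
  refine Halts.seq_arith N 0 (by simp [h24]) (by simp [hs.r4]) bN b0 ?_
  refine Halts.seq_arith (2 ^ N) 0 (by simp [h26]) (by simp [hs.r4]) (pow_two_lt_pow_allBits (by omega)) b0 ?_
  -- The nodes are treated from N - 1 downwards. After N - j of them the denominator has at most N -
  -- j blocks; each summand of the numerator has n blocks for the table entry, two for the products,
  -- and at most N - j for the denominators.
  refine Halts.seq (k := N * (interpStepTime n + 1) + 1) (k' := 1) (halts_loop_counter (k := interpStepTime n) (fun j s' => j ≤ N ∧ s'.reg 31 = 2 ^ j ∧
    s'.reg 32 = 2 ^ N - 1 ∧ s'.reg 28 ≠ 0 ∧ |s'.reg 28| ≤ 2 ^ (L * (N - j)) ∧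
    |s'.reg 27| ≤ ((N - j : ℕ) : ℤ) * 2 ^ (L * (n + 2 + (N - j))) ∧
    (s'.reg 27 : ℚ) = s'.reg 28 * ∑ i ∈ Finset.Ico j N, T i ∧
    (∀ r < 27, s'.reg r = s.reg r) ∧ s'.mem = s.mem) N ((le_abs_self _).trans_lt bN)
    (Q := fun s' => s'.reg 28 ≠ 0 ∧ |s'.reg 28| ≤ 2 ^ (L * N) ∧
      |s'.reg 27| ≤ 2 ^ (L * (1 + (n + 2 + N))) ∧
      (s'.reg 27 : ℚ) = s'.reg 28 * ∑ i ∈ Finset.Ico 0 N, T i ∧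
      (∀ r < 27, s'.reg r = s.reg r) ∧ s'.mem = s.mem) ?_ ?_ ?_ ?_) ?_
  · rintro j hj s' h29 ⟨-, h31, h32, hD, hDb, hNb, hNeq, hr, hmem⟩
    have hs' : Setup n d s' := hs.congr fun r h => hr r (by omega)
    have hw27 : |s'.reg 27| ≤ 2 ^ (L * (1 + (n + 2 + (N - (j + 1))))) := by
      rw [mul_add L 1, pow_add]
      refine hNb.trans (mul_le_mul_of_nonneg_right (le_trans ?_ h2nL) (by positivity))
      exact_mod_cast (by omega : N - (j + 1) ≤ 2 * n)
    refine (halts_interpStep hs' hN hj hw hS ht (by rw [hr 22 (by norm_num), h22])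
      (by rw [hr 23 (by norm_num), h23]) (by rw [hr 25 (by norm_num), h25]) rfl rfl h29 h31 h32
      (by rwa [hmem]) ?_ ?_).mono le_rfl ?_
    · rw [← hL]
      exact hw27.trans (pow_le_pow_right₀ (by norm_num) (Nat.mul_le_mul_left _ (by omega)))
    · rw [← hL]
      exact hDb.trans (pow_le_pow_right₀ (by norm_num) (Nat.mul_le_mul_left _ (by omega)))
    rintro s'' ⟨k29, k31, k32, k28, k27, kr, km⟩
    have hNj : N - j = N - (j + 1) + 1 := by omega
    have bj : |((j : ℕ) : ℤ)| ≤ 2 * n := by rw [Nat.abs_cast]; norm_cast; omega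
    have hmlt : 2 ^ N - 1 - 2 ^ j < 2 ^ (2 * n + 1) := by
      have h1 : 2 ^ N ≤ 2 ^ (2 * n + 1) := Nat.pow_le_pow_right (by norm_num) (by omega)
      have h2 : 0 < 2 ^ N := by positivity
      exact lt_of_le_of_lt (Nat.sub_le _ _) (by omega)
    have e1 := abs_bitProd_le_prodBits hS bj
    have e2 := abs_bitProd_le_prodBits hmlt ht
    have e3 := abs_bitProd_le_prodBits hmlt bj
    rw [prod_erase_eq_bitProd hj] at e2 e3
    rw [← mul_one (prodBits n), ← hL] at e1 e2 e3
    have e4 := abs_mul_le_pow (abs_mul_le_pow (abs_mul_le_pow e1 e2)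
      (hL ▸ hmb (tableAddr n (S + 2 ^ j) w))) hDb
    have hne : ∏ i ∈ (Finset.range N).erase j, ((j : ℤ) - i) ≠ 0 := by
      refine Finset.prod_ne_zero_iff.2 fun i hi => ?_
      have := (Finset.mem_erase.1 hi).1
      omega
    refine ⟨k29, by omega, k31, k32, ?_, ?_, ?_, ?_, fun r h => by rw [kr r h, hr r h],
      by rw [km, hmem]⟩
    · rw [k28]
      exact mul_ne_zero hD hne
    · rw [k28, hNj]
      exact abs_mul_le_pow hDb e3
    · rw [k27, hNj]
      refine (abs_add_le _ _).trans ?_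
      rw [Nat.cast_add, Nat.cast_one, add_mul, one_mul]
      refine add_le_add ?_ ?_
      · rw [abs_mul, show n + 2 + (N - (j + 1) + 1) = n + 2 + (N - (j + 1)) + 1 by ring, mul_add,
          pow_add, ← mul_assoc]
        exact mul_le_mul hNb e3 (abs_nonneg _) (by positivity)
      · rw [hmem]
        exact e4.trans (pow_le_pow_right₀ (by norm_num) (Nat.mul_le_mul_left _ (by omega)))
    · rw [k27, k28, Finset.sum_eq_sum_Ico_succ_bot hj]
      have hTj : T j = ((bitProd S j * s.mem (tableAddr n (S + 2 ^ j) w) : ℤ) : ℚ) *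
          ((∏ i ∈ (Finset.range N).erase j, ((t : ℚ) - i)) /
            ∏ i ∈ (Finset.range N).erase j, ((j : ℚ) - i)) := by rw [hval j hj]
      rw [hTj, hmem]
      have hne' : ∏ i ∈ (Finset.range N).erase j, ((j : ℚ) - i) ≠ 0 := by exact_mod_cast hne
      push_cast
      rw [hNeq]
      generalize ∑ i ∈ Finset.Ico (j + 1) N, T i = c
      field_simp
      ring
  · simp [Op.eval]
  · refine ⟨le_rfl, by simp [Op.eval], by simp [Op.eval], by simp, by simp, by simp, by simp,
      fun r hr => ?_, by simp⟩
    simp only [State.reg_setReg]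
    rw [if_neg (by omega), if_neg (by omega), if_neg (by omega), if_neg (by omega),
      if_neg (by omega)]
  · rintro s' - ⟨-, h31, h32, hD, hDb, hNb, hNeq, hr, hmem⟩
    refine ⟨hD, hDb, hNb.trans ?_, hNeq, hr, hmem⟩
    rw [Nat.sub_zero, mul_add L 1, pow_add _ (L * 1)]
    exact mul_le_mul_of_nonneg_right ((Nat.cast_le.2 hN).trans h2nL) (by positivity)
  · rintro s' ⟨hD, hDb, hNb, hNeq, hr, hmem⟩
    rw [← hsum] at hNeq
    have hNeq' : s'.reg 27 = s'.reg 28 * G.eval t := by exact_mod_cast hNeq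
    refine halts_arith _ _ rfl rfl (lt_pow_allBits (hL ▸ hNb) (by omega))
      (lt_pow_allBits (hL ▸ hDb) (by omega)) ?_
    refine ⟨?_, fun r h => ?_, by simp [hmem]⟩
    · simp only [State.reg_setReg, Op.eval, ↓reduceIte]
      rw [hNeq', Int.mul_ediv_cancel_left _ hD]
    · rw [State.reg_setReg, if_neg (by omega), hr r h]

/-! ### Table entries and their place in memory -/

/-- The elements of `S`, as integers. -/
def setLabels (S : Finset ℕ) : Multiset ℤ := S.val.map fun i : ℕ => (i : ℤ)

theorem setLabels_insert {S : Finset ℕ} {j : ℕ} (hj : j ∉ S) :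
    setLabels (insert j S) = (j : ℤ) ::ₘ setLabels S := by
  rw [setLabels, Finset.insert_val_of_notMem hj, Multiset.map_cons, setLabels]

theorem prod_setLabels (S : Finset ℕ) (f : ℤ → ℤ) :
    ((setLabels S).map f).prod = ∏ i ∈ S, f i := by
  rw [setLabels, Multiset.map_map]
  rfl

/-- The label of the vertex `w` in the search for cycles through `u`. -/
def vertexLabel {n : ℕ} (u w : Fin n) : ℤ := (w : ℤ) - u

theorem vertexLabel_injective {n : ℕ} (u : Fin n) : Function.Injective (vertexLabel u) := by
  intro w w' h
  rw [vertexLabel, vertexLabel] at h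
  exact Fin.ext (by omega)

theorem abs_vertexLabel_le {n : ℕ} (u w : Fin n) : |vertexLabel u w| ≤ n := by
  have h1 := u.2
  have h2 := w.2
  rw [vertexLabel, abs_le]
  omega

section

variable {n : ℕ} (adj : Fin n → Fin n → Prop) [DecidableRel adj]

/-- The table entry for the set `S` and the vertex `v`, where `d - S.card` more vertices are
needed. -/
def tableEntry (d : ℕ) (u : Fin n) (S : Finset ℕ) (v : Fin n) : ℤ :=
  walkWeight adj (vertexLabel u) u (d - S.card) v (setLabels S)

/-- Labels are at most n and remembered integers at most 2n in absolute value, so 4n bounds all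
differences. One choice of a vertex then contributes at most n (4n) ^ (2n), which is one block, and
there are at most n choices. -/
theorem walkWeight_vertexLabel_le (u v : Fin n) (r : ℕ) (M : Multiset ℤ)
    (hM : ∀ x ∈ M, |x| ≤ 2 * n) (hr : M.card + r ≤ n) :
    |walkWeight adj (vertexLabel u) u r v M| ≤ 2 ^ (prodBits n * n) := by
  have hn : 1 ≤ n := by have := v.2; omega
  rw [abs_of_nonneg (walkWeight_nonneg _ _ _ _ _ _)]
  refine (walkWeight_le adj (vertexLabel u) u (A := 4 * n) (by omega) (fun w w' => ?_) n _ v _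
    (fun x hx w => ?_) hr).trans ?_
  · have h1 := w.2
    have h2 := w'.2
    rw [vertexLabel, vertexLabel, abs_le]
    omega
  · refine (abs_sub _ _).trans ?_
    have := hM x hx
    have := abs_vertexLabel_le u w
    linarith
  · have h1 : (n + 1 : ℤ) ≤ 2 ^ n := by exact_mod_cast Nat.lt_two_pow_self
    have h2 : (4 * n : ℤ) ≤ 2 ^ (n + 2) := by rw [pow_add]; linarith
    have h3 : (n : ℤ) * (4 * n) ^ (2 * n) ≤ 2 ^ prodBits n := by
      calc (n : ℤ) * (4 * n) ^ (2 * n) ≤ 2 ^ (n + 2) * (2 ^ (n + 2)) ^ (2 * n) := by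
            gcongr
            linarith
        _ = 2 ^ prodBits n := by rw [← pow_mul, ← pow_add, prodBits]; ring
    rw [Fintype.card_fin, pow_mul 2 (prodBits n)]
    refine (pow_le_pow_left₀ (by positivity) h3 _).trans (pow_le_pow_right₀ ?_ (by omega))
    exact one_le_pow₀ (by norm_num)

theorem abs_le_of_mem_setLabels {S : Finset ℕ} {m : ℕ} (hS : S ⊆ Finset.range (m + 1)) {x : ℤ}
    (hx : x ∈ setLabels S) : |x| ≤ m := by
  obtain ⟨i, hi, rfl⟩ := Multiset.mem_map.1 hx
  have := Finset.mem_range.1 (hS hi)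
  rw [Nat.abs_cast]
  omega

theorem card_setLabels (S : Finset ℕ) : (setLabels S).card = S.card := Multiset.card_map _ _

theorem abs_tableEntry_le {d : ℕ} (hd : d ≤ n) (u : Fin n) {S : Finset ℕ} (v : Fin n)
    (hS : S ⊆ Finset.range (2 * n + 1)) (hc : S.card ≤ d) :
    |tableEntry adj d u S v| ≤ 2 ^ (prodBits n * n) := by
  refine walkWeight_vertexLabel_le adj u v _ _ (fun x hx => ?_) (by rw [card_setLabels]; omega)
  exact_mod_cast abs_le_of_mem_setLabels hS hx

-- The extra factor vanishes on S, where no table entry is available, so consecutive integers can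
-- serve as nodes. The price is |S| in the degree.
open Polynomial in
theorem exists_nodePolynomial (r : ℕ) (u w : Fin n) (S : Finset ℕ) :
    ∃ G : ℤ[X], G.natDegree ≤ S.card + 2 * r ∧ ∀ t, G.eval t = bitProd (bitMask S) t *
      walkWeight adj (vertexLabel u) u r w (t ::ₘ setLabels S) := by
  obtain ⟨p, hp, hp'⟩ := exists_polynomial_walkWeight adj (vertexLabel u) u r w (setLabels S)
  refine ⟨(∏ i ∈ S, (X - C (i : ℤ))) * p, ?_, fun t => ?_⟩
  · refine natDegree_mul_le.trans (add_le_add ?_ hp)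
    refine (natDegree_prod_le _ _).trans ((Finset.sum_le_card_nsmul _ _ 1 fun i _ => ?_).trans ?_)
    · exact natDegree_X_sub_C_le _
    · simp
  · rw [eval_mul, eval_prod, bitProd_bitMask, hp']
    simp

/-- The part of the memory that stays fixed, and a bound on all cells. -/
structure MemSetup (l : List (Finset ℕ)) (m : ℤ → ℤ) : Prop where
  adj : ∀ i j : Fin n, m ((i : ℤ) * n + j) = if adj i j then 1 else 0
  mask : ∀ i (h : i < l.length), m (-(2 * i + 1)) = bitMask l[i]
  card : ∀ i (h : i < l.length), m (-(2 * i + 2)) = l[i].card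
  bound : ∀ a, |m a| ≤ 2 ^ (prodBits n * n)

/-- The table begins after the n² cells of the adjacency matrix and the list of sets occupies
negative addresses, so a table write disturbs neither. -/
theorem MemSetup.update {l : List (Finset ℕ)} {m : ℤ → ℤ} (h : MemSetup adj l m) (k v : ℕ) {c : ℤ}
    (hc : |c| ≤ 2 ^ (prodBits n * n)) :
    MemSetup adj l (Function.update m (tableAddr n k v) c) where
  adj i j := by
    rw [Function.update_of_ne, h.adj]
    have h1 : ((i : ℤ) + 1) * n ≤ n * n :=
      mul_le_mul_of_nonneg_right (by have := i.2; omega) (by positivity)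
    have h2 := j.2
    have h3 : (0 : ℤ) ≤ k * n := by positivity
    rw [tableAddr]
    intro h4
    rw [add_mul] at h1
    omega
  mask i hi := by
    rw [Function.update_of_ne, h.mask]
    have : 0 ≤ tableAddr n k v := by rw [tableAddr]; positivity
    omega
  card i hi := by
    rw [Function.update_of_ne, h.card]
    have : 0 ≤ tableAddr n k v := by rw [tableAddr]; positivity
    omega
  bound a := by
    rw [Function.update_apply]
    split_ifs
    · exact hc
    · exact h.bound a

theorem tableAddr_inj {k k' v v' : ℕ} (hv : v < n) (hv' : v' < n)
    (h : tableAddr n k v = tableAddr n k' v') : k = k' ∧ v = v' := by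
  rw [tableAddr, tableAddr] at h
  have h1 : v + n * k = v' + n * k' := by
    have : (k : ℤ) * n + v = k' * n + v' := by linarith
    rw [mul_comm, mul_comm (k' : ℤ)] at this
    exact_mod_cast (by linarith : (v : ℤ) + n * k = v' + n * k')
  have h2 := congrArg (· % n) h1
  simp only [Nat.add_mul_mod_self_left, Nat.mod_eq_of_lt hv, Nat.mod_eq_of_lt hv'] at h2
  subst h2
  have h3 : n * k = n * k' := by omega
  exact ⟨Nat.eq_of_mul_eq_mul_left (by omega) h3, rfl⟩

/-! ### Programs for single table entries -/

/-- Stores the content of register `19` as the table entry for the mask in register `15` and the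
vertex in register `17`. -/
def storeEntry : Prog := addrProg 18 15 17 ;; .store 18 19

theorem halts_storeEntry {d m v : ℕ} {c : ℤ} {s : State} (hs : Setup n d s)
    (hm : m < 2 ^ (2 * n + 1)) (hv : v < n) (h15 : s.reg 15 = m) (h17 : s.reg 17 = v)
    (h19 : s.reg 19 = c) (hc : |c| ≤ 2 ^ (prodBits n * n)) :
    Halts (allBits n) storeEntry 4 (fun s' => (∀ r < 18, s'.reg r = s.reg r) ∧
      s'.mem = Function.update s.mem (tableAddr n m v) c) s := by
  refine Halts.seq (k := 3) (k' := 1) (halts_addrProg hs (by omega) hv (by norm_num) (by norm_num)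
    h15 h17) ?_
  rintro s' ⟨hr, hmem⟩
  refine halts_store (tableAddr n m v) c (by simp [hr]) (by simp [hr, h19])
    (tableAddr_bounds (by omega) hv).2.2.2.2.1 (lt_pow_allBits hc (by omega)) ?_
  refine ⟨fun r h => ?_, by simp [hmem]⟩
  rw [State.reg_setMem, hr, if_neg (by omega)]

/-- Writes the table entry for sets with `d` elements. -/
def baseCell : Prog :=
  .arith .mul 18 17 0 ;; .arith .add 18 18 9 ;; .load 19 18 ;; storeEntry

theorem halts_baseCell {d : ℕ} {u v : Fin n} {S : Finset ℕ} {l : List (Finset ℕ)} {s : State}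
    (hs : Setup n d s) (hm : MemSetup adj l s.mem) (h9 : s.reg 9 = u)
    (h15 : s.reg 15 = bitMask S) (h17 : s.reg 17 = v) (hS : S ⊆ Finset.range (2 * n + 1))
    (hc : S.card = d) :
    Halts (allBits n) baseCell 7 (fun s' => (∀ r < 18, s'.reg r = s.reg r) ∧
      s'.mem = Function.update s.mem (tableAddr n (bitMask S) v) (tableEntry adj d u S v)) s := by
  have hmask := bitMask_lt_iff.2 hS
  obtain ⟨b1, b2, b3, b4, b5, b6⟩ :=
    tableAddr_bounds (n := n) (m := v) (v := u)
      (v.2.le.trans (by have := Nat.lt_two_pow_self (n := 2 * n + 1); omega)) u.2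
  -- With d elements remembered no inner vertex is left, and only the closing edge to u has to be
  -- checked.
  have h0 : tableEntry adj d u S v = if adj v u then 1 else 0 := by
    rw [tableEntry, hc, Nat.sub_self, walkWeight]
  have hb := hm.bound (v * n + u)
  rw [hm.adj, ← h0] at hb
  refine Halts.seq_arith v n h17 hs.r0 b1
    (lt_pow_allBits_of_le' (by rw [Nat.abs_cast]; linarith)) ?_
  refine Halts.seq_arith (v * n) u (by simp [Op.eval]) (by simp [h9]) b2 b6 ?_
  refine Halts.seq_load (v * n + u) (tableEntry adj d u S v) (by simp [Op.eval])
    (by simp [hm.adj, h0]) b3 (lt_pow_allBits hb (by omega)) ?_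
  refine (halts_storeEntry (d := d) (hs.congr fun r h => ?_) hmask v.2 (by simp [h15])
    (by simp [h17]) (c := tableEntry adj d u S v) (by simp) hb).mono le_rfl ?_
  · simp only [State.reg_setReg]
    rw [if_neg (by omega), if_neg (by omega), if_neg (by omega)]
  · rintro s' ⟨hr, hmem⟩
    refine ⟨fun r h => ?_, by simpa using hmem⟩
    rw [hr r h]
    simp only [State.reg_setReg]
    rw [if_neg (by omega), if_neg (by omega), if_neg (by omega)]

/-- Adds to register `19` the contribution of one vertex to a table entry. -/
def edgeStep : Prog :=
  .arith .sub 20 20 2 ;; .arith .mul 18 17 0 ;; .arith .add 18 18 20 ;; .load 18 18 ;;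
  .cond 18 (.arith .add 22 15 4 ;; .arith .sub 23 20 9 ;; .arith .sub 24 7 11 ;;
    .arith .sub 24 24 2 ;; .arith .add 25 20 4 ;; .arith .div 26 12 3 ;; interpProg ;;
    bitProdCall 28 15 23 ;; .arith .mul 27 27 28 ;; .arith .add 19 19 27) .skip

def edgeStepTime (n : ℕ) : ℕ := interpTime n + bitProdCallTime n + 13

/-- The contribution of the vertex `w` to the table entry for `S` and `v`. -/
def edgeTerm (d : ℕ) (u : Fin n) (S : Finset ℕ) (v w : Fin n) : ℤ :=
  if adj v w then ((setLabels S).map fun x => (vertexLabel u w - x) ^ 2).prod *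
    walkWeight adj (vertexLabel u) u (d - (S.card + 1)) w (vertexLabel u w ::ₘ setLabels S) else 0

theorem tableEntry_eq_sum {d : ℕ} (u : Fin n) {S : Finset ℕ} (v : Fin n) (hS : S.card < d) :
    tableEntry adj d u S v = ∑ w, edgeTerm adj d u S v w := by
  rw [tableEntry, show d - S.card = d - (S.card + 1) + 1 by omega, walkWeight]
  rfl

theorem edgeTerm_nonneg (d : ℕ) (u : Fin n) (S : Finset ℕ) (v w : Fin n) :
    0 ≤ edgeTerm adj d u S v w := by
  rw [edgeTerm]
  split_ifs
  · exact mul_nonneg (Multiset.prod_map_sq_nonneg _ _) (walkWeight_nonneg _ _ _ _ _ _)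
  · exact le_rfl

/-- With k = |S|, the node polynomial has degree at most k + 2 (d - k - 1) = 2d - k - 2, so 2d - k -
1 nodes suffice. Adding a node to S stays within `range (2 * d - k)`, where the entries of size k +
1 are known. -/
theorem halts_edgeStep {d : ℕ} {u v w : Fin n} {S : Finset ℕ} {l : List (Finset ℕ)} {c : ℤ}
    {s : State} (hd : d ≤ n) (hs : Setup n d s) (hm : MemSetup adj l s.mem) (h9 : s.reg 9 = u)
    (h11 : s.reg 11 = S.card) (h12 : s.reg 12 = 2 ^ (2 * d - S.card))
    (h15 : s.reg 15 = bitMask S) (h17 : s.reg 17 = v) (h20 : s.reg 20 = (w + 1 : ℕ))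
    (h19 : s.reg 19 = c) (hcard : S.card < d) (hS : S ⊆ Finset.range (2 * d - S.card))
    (hc0 : 0 ≤ c) (hc : c + edgeTerm adj d u S v w ≤ 2 ^ (prodBits n * n))
    (htab : ∀ T : Finset ℕ, T.card = S.card + 1 → T ⊆ Finset.range (2 * d - S.card) → ∀ v : Fin n,
      s.mem (tableAddr n (bitMask T) v) = tableEntry adj d u T v) :
    Halts (allBits n) edgeStep (edgeStepTime n) (fun s' => s'.reg 20 = (w : ℕ) ∧
      s'.reg 19 = c + edgeTerm adj d u S v w ∧ (∀ r < 18, s'.reg r = s.reg r) ∧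
      s'.mem = s.mem) s := by
  have small : ∀ a : ℤ, |a| ≤ 8 * n + 8 → |a| < 2 ^ allBits n := fun a => lt_pow_allBits_of_le'
  have b0 : |(0 : ℤ)| < 2 ^ allBits n := small _ (by norm_num; linarith)
  have b1 : |(1 : ℤ)| < 2 ^ allBits n := small _ (by norm_num; linarith)
  have b2 : |(2 : ℤ)| < 2 ^ allBits n := small _ (by norm_num; linarith)
  have hw := w.2
  have hu := u.2
  have hmask : bitMask S < 2 ^ (2 * n + 1) :=
    bitMask_lt_iff.2 (hS.trans (Finset.range_subset_range.2 (by omega)))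
  obtain ⟨a1, a2, a3, a4, a5, a6⟩ :=
    tableAddr_bounds (n := n) (m := v) (v := w)
      (v.2.le.trans (by have := Nat.lt_two_pow_self (n := 2 * n + 1); omega)) w.2
  have hE := edgeTerm_nonneg adj d u S v w
  have hcb : |c| < 2 ^ allBits n :=
    lt_pow_allBits (c := n) (by rw [abs_of_nonneg hc0]; linarith) (by omega)
  refine Halts.seq_arith (w + 1 : ℕ) 1 h20 hs.r2
    (small _ (by rw [Nat.abs_cast]; push_cast; omega)) b1 ?_
  refine Halts.seq_arith v n (by simp [h17]) (by simp [hs.r0]) a1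
    (small _ (by rw [Nat.abs_cast]; linarith)) ?_
  refine Halts.seq_arith (v * n) w (by simp [Op.eval]) (by simp [Op.eval]) a2 a6 ?_
  refine Halts.seq_load (v * n + w) (if adj v w then 1 else 0) (by simp [Op.eval])
    (by simp [hm.adj]) a3 (by split_ifs <;> assumption) ?_
  refine halts_cond (k := interpTime n + bitProdCallTime n + 8)
    (by simp; split_ifs <;> assumption) (fun hc' => ?_) fun hc' => ?_
  · have hadj : adj v w := by
      by_contra h
      simp [h] at hc'
    have hN : ((2 * d - S.card - 1 : ℕ) : ℤ) = 2 * d - S.card - 1 := by omega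
    have hlab : |vertexLabel u w| ≤ 2 * n := (abs_vertexLabel_le u w).trans (by linarith)
    have hlab' : |vertexLabel u w| < 2 ^ allBits n := small _ (by linarith)
    have hpow : (2 : ℤ) ^ (2 * d - S.card) / 2 = 2 ^ (2 * d - S.card - 1) := by
      rw [show 2 * d - S.card = 2 * d - S.card - 1 + 1 by omega, pow_succ,
        Int.mul_ediv_cancel _ (by norm_num), Nat.add_sub_cancel]
    obtain ⟨G, hG, hG'⟩ := exists_nodePolynomial adj (d - (S.card + 1)) u w S
    -- The polynomial contains the product over S once; the second copy completes the squares, so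
    -- nothing has to be divided out.
    have hprod : edgeTerm adj d u S v w = G.eval (vertexLabel u w) *
        bitProd (bitMask S) (vertexLabel u w) := by
      rw [edgeTerm, if_pos hadj, hG', prod_setLabels, bitProd_bitMask, Finset.prod_pow]
      ring
    refine Halts.mono (k := interpTime n + (bitProdCallTime n + 2) + 6) ?_ (by omega) fun _ h => h
    refine Halts.seq_arith (bitMask S) 0 (by simp [h15]) (by simp [hs.r4])
      (cast_lt_pow_allBits hmask) b0 ?_
    refine Halts.seq_arith w u (by simp [Op.eval]) (by simp [h9]) a6
      (small _ (by rw [Nat.abs_cast]; omega)) ?_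
    refine Halts.seq_arith (2 * d) S.card (by simp [hs.r7]) (by simp [h11])
      (small _ (by rw [abs_le]; omega)) (small _ (by rw [abs_le]; omega)) ?_
    refine Halts.seq_arith (2 * d - S.card) 1 (by simp [Op.eval]) (by simp [hs.r2])
      (small _ (by rw [abs_le]; omega)) b1 ?_
    refine Halts.seq_arith w 0 (by simp [Op.eval]) (by simp [hs.r4]) a6 b0 ?_
    refine Halts.seq_arith (2 ^ (2 * d - S.card)) 2 (by simp [h12]) (by simp [hs.r3])
      (pow_two_lt_pow_allBits (by omega)) b2 ?_
    refine Halts.seq (halts_interpProg (d := d) (N := 2 * d - S.card - 1) (S := bitMask S) (w := w)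
      (t := vertexLabel u w) (G := G) (hs.congr fun r h => ?_) (by omega) hw hmask hlab
      (by simp [Op.eval]) (by simp [Op.eval, vertexLabel]) (by simp [Op.eval, hN])
      (by simp [Op.eval]) (by simp [Op.eval, hpow]) (by simpa using hm.bound) (by omega) ?_) ?_
    · simp only [State.reg_setReg]
      rw [if_neg (by omega), if_neg (by omega), if_neg (by omega), if_neg (by omega),
        if_neg (by omega), if_neg (by omega), if_neg (by omega), if_neg (by omega),
        if_neg (by omega), if_neg (by omega)]
    · intro j hj
      simp only [State.mem_setReg]
      -- For j in S the address S + 2 ^ j is not that of S with j added. Whatever it contains is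
      -- multiplied by zero.
      by_cases hjS : j ∈ S
      · have h0 : bitProd (bitMask S) (j : ℤ) = 0 := by
          rw [bitProd_bitMask]
          exact Finset.prod_eq_zero hjS (sub_self _)
        rw [hG', h0, zero_mul, zero_mul]
      · rw [hG', ← bitMask_insert hjS, htab _ (Finset.card_insert_of_notMem hjS) ?_ w, tableEntry,
          Finset.card_insert_of_notMem hjS, setLabels_insert hjS]
        exact Finset.insert_subset (Finset.mem_range.2 (by omega)) hS
    rintro s₁ ⟨h27, hr₁, hm₁⟩
    have hs₁ : Setup n d s₁ := hs.congr fun r h => by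
      rw [hr₁ r (by omega)]
      simp only [State.reg_setReg]
      rw [if_neg (by omega), if_neg (by omega), if_neg (by omega), if_neg (by omega),
        if_neg (by omega), if_neg (by omega), if_neg (by omega), if_neg (by omega),
        if_neg (by omega), if_neg (by omega)]
    refine Halts.seq (halts_bitProdCall (d := d) (m := bitMask S) (t := vertexLabel u w) hs₁
      (by norm_num) (by simp [hr₁, h15]) (by simp [hr₁, Op.eval, vertexLabel]) hmask hlab) ?_
    rintro s₂ ⟨hr₂, hm₂⟩
    have e1 := abs_bitProd_le_prodBits hmask hlab
    rw [← mul_one (prodBits n)] at e1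
    have e3 : |G.eval (vertexLabel u w)| < 2 ^ allBits n := by
      have h1 := walkWeight_vertexLabel_le adj u w (d - (S.card + 1))
        (vertexLabel u w ::ₘ setLabels S) (fun x hx => ?_) (by
          rw [Multiset.card_cons, card_setLabels]; omega)
      · rw [hG']
        exact lt_pow_allBits (abs_mul_le_pow e1 h1) (by omega)
      · rcases Multiset.mem_cons.1 hx with rfl | hx
        · exact hlab
        · exact_mod_cast abs_le_of_mem_setLabels
            (hS.trans (Finset.range_subset_range.2 (by omega : _ ≤ 2 * n + 1))) hx
    have e4 : |edgeTerm adj d u S v w| < 2 ^ allBits n :=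
      lt_pow_allBits (c := n) (by rw [abs_of_nonneg hE]; linarith) (by omega)
    refine Halts.seq_arith (G.eval (vertexLabel u w)) (bitProd (bitMask S) (vertexLabel u w))
      (by simp [hr₂, h27]) (by simp [hr₂]) e3 (lt_pow_allBits e1 (by omega)) ?_
    refine halts_arith c (edgeTerm adj d u S v w) (by simp [hr₂, hr₁, h19])
      (by simp [hprod, Op.eval]) hcb e4 ?_
    refine ⟨by simp [hr₂, hr₁, Op.eval], by simp [Op.eval], fun r h => ?_, by simp [hm₂, hm₁]⟩
    simp only [State.reg_setReg]
    rw [if_neg (by omega), if_neg (by omega), hr₂ r (by omega), if_neg (by omega),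
      hr₁ r (by omega)]
    simp only [State.reg_setReg]
    rw [if_neg (by omega), if_neg (by omega), if_neg (by omega), if_neg (by omega),
      if_neg (by omega), if_neg (by omega), if_neg (by omega), if_neg (by omega),
      if_neg (by omega), if_neg (by omega)]
  · have hadj : ¬ adj v w := by
      intro h
      simp [h] at hc'
    refine (halts_skip ?_ : Halts _ _ 1 _ _).mono (by omega) fun _ h => h
    refine ⟨by simp [Op.eval], by simp [edgeTerm, hadj, h19], fun r h => ?_, by simp⟩
    simp only [State.reg_setReg]
    rw [if_neg (by omega), if_neg (by omega), if_neg (by omega), if_neg (by omega)]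

end

section

variable {n : ℕ} (adj : Fin n → Fin n → Prop) [DecidableRel adj]

/-- Computes a table entry from entries for larger sets. -/
def edgeCell : Prog :=
  .const 19 0 ;; .arith .add 20 0 4 ;; .loop 20 edgeStep ;; storeEntry

def edgeCellTime (n : ℕ) : ℕ := n * (edgeStepTime n + 1) + 7

theorem halts_edgeCell {d : ℕ} {u v : Fin n} {S : Finset ℕ} {l : List (Finset ℕ)}
    {s : State} (hd : d ≤ n) (hs : Setup n d s) (hm : MemSetup adj l s.mem) (h9 : s.reg 9 = u)
    (h11 : s.reg 11 = S.card) (h12 : s.reg 12 = 2 ^ (2 * d - S.card))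
    (h15 : s.reg 15 = bitMask S) (h17 : s.reg 17 = v)
    (hcard : S.card < d) (hS : S ⊆ Finset.range (2 * d - S.card))
    (htab : ∀ T : Finset ℕ, T.card = S.card + 1 → T ⊆ Finset.range (2 * d - S.card) → ∀ v : Fin n,
      s.mem (tableAddr n (bitMask T) v) = tableEntry adj d u T v) :
    Halts (allBits n) edgeCell (edgeCellTime n) (fun s' => (∀ r < 18, s'.reg r = s.reg r) ∧
      s'.mem = Function.update s.mem (tableAddr n (bitMask S) v) (tableEntry adj d u S v)) s := by
  have small : ∀ a : ℤ, |a| ≤ 8 * n + 8 → |a| < 2 ^ allBits n := fun a => lt_pow_allBits_of_le'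
  have b0 : |(0 : ℤ)| < 2 ^ allBits n := small _ (by norm_num; linarith)
  have bn : |(n : ℤ)| < 2 ^ allBits n := small _ (by rw [Nat.abs_cast]; linarith)
  have hS' : S ⊆ Finset.range (2 * n + 1) := hS.trans (Finset.range_subset_range.2 (by omega))
  have hE := abs_tableEntry_le adj hd u v hS' hcard.le
  -- Extended by zero to all naturals, the contributions can be summed over intervals; the loop runs
  -- from vertex n - 1 down.
  let f : ℕ → ℤ := fun j => if h : j < n then edgeTerm adj d u S v ⟨j, h⟩ else 0
  have hf : ∀ j, 0 ≤ f j := fun j => by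
    simp only [f]
    split_ifs
    · exact edgeTerm_nonneg _ _ _ _ _ _
    · exact le_rfl
  have hsum : tableEntry adj d u S v = ∑ j ∈ Finset.Ico 0 n, f j := by
    rw [tableEntry_eq_sum adj u v hcard, ← Finset.range_eq_Ico, Finset.sum_range]
    exact Finset.sum_congr rfl fun w _ => by simp [f]
  -- Nonnegative terms make every partial sum at most the full entry, so the accumulator obeys the
  -- bound for table entries.
  have hpart : ∀ j, ∑ i ∈ Finset.Ico j n, f i ≤ 2 ^ (prodBits n * n) := fun j => by
    refine le_trans ?_ ((le_abs_self _).trans hE)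
    rw [hsum]
    exact Finset.sum_le_sum_of_subset_of_nonneg (Finset.Ico_subset_Ico_left (Nat.zero_le _))
      fun i _ _ => hf i
  refine Halts.mono (k := n * (edgeStepTime n + 1) + 1 + 4 + 2) ?_ (by rw [edgeCellTime])
    fun _ h => h
  refine Halts.seq_const b0 ?_
  refine Halts.seq_arith n 0 (by simp [hs.r0]) (by simp [hs.r4]) bn b0 ?_
  refine Halts.seq (k := n * (edgeStepTime n + 1) + 1) (k' := 4) (halts_loop_counter (k := edgeStepTime n) (fun j s' => j ≤ n ∧
    s'.reg 19 = ∑ i ∈ Finset.Ico j n, f i ∧ (∀ r < 18, s'.reg r = s.reg r) ∧ s'.mem = s.mem) n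
    ((le_abs_self _).trans_lt bn) (Q := fun s' => s'.reg 19 = tableEntry adj d u S v ∧
      (∀ r < 18, s'.reg r = s.reg r) ∧ s'.mem = s.mem) ?_ ?_ ?_ ?_) ?_
  · rintro j hj s' h20 ⟨-, h19, hr, hmem⟩
    have hfj : f j = edgeTerm adj d u S v ⟨j, hj⟩ := by simp [f, hj]
    refine (halts_edgeStep adj (w := ⟨j, hj⟩) (u := u) (v := v) (S := S) (l := l) hd
      (hs.congr fun r h => hr r (by omega)) (by rwa [hmem]) (by rw [hr 9 (by norm_num), h9])
      (by rw [hr 11 (by norm_num), h11]) (by rw [hr 12 (by norm_num), h12])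
      (by rw [hr 15 (by norm_num), h15]) (by rw [hr 17 (by norm_num), h17]) h20 h19 hcard hS
      (Finset.sum_nonneg fun i _ => hf i) ?_ (by rwa [hmem])).mono le_rfl ?_
    · rw [← hfj, add_comm, ← Finset.sum_eq_sum_Ico_succ_bot hj]
      exact hpart j
    · rintro s'' ⟨k20, k19, kr, km⟩
      refine ⟨k20, hj.le, ?_, fun r h => by rw [kr r h, hr r h], by rw [km, hmem]⟩
      rw [k19, ← hfj, add_comm, ← Finset.sum_eq_sum_Ico_succ_bot hj]
  · simp [Op.eval]
  · refine ⟨le_rfl, by simp, fun r h => ?_, by simp⟩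
    simp only [State.reg_setReg]
    rw [if_neg (by omega), if_neg (by omega)]
  · rintro s' - ⟨-, h19, hr, hmem⟩
    exact ⟨h19.trans hsum.symm, hr, hmem⟩
  · rintro s' ⟨h19, hr, hmem⟩
    refine (halts_storeEntry (d := d) (hs.congr fun r h => hr r (by omega)) (bitMask_lt_iff.2 hS')
      v.2 (by rw [hr 15 (by norm_num), h15]) (by rw [hr 17 (by norm_num), h17]) h19 hE).mono le_rfl
      ?_
    rintro s'' ⟨kr, km⟩
    exact ⟨fun r h => by rw [kr r h, hr r h], by rw [km, hmem]⟩

/-- Computes a table entry by extrapolation from entries for sets of the same size. -/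
def extrapCell : Prog :=
  .arith .sub 22 15 12 ;; .arith .sub 23 7 11 ;; .arith .add 24 23 4 ;; .arith .add 25 17 4 ;;
  .arith .add 26 12 4 ;; interpProg ;; bitProdCall 28 22 23 ;; .arith .div 19 27 28 ;; storeEntry

def extrapCellTime (n : ℕ) : ℕ := interpTime n + bitProdCallTime n + 10

/-- Write S as T with its top element z = 2d - |S| added, and let the top element vary. The node
polynomial for T has degree at most |T| + 2 (d - |S|) = z - 1, so the z nodes below z determine it;
adding such a node to T gives a set of the size of S without z. The final divisor is nonzero because
z exceeds all elements of T. -/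
theorem halts_extrapCell {d : ℕ} {u v : Fin n} {S : Finset ℕ} {l : List (Finset ℕ)}
    {s : State} (hd : d ≤ n) (hs : Setup n d s) (hm : MemSetup adj l s.mem)
    (h11 : s.reg 11 = S.card) (h12 : s.reg 12 = 2 ^ (2 * d - S.card))
    (h15 : s.reg 15 = bitMask S) (h17 : s.reg 17 = v)
    (hcard : S.card ≤ d) (hS : S ⊆ Finset.range (2 * d - S.card + 1)) (hmax : 2 * d - S.card ∈ S)
    (htab : ∀ T : Finset ℕ, T.card = S.card → T ⊆ Finset.range (2 * d - S.card) → ∀ v : Fin n,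
      s.mem (tableAddr n (bitMask T) v) = tableEntry adj d u T v) :
    Halts (allBits n) extrapCell (extrapCellTime n) (fun s' => (∀ r < 18, s'.reg r = s.reg r) ∧
      s'.mem = Function.update s.mem (tableAddr n (bitMask S) v) (tableEntry adj d u S v)) s := by
  have small : ∀ a : ℤ, |a| ≤ 8 * n + 8 → |a| < 2 ^ allBits n := fun a => lt_pow_allBits_of_le'
  have b0 : |(0 : ℤ)| < 2 ^ allBits n := small _ (by norm_num; linarith)
  have hS' : S ⊆ Finset.range (2 * n + 1) :=
    hS.trans (Finset.range_subset_range.2 (by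
      have := Finset.card_pos.2 ⟨_, hmax⟩
      omega))
  have hE := abs_tableEntry_le adj hd u v hS' hcard
  have hv := v.2
  obtain ⟨z, hz⟩ : ∃ z, z = 2 * d - S.card := ⟨_, rfl⟩
  obtain ⟨k, hk⟩ : ∃ k, k = S.card := ⟨_, rfl⟩
  rw [← hz] at hmax hS htab h12
  obtain ⟨T, hzT, rfl⟩ : ∃ T : Finset ℕ, z ∉ T ∧ S = insert z T :=
    ⟨S.erase z, Finset.notMem_erase z S, (Finset.insert_erase hmax).symm⟩
  rw [Finset.card_insert_of_notMem hzT] at hk hz hcard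
  have hT : T ⊆ Finset.range z := fun i hi => by
    have h1 := Finset.mem_range.1 (hS (Finset.mem_insert_of_mem hi))
    have h2 : i ≠ z := fun h => hzT (h ▸ hi)
    exact Finset.mem_range.2 (by omega)
  have hTm : bitMask T < 2 ^ (2 * n + 1) :=
    bitMask_lt_iff.2 (hT.trans (Finset.range_subset_range.2 (by omega)))
  have hzb : |(z : ℤ)| ≤ 2 * n := by rw [Nat.abs_cast]; omega
  have hzb' : |(z : ℤ)| < 2 ^ allBits n := small _ (by linarith)
  obtain ⟨G, hG, hG'⟩ := exists_nodePolynomial adj (d - k) u v T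
  have hentry : tableEntry adj d u (insert z T) v =
      walkWeight adj (vertexLabel u) u (d - k) v ((z : ℤ) ::ₘ setLabels T) := by
    rw [tableEntry, Finset.card_insert_of_notMem hzT, ← hk, setLabels_insert hzT]
  have hGz : G.eval (z : ℤ) = bitProd (bitMask T) z * tableEntry adj d u (insert z T) v := by
    rw [hG', hentry]
  have hne : bitProd (bitMask T) z ≠ 0 := by
    rw [bitProd_bitMask, Finset.prod_ne_zero_iff]
    intro i hi
    have := Finset.mem_range.1 (hT hi)
    omega
  have h15' : s.reg 15 - 2 ^ z = bitMask T := by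
    rw [h15, bitMask_insert hzT]
    push_cast
    ring
  have e1 := abs_bitProd_le_prodBits hTm hzb
  rw [← mul_one (prodBits n)] at e1
  refine Halts.mono (k := interpTime n + (bitProdCallTime n + (4 + 1)) + 5) ?_
    (by rw [extrapCellTime]; omega) fun _ h => h
  refine Halts.seq_arith (bitMask (insert z T)) (2 ^ z) h15 h12
    (cast_lt_pow_allBits (bitMask_lt_iff.2 hS')) (pow_two_lt_pow_allBits (by omega)) ?_
  refine Halts.seq_arith (2 * d) k (by simp [hs.r7])
    (by simp [h11, Finset.card_insert_of_notMem hzT, hk])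
    (small _ (by rw [abs_le]; omega)) (small _ (by rw [abs_le]; omega)) ?_
  have hzk : (2 * (d : ℤ)) - k = z := by omega
  refine Halts.seq_arith z 0 (by simp [Op.eval, hzk]) (by simp [hs.r4]) hzb' b0 ?_
  refine Halts.seq_arith v 0 (by simp [h17]) (by simp [hs.r4])
    (small _ (by rw [Nat.abs_cast]; omega)) b0 ?_
  refine Halts.seq_arith (2 ^ z) 0 (by simp [h12]) (by simp [hs.r4])
    (pow_two_lt_pow_allBits (by omega)) b0 ?_
  refine Halts.seq (halts_interpProg (d := d) (N := z) (S := bitMask T) (w := v)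
      (t := z) (G := G) (hs.congr fun r h => ?_) (by omega) hv hTm hzb
      (by simp [Op.eval, ← h15, h15']) (by simp [Op.eval, hzk]) (by simp [Op.eval])
      (by simp [Op.eval]) (by simp [Op.eval]) (by simpa using hm.bound) (by omega) ?_) ?_
  · simp only [State.reg_setReg]
    rw [if_neg (by omega), if_neg (by omega), if_neg (by omega), if_neg (by omega),
      if_neg (by omega)]
  · intro j hj
    simp only [State.mem_setReg]
    by_cases hjT : j ∈ T
    · have h0 : bitProd (bitMask T) (j : ℤ) = 0 := by
        rw [bitProd_bitMask]
        exact Finset.prod_eq_zero hjT (sub_self _)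
      rw [hG', h0, zero_mul, zero_mul]
    · rw [hG', ← bitMask_insert hjT, htab _ ?_ ?_ v, tableEntry,
        Finset.card_insert_of_notMem hjT, setLabels_insert hjT, ← hk]
      · rw [Finset.card_insert_of_notMem hjT, Finset.card_insert_of_notMem hzT]
      · exact Finset.insert_subset (Finset.mem_range.2 hj) hT
  rintro s₁ ⟨h27, hr₁, hm₁⟩
  have hs₁ : Setup n d s₁ := hs.congr fun r h => by
    rw [hr₁ r (by omega)]
    simp only [State.reg_setReg]
    rw [if_neg (by omega), if_neg (by omega), if_neg (by omega), if_neg (by omega),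
      if_neg (by omega)]
  refine Halts.seq (halts_bitProdCall (d := d) (m := bitMask T) (t := z) hs₁
    (by norm_num) (by simp [hr₁, Op.eval, ← h15, h15']) (by simp [hr₁, Op.eval, hzk]) hTm hzb) ?_
  rintro s₂ ⟨hr₂, hm₂⟩
  have hr : ∀ r < 18, s₂.reg r = s.reg r := fun r h => by
    rw [hr₂ r (by omega), if_neg (by omega), hr₁ r (by omega)]
    simp only [State.reg_setReg]
    rw [if_neg (by omega), if_neg (by omega), if_neg (by omega), if_neg (by omega),
      if_neg (by omega)]
  have hG27 : |G.eval (z : ℤ)| < 2 ^ allBits n := by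
    rw [hGz]
    exact lt_pow_allBits (abs_mul_le_pow e1 hE) (by omega)
  refine Halts.seq_arith (G.eval (z : ℤ)) (bitProd (bitMask T) z)
      (by simp [hr₂, h27]) (by simp [hr₂]) hG27 (lt_pow_allBits e1 (by omega)) ?_
  refine (halts_storeEntry (d := d) (hs.congr fun r h => ?_) (bitMask_lt_iff.2 hS')
    v.2 (by simp [hr, h15]) (by simp [hr, h17]) (c := tableEntry adj d u (insert z T) v) ?_
    hE).mono le_rfl ?_
  · rw [State.reg_setReg, if_neg (by omega), hr r (by omega)]
  · simp [Op.eval, hGz, Int.mul_ediv_cancel_left _ hne]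
  rintro s'' ⟨kr, km⟩
  refine ⟨fun r h => ?_, by rw [km]; simp [hm₂, hm₁]⟩
  rw [kr r h, State.reg_setReg, if_neg (by omega), hr r h]

end

/-! ### Loops over the vertices and over the list of sets -/

section

variable {n : ℕ} (adj : Fin n → Fin n → Prop) [DecidableRel adj]

/-- Runs `C` for all vertices, with the vertex in register `17`. -/
def vertexLoop (C : Prog) : Prog :=
  .arith .add 17 0 4 ;; .loop 17 (.arith .sub 17 17 2 ;; C)

/-- The memory `m` differs from `m₀` only in table entries for sets satisfying `sel`. -/
def Filling (l : List (Finset ℕ)) (sel : Finset ℕ → Prop) (m₀ m : ℤ → ℤ) : Prop :=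
  MemSetup adj l m ∧
    ∀ a, (∀ S ∈ l, sel S → ∀ v : Fin n, a ≠ tableAddr n (bitMask S) v) → m a = m₀ a

/-- From a state like `s`, except that registers from `r₀` on and the table entries for sets
satisfying `sel` may be different, the program `C` writes the table entry for `S` and `v`. -/
def FillsEntry (d : ℕ) (u : Fin n) (l : List (Finset ℕ)) (sel : Finset ℕ → Prop) (S : Finset ℕ)
    (C : Prog) (c : ℕ) (m₀ : ℤ → ℤ) (s : State) : Prop :=
  ∀ (v : Fin n) (s' : State), (∀ r < 17, s'.reg r = s.reg r) → s'.reg 17 = (v : ℕ) →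
    Filling adj l sel m₀ s'.mem →
    Halts (allBits n) C c (fun s'' => (∀ r < 18, s''.reg r = s'.reg r) ∧
      s''.mem = Function.update s'.mem (tableAddr n (bitMask S) v) (tableEntry adj d u S v)) s'

theorem halts_vertexLoop {d c : ℕ} {u : Fin n} {l : List (Finset ℕ)} {sel : Finset ℕ → Prop}
    {S : Finset ℕ} {C : Prog} {s : State} {m₀ : ℤ → ℤ} (hs : Setup n d s)
    (hC : FillsEntry adj d u l sel S C c m₀ s) (hm : Filling adj l sel m₀ s.mem) (hSl : S ∈ l)
    (hsel : sel S) (hb : ∀ v, |tableEntry adj d u S v| ≤ 2 ^ (prodBits n * n)) :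
    Halts (allBits n) (vertexLoop C) (n * (c + 2) + 2) (fun s' => (∀ r < 17, s'.reg r = s.reg r) ∧
      Filling adj l sel m₀ s'.mem ∧
      (∀ v : Fin n, s'.mem (tableAddr n (bitMask S) v) = tableEntry adj d u S v) ∧
      ∀ a, (∀ v : Fin n, a ≠ tableAddr n (bitMask S) v) → s'.mem a = s.mem a) s := by
  have small : ∀ a : ℤ, |a| ≤ 8 * n + 8 → |a| < 2 ^ allBits n := fun a => lt_pow_allBits_of_le'
  have b0 : |(0 : ℤ)| < 2 ^ allBits n := small _ (by norm_num; linarith)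
  have b1 : |(1 : ℤ)| < 2 ^ allBits n := small _ (by norm_num; linarith)
  have bn : |(n : ℤ)| < 2 ^ allBits n := small _ (by rw [Nat.abs_cast]; linarith)
  refine Halts.seq_arith n 0 hs.r0 hs.r4 bn b0 ?_
  refine halts_loop_counter (k := c + 1) (fun j s' => (∀ r < 17, s'.reg r = s.reg r) ∧
      Filling adj l sel m₀ s'.mem ∧
      (∀ v : Fin n, j ≤ v → s'.mem (tableAddr n (bitMask S) v) = tableEntry adj d u S v) ∧
      ∀ a, (∀ v : Fin n, a ≠ tableAddr n (bitMask S) v) → s'.mem a = s.mem a) n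
    ((le_abs_self _).trans_lt bn) ?_ ?_ ?_ ?_
  · rintro j hj s' h17 ⟨hr, hF, hfill, hout⟩
    refine Halts.seq_arith (j + 1 : ℕ) 1 h17 ((hr 2 (by norm_num)).trans hs.r2)
      (small _ (by rw [Nat.abs_cast]; push_cast; omega)) b1 ?_
    refine (hC ⟨j, hj⟩ _ (fun r h => ?_) ?_ ?_).mono le_rfl ?_
    · rw [State.reg_setReg, if_neg (by omega), hr r h]
    · simp [Op.eval]
    · exact hF
    rintro s'' ⟨kr, km⟩
    rw [State.mem_setReg] at km
    refine ⟨by rw [kr 17 (by norm_num)]; simp [Op.eval], fun r h => ?_, ⟨?_, fun a ha => ?_⟩,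
      fun v hv => ?_, fun a ha => ?_⟩
    · rw [kr r (by omega), State.reg_setReg, if_neg (by omega), hr r h]
    · rw [km]
      exact hF.1.update adj _ _ (hb _)
    · rw [km, Function.update_of_ne (ha S hSl hsel ⟨j, hj⟩), hF.2 a ha]
    · rw [km, Function.update_apply]
      split_ifs with h
      · have := (tableAddr_inj v.2 hj h).2
        rw [show v = ⟨j, hj⟩ from Fin.ext this]
      · refine hfill v ?_
        rcases Nat.eq_or_lt_of_le hv with h' | h'
        · exact absurd (congrArg (tableAddr n (bitMask S)) h'.symm) h
        · exact h'
    · rw [km, Function.update_of_ne (ha ⟨j, hj⟩), hout a ha]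
  · simp [Op.eval]
  · refine ⟨fun r h => ?_, hm, fun v hv => absurd v.2 (by omega), fun a _ => rfl⟩
    rw [State.reg_setReg, if_neg (by omega)]
  · rintro s' - ⟨hr, hF, hfill, hout⟩
    exact ⟨hr, hF, fun v => hfill v (Nat.zero_le _), hout⟩

/-- Runs `D` for all sets in the list whose size is the content of register `11`, with the mask
in register `15`. -/
def pass (D : Prog) : Prog :=
  .arith .add 13 6 4 ;; .loop 13 (.arith .sub 13 13 2 ;; .arith .add 33 13 13 ;;
    .arith .sub 33 4 33 ;; .arith .sub 33 33 2 ;; .load 15 33 ;; .arith .sub 33 33 2 ;;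
    .load 34 33 ;; .arith .sub 34 34 11 ;; .arith .mul 34 34 34 ;; .arith .sub 34 2 34 ;;
    .cond 34 D .skip)

/-- From a state like `s`, except that registers from `13` on and the table entries for sets
satisfying `sel` may be different, the program `D` writes all table entries for `S` if `S`
satisfies `sel`. -/
def FillsSet (d : ℕ) (u : Fin n) (l : List (Finset ℕ)) (sel : Finset ℕ → Prop) (S : Finset ℕ)
    (D : Prog) (c : ℕ) (m₀ : ℤ → ℤ) (s : State) : Prop :=
  ∀ s' : State, (∀ r < 13, s'.reg r = s.reg r) → s'.reg 15 = bitMask S →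
    Filling adj l sel m₀ s'.mem →
    Halts (allBits n) D c (fun s'' => (∀ r < 14, s''.reg r = s'.reg r) ∧
      Filling adj l sel m₀ s''.mem ∧
      (sel S → ∀ v : Fin n, s''.mem (tableAddr n (bitMask S) v) = tableEntry adj d u S v) ∧
      ∀ a, (∀ v : Fin n, a ≠ tableAddr n (bitMask S) v) → s''.mem a = s'.mem a) s'

theorem listAddr_lt {i : ℕ} (hi : i < 2 ^ (2 * n + 1)) (hn : 1 ≤ n) :
    |(i : ℤ)| < 2 ^ allBits n ∧ |(i : ℤ) + i| < 2 ^ allBits n ∧ |-(2 * (i : ℤ))| < 2 ^ allBits n ∧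
    |-(2 * (i : ℤ) + 1)| < 2 ^ allBits n ∧ |-(2 * (i : ℤ) + 2)| < 2 ^ allBits n ∧
    |((i + 1 : ℕ) : ℤ)| < 2 ^ allBits n := by
  have h : (i : ℤ) < 2 ^ (2 * n + 1) := by exact_mod_cast hi
  have h1 : (1 : ℤ) ≤ n := by exact_mod_cast hn
  have h2 : (1 : ℤ) ≤ 2 ^ (2 * n + 1) := one_le_pow₀ (by norm_num)
  have h3 : (0 : ℤ) ≤ i := by positivity
  have h4 : (1 : ℤ) * 2 ^ (2 * n + 1) ≤ n * 2 ^ (2 * n + 1) := by gcongr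
  have key : ∀ a : ℤ, |a| ≤ 2 * i + 2 → |a| < 2 ^ allBits n := by
    refine fun a ha => lt_pow_allBits_of_le ?_
    linarith
  refine ⟨key _ ?_, key _ ?_, key _ ?_, key _ ?_, key _ ?_, key _ ?_⟩ <;> rw [abs_le] <;>
    constructor <;> push_cast <;> linarith

theorem halts_pass {d c k : ℕ} {u : Fin n} {l : List (Finset ℕ)} {sel : Finset ℕ → Prop}
    {D : Prog} {s : State} (hd : d ≤ n) (hs : Setup n d s) (h6 : s.reg 6 = l.length)
    (h11 : s.reg 11 = k) (hk : k ≤ d) (hc : 1 ≤ c) (hlen : l.length ≤ 2 ^ (2 * n + 1))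
    (hl : ∀ S ∈ l, S ⊆ Finset.range (2 * n)) (hsel : ∀ S ∈ l, sel S → S.card = k)
    (hD : ∀ S ∈ l, S.card = k → FillsSet adj d u l sel S D c s.mem s) (hm : MemSetup adj l s.mem) :
    Halts (allBits n) (pass D) (l.length * (c + 12) + 2) (fun s' => (∀ r < 13, s'.reg r = s.reg r) ∧
      Filling adj l sel s.mem s'.mem ∧
      ∀ S ∈ l, sel S → ∀ v : Fin n, s'.mem (tableAddr n (bitMask S) v) = tableEntry adj d u S v)
      s := by
  have small : ∀ a : ℤ, |a| ≤ 8 * n + 8 → |a| < 2 ^ allBits n := fun a => lt_pow_allBits_of_le'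
  have b0 : |(0 : ℤ)| < 2 ^ allBits n := small _ (by norm_num; linarith)
  have b1 : |(1 : ℤ)| < 2 ^ allBits n := small _ (by norm_num; linarith)
  have hn : 1 ≤ n := by have := u.2; omega
  have blen : |(l.length : ℤ)| < 2 ^ allBits n := by
    rcases Nat.eq_zero_or_pos l.length with h | h
    · rw [h]; exact b0
    · have := (listAddr_lt (i := l.length - 1) (by omega) hn).2.2.2.2.2
      rwa [Nat.sub_add_cancel h] at this
  refine Halts.seq_arith l.length 0 h6 hs.r4 blen b0 ?_
  refine halts_loop_counter (k := c + 11) (fun j s' => (∀ r < 13, s'.reg r = s.reg r) ∧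
      Filling adj l sel s.mem s'.mem ∧
      ∀ i (h : i < l.length), j ≤ i → sel l[i] →
        ∀ v : Fin n, s'.mem (tableAddr n (bitMask l[i]) v) = tableEntry adj d u l[i] v) l.length
    ((le_abs_self _).trans_lt blen) ?_ ?_ ?_ ?_
  · rintro j hj s' h13 ⟨hr, hF, hfill⟩
    have hs' : Setup n d s' := hs.congr fun r h => hr r (by omega)
    obtain ⟨c1, c2, c3, c4, c5, c6⟩ := listAddr_lt (i := j) (by omega) hn
    have hSl : l[j] ∈ l := List.getElem_mem hj
    have hcard : l[j].card ≤ 2 * n := by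
      simpa using Finset.card_le_card (hl _ hSl)
    have hmask : bitMask l[j] < 2 ^ (2 * n + 1) :=
      bitMask_lt_iff.2 ((hl _ hSl).trans (Finset.range_subset_range.2 (by omega)))
    have hsq : |((l[j].card : ℤ) - k) * (l[j].card - k)| < 2 ^ allBits n := by
      have h1 : |(l[j].card : ℤ) - k| ≤ 2 * n := by rw [abs_le]; omega
      have h2 : (n : ℤ) ≤ 2 ^ (2 * n + 1) := by
        exact_mod_cast Nat.lt_two_pow_self.le.trans
          (Nat.pow_le_pow_right (n := 2) (by norm_num) (by omega))
      refine lt_pow_allBits_of_le ?_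
      rw [abs_mul]
      refine (mul_le_mul h1 h1 (abs_nonneg _) (by positivity)).trans ?_
      nlinarith
    refine Halts.seq_arith (j + 1 : ℕ) 1 h13 hs'.r2 c6 b1 ?_
    refine Halts.seq_arith j j (by simp [Op.eval]) (by simp [Op.eval]) c1 c1 ?_
    refine Halts.seq_arith 0 (2 * j) (by simp [hs'.r4]) (by simp [Op.eval, two_mul]) b0
      (by rw [two_mul]; exact c2) ?_
    refine Halts.seq_arith (-(2 * j)) 1 (by simp [Op.eval]) (by simp [hs'.r2]) c3 b1 ?_
    refine Halts.seq_load (-(2 * j + 1)) (bitMask l[j]) (by simp [Op.eval]; ring)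
      (by simpa using hF.1.mask j hj) c4 (cast_lt_pow_allBits hmask) ?_
    refine Halts.seq_arith (-(2 * j + 1)) 1 (by simp [Op.eval]; ring) (by simp [hs'.r2]) c4 b1 ?_
    refine Halts.seq_load (-(2 * j + 2)) l[j].card (by simp [Op.eval]; ring)
      (by simpa using hF.1.card j hj) c5 (small _ (by rw [Nat.abs_cast]; omega)) ?_
    refine Halts.seq_arith l[j].card k (by simp) (by simp [hr, h11])
      (small _ (by rw [Nat.abs_cast]; omega)) (small _ (by rw [Nat.abs_cast]; omega)) ?_
    refine Halts.seq_arith (l[j].card - k) (l[j].card - k) (by simp [Op.eval]) (by simp [Op.eval])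
      (small _ (by rw [abs_le]; omega)) (small _ (by rw [abs_le]; omega)) ?_
    refine Halts.seq_arith 1 ((l[j].card - k) * (l[j].card - k)) (by simp [hs'.r2])
      (by simp [Op.eval]) b1 hsq ?_
    -- The machine only tests for positivity; for integers 1 - x ^ 2 is positive exactly when x = 0.
    have hcond : 0 < 1 - ((l[j].card : ℤ) - k) * (l[j].card - k) ↔ l[j].card = k := by
      constructor
      · intro h
        have h1 : ((l[j].card : ℤ) - k) * (l[j].card - k) = 0 := by
          nlinarith [mul_self_nonneg ((l[j].card : ℤ) - k)]
        have h2 := mul_self_eq_zero.1 h1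
        omega
      · intro h
        simp [h]
    -- The list is not assumed free of repetitions here: treating a set again leaves its entries
    -- correct, and the entries of other sets lie at other addresses.
    have hkeep : ∀ m : ℤ → ℤ, (∀ a, (∀ v : Fin n, a ≠ tableAddr n (bitMask l[j]) v) →
        m a = s'.mem a) → (sel l[j] → ∀ v : Fin n, m (tableAddr n (bitMask l[j]) v) =
          tableEntry adj d u l[j] v) → ∀ i (h : i < l.length), j ≤ i → sel l[i] →
        ∀ v : Fin n, m (tableAddr n (bitMask l[i]) v) = tableEntry adj d u l[i] v := by
      intro m hmo hmf i hi hji hsi v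
      by_cases h : l[i] = l[j]
      · rw [h] at hsi ⊢
        exact hmf hsi v
      · rw [hmo]
        · refine hfill i hi ?_ hsi v
          rcases Nat.eq_or_lt_of_le hji with h' | h'
          · subst h'
            exact absurd rfl h
          · exact h'
        · intro v' h'
          exact h (bitMask_injective (tableAddr_inj v.2 v'.2 h').1)
    have hfr : ∀ r < 14, r ≠ 13 → ∀ x : ℤ, ∀ r' ∈ [13, 15, 33, 34], ∀ t : State,
        (t.setReg r' x).reg r = t.reg r := by
      intro r h h' x r' hr' t
      rw [State.reg_setReg, if_neg]
      simp only [List.mem_cons, List.not_mem_nil, or_false] at hr'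
      omega
    refine halts_cond (k := c) (by
      simp only [State.reg_setReg, Op.eval, ↓reduceIte]
      by_cases h : l[j].card = k
      · simpa [h] using b1
      · have h0 := mt hcond.1 h
        have h1 := mul_self_nonneg ((l[j].card : ℤ) - k)
        rw [abs_of_nonneg h1] at hsq
        rw [abs_of_nonpos (by omega)]
        omega) (fun h34 => ?_) fun h34 => ?_
    · simp only [State.reg_setReg, Op.eval, ↓reduceIte] at h34
      refine (hD _ hSl (hcond.1 h34) _ (fun r h => ?_) ?_ ?_).mono le_rfl ?_
      · iterate 10 rw [hfr r (by omega) (by omega) _ _ (by simp)]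
        exact hr r h
      · simp
      · exact hF
      · rintro s'' ⟨kr, kF, kf, ko⟩
        refine ⟨by rw [kr 13 (by norm_num)]; simp [Op.eval], fun r h => ?_, kF, hkeep _ ko kf⟩
        rw [kr r (by omega)]
        iterate 10 rw [hfr r (by omega) (by omega) _ _ (by simp)]
        exact hr r h
    · simp only [State.reg_setReg, Op.eval, ↓reduceIte] at h34
      refine (halts_skip ?_ : Halts _ _ 1 _ _).mono hc fun _ h => h
      refine ⟨by simp [Op.eval], fun r h => ?_, hF, hkeep _ (fun a _ => rfl)
        fun h => absurd (hcond.2 (hsel _ hSl h)) h34⟩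
      iterate 10 rw [hfr r (by omega) (by omega) _ _ (by simp)]
      exact hr r h
  · simp [Op.eval]
  · refine ⟨fun r h => ?_, ⟨hm, fun a _ => rfl⟩, fun i h h' => absurd h (by omega)⟩
    rw [State.reg_setReg, if_neg (by omega)]
  · rintro s' - ⟨hr, hF, hfill⟩
    refine ⟨hr, hF, fun S hS => ?_⟩
    obtain ⟨i, hi, rfl⟩ := List.mem_iff_getElem.1 hS
    exact hfill i hi (Nat.zero_le _)

end

/-! ### One level, one start vertex, the whole search -/

/-- Runs `C` for all vertices if the mask in register `15` is smaller than register `12`. -/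
def innerSet (C : Prog) : Prog := .arith .sub 34 12 15 ;; .cond 34 (vertexLoop C) .skip

/-- Runs `C` for all vertices unless the mask in register `15` is smaller than register `12`. -/
def outerSet (C : Prog) : Prog := .arith .sub 34 12 15 ;; .cond 34 .skip (vertexLoop C)

/-- Computes the table entries for all sets of one size. -/
def levelStep : Prog :=
  pass (innerSet edgeCell) ;; pass (outerSet extrapCell) ;; .arith .sub 11 11 2 ;;
  .arith .add 12 12 12

/-- Searches for a cycle through the vertex in register `9`. -/
def vertexRound : Prog :=
  .arith .add 11 1 4 ;; pass (vertexLoop baseCell) ;; .arith .sub 11 11 2 ;;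
  .arith .add 12 10 10 ;; .loop 11 levelStep ;; .arith .add 33 5 0 ;; .arith .add 33 33 9 ;;
  .load 33 33 ;; .cond 33 (.const 8 1) .skip

/-- Searches for a cycle through any vertex. -/
def search : Prog :=
  .arith .add 9 0 4 ;; .loop 9 (.arith .sub 9 9 2 ;; vertexRound) ;; .arith .add 0 8 4

def innerTime (n : ℕ) : ℕ := n * (edgeCellTime n + 2) + 4

def outerTime (n : ℕ) : ℕ := n * (extrapCellTime n + 2) + 4

def levelTime (n len : ℕ) : ℕ := len * (innerTime n + 12) + len * (outerTime n + 12) + 6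

def roundTime (n len : ℕ) : ℕ := len * (n * 9 + 14) + n * (levelTime n len + 1) + 12

def searchTime (n len : ℕ) : ℕ := n * (roundTime n len + 2) + 3

/-- A list of all sets whose table entries are computed. -/
structure IsFamily (n d : ℕ) (l : List (Finset ℕ)) : Prop where
  mem_iff : ∀ S, S ∈ l ↔ S ⊆ Finset.range (2 * d + 1 - S.card)
  length_le : l.length ≤ 2 ^ (2 * n + 1)

theorem IsFamily.subset {n d : ℕ} {l : List (Finset ℕ)} (h : IsFamily n d l) (hd : d ≤ n) :
    ∀ S ∈ l, S ⊆ Finset.range (2 * n) := by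
  intro S hS i hi
  have h1 := Finset.mem_range.1 ((h.mem_iff S).1 hS hi)
  have h2 := Finset.card_pos.2 ⟨i, hi⟩
  exact Finset.mem_range.2 (by omega)

section

variable {n : ℕ} (adj : Fin n → Fin n → Prop) [DecidableRel adj]

/-- The table entries for sets of size `k` are correct. -/
def LevelDone (d k : ℕ) (u : Fin n) (m : ℤ → ℤ) : Prop :=
  ∀ T : Finset ℕ, T.card = k → T ⊆ Finset.range (2 * d + 1 - k) → ∀ v : Fin n,
    m (tableAddr n (bitMask T) v) = tableEntry adj d u T v

/-- Distinct sets have distinct masks and hence disjoint cells. So a pass preserves the entries that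
it reads: those of the level above, or those of the sets without the top element. -/
theorem Filling.eq_of_not {l : List (Finset ℕ)} {sel : Finset ℕ → Prop} {m₀ m : ℤ → ℤ}
    (h : Filling adj l sel m₀ m) {T : Finset ℕ} (hT : ¬ sel T) (v : Fin n) :
    m (tableAddr n (bitMask T) v) = m₀ (tableAddr n (bitMask T) v) := by
  refine h.2 _ fun S _ hS v' h' => hT ?_
  rwa [bitMask_injective (tableAddr_inj v.2 v'.2 h').1]

/-- A stored set of size k + 1 lies in `range (2 * d - k)`. Either it lies even in `range (2 * d -
(k + 1))`, and its entries come from sets of size k + 2, or it contains the top element 2d - (k +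
1), and its entries are extrapolated from the sets just treated. -/
theorem halts_levelStep {d k : ℕ} {u : Fin n} {l : List (Finset ℕ)} {s : State} (hd : d ≤ n)
    (hs : Setup n d s) (hl : IsFamily n d l) (h6 : s.reg 6 = l.length) (h9 : s.reg 9 = u)
    (h11 : s.reg 11 = (k + 1 : ℕ)) (h12 : s.reg 12 = 2 ^ (2 * d - (k + 1))) (hk : k + 1 < d)
    (hm : MemSetup adj l s.mem) (hL : LevelDone adj d (k + 2) u s.mem) :
    Halts (allBits n) levelStep (levelTime n l.length) (fun s' => s'.reg 11 = k ∧
      s'.reg 12 = 2 ^ (2 * d - k) ∧ (∀ r < 11, s'.reg r = s.reg r) ∧ MemSetup adj l s'.mem ∧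
      LevelDone adj d (k + 1) u s'.mem) s := by
  have small : ∀ a : ℤ, |a| ≤ 8 * n + 8 → |a| < 2 ^ allBits n := fun a => lt_pow_allBits_of_le'
  have b1 : |(1 : ℤ)| < 2 ^ allBits n := small _ (by norm_num; linarith)
  have hsub := hl.subset hd
  have hb : ∀ S ∈ l, S.card = k + 1 → ∀ v, |tableEntry adj d u S v| ≤ 2 ^ (prodBits n * n) :=
    fun S hS hc v => abs_tableEntry_le adj hd u v
      ((hsub S hS).trans (Finset.range_subset_range.2 (by omega))) (by omega)
  have hbm : ∀ S ∈ l, |(bitMask S : ℤ)| < 2 ^ allBits n := fun S hS =>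
    cast_lt_pow_allBits (bitMask_lt_iff.2
      ((hsub S hS).trans (Finset.range_subset_range.2 (by omega))))
  have hb34 : ∀ S ∈ l, |2 ^ (2 * d - (k + 1)) - (bitMask S : ℤ)| < 2 ^ allBits n := by
    intro S hS
    have h1 := hbm S hS
    have h2 := pow_two_lt_pow_allBits (n := n) (j := 2 * d - (k + 1)) (by omega)
    rw [abs_lt] at h1 h2 ⊢
    have h3 : (0 : ℤ) < 2 ^ (2 * d - (k + 1)) := by positivity
    constructor <;> linarith
  have hsel : ∀ S ∈ l, S.card = k + 1 → (0 < (2 : ℤ) ^ (2 * d - (k + 1)) - bitMask S ↔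
      S ⊆ Finset.range (2 * d - (k + 1))) := by
    intro S hS hc
    rw [← bitMask_lt_iff, sub_pos]
    exact_mod_cast Iff.rfl
  have hsel' : ∀ S ∈ l, S.card = k + 1 → (¬ S ⊆ Finset.range (2 * d - (k + 1)) ↔
      2 * d - (k + 1) ∈ S) := by
    intro S hS hc
    have h1 := (hl.mem_iff S).1 hS
    rw [hc] at h1
    constructor
    · intro h
      obtain ⟨i, hi, hi'⟩ := Finset.not_subset.1 h
      have h2 := Finset.mem_range.1 (h1 hi)
      rw [Finset.mem_range] at hi'
      rwa [show 2 * d - (k + 1) = i by omega]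
    · exact fun h h' => absurd (Finset.mem_range.1 (h' h)) (by omega)
  refine Halts.mono (k := l.length * (innerTime n + 12) + 2 +
    (l.length * (outerTime n + 12) + 2 + (1 + 1))) ?_ (by rw [levelTime]; omega) fun _ h => h
  refine Halts.seq (halts_pass adj (c := innerTime n) (u := u)
    (sel := fun S => S.card = k + 1 ∧ S ⊆ Finset.range (2 * d - (k + 1))) hd hs h6 h11 (by omega)
    (by rw [innerTime]; omega) hl.length_le hsub (fun S _ h => h.1) (fun S hS hc => ?_) hm) ?_
  · intro s' hr h15 hF
    refine Halts.seq_arith _ _ ((hr 12 (by norm_num)).trans h12) h15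
      (pow_two_lt_pow_allBits (by omega)) (hbm S hS) ?_
    refine halts_cond (k := n * (edgeCellTime n + 2) + 2) (by simpa [Op.eval] using hb34 S hS)
      (fun h => ?_) fun h => ?_
    · have hS' := (hsel S hS hc).1 (by simpa [Op.eval] using h)
      refine (halts_vertexLoop adj (sel := fun S => S.card = k + 1 ∧
        S ⊆ Finset.range (2 * d - (k + 1))) (d := d) (m₀ := s.mem) (hs.congr fun r h => ?_) ?_ ?_ hS ⟨hc, hS'⟩
        (hb S hS hc)).mono le_rfl ?_
      · rw [State.reg_setReg, if_neg (by omega), hr r (by omega)]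
      · intro v t ht h17 hFt
        have htr : ∀ r < 13, t.reg r = s.reg r := fun r h => by
          rw [ht r (by omega), State.reg_setReg, if_neg (by omega), hr r h]
        refine halts_edgeCell adj (l := l) hd (hs.congr fun r h => htr r (by omega)) hFt.1
          (by rw [htr 9 (by norm_num), h9]) (by rw [htr 11 (by norm_num), h11, hc])
          (by rw [htr 12 (by norm_num), h12, hc]) (by rw [ht 15 (by norm_num)]; simpa using h15)
          h17 (by omega) (by rwa [hc]) (fun T hT hTs w => ?_)
        rw [hFt.eq_of_not adj (fun h => by omega)]
        exact hL T (by omega) (by rwa [hc, show 2 * d - (k + 1) = 2 * d + 1 - (k + 2) by omega]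
          at hTs) w
      · exact hF
      · rintro t ⟨kr, kF, kf, ko⟩
        refine ⟨fun r h => ?_, kF, fun _ => kf, ko⟩
        rw [kr r (by omega), State.reg_setReg, if_neg (by omega)]
    · refine (halts_skip ?_ : Halts _ _ 1 _ _).mono (by omega) fun _ h => h
      refine ⟨fun r h => ?_, hF, fun h' => ?_, fun _ _ => rfl⟩
      · rw [State.reg_setReg, if_neg (by omega)]
      · exact absurd ((hsel S hS hc).2 h'.2) (by simpa [Op.eval] using h)
  rintro s₁ ⟨hr₁, hF₁, hfill₁⟩
  have hs₁ : Setup n d s₁ := hs.congr fun r h => hr₁ r (by omega)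
  have hL₁ : ∀ T : Finset ℕ, T.card = k + 1 → T ⊆ Finset.range (2 * d - (k + 1)) → ∀ v : Fin n,
      s₁.mem (tableAddr n (bitMask T) v) = tableEntry adj d u T v := fun T hc hT v =>
    hfill₁ T ((hl.mem_iff T).2 (hT.trans (Finset.range_subset_range.2 (by omega)))) ⟨hc, hT⟩ v
  refine Halts.seq (halts_pass adj (c := outerTime n) (u := u)
    (sel := fun S => S.card = k + 1 ∧ 2 * d - (k + 1) ∈ S) hd hs₁
    (by rw [hr₁ 6 (by norm_num), h6]) (by rw [hr₁ 11 (by norm_num), h11]) (by omega)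
    (by rw [outerTime]; omega) hl.length_le hsub (fun S _ h => h.1) (fun S hS hc => ?_) hF₁.1) ?_
  · intro s' hr h15 hF
    refine Halts.seq_arith _ _ ((hr 12 (by norm_num)).trans ((hr₁ 12 (by norm_num)).trans h12)) h15
      (pow_two_lt_pow_allBits (by omega)) (hbm S hS) ?_
    refine halts_cond (k := n * (extrapCellTime n + 2) + 2) (by simpa [Op.eval] using hb34 S hS)
      (fun h => ?_) fun h => ?_
    · refine (halts_skip ?_ : Halts _ _ 1 _ _).mono (by omega) fun _ h => h
      refine ⟨fun r h => ?_, hF, fun h' => ?_, fun _ _ => rfl⟩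
      · rw [State.reg_setReg, if_neg (by omega)]
      · exact absurd ((hsel S hS hc).1 (by simpa [Op.eval] using h)) ((hsel' S hS hc).2 h'.2)
    · have hS' := (hsel' S hS hc).1 (mt (hsel S hS hc).2 (by simpa [Op.eval] using h))
      refine (halts_vertexLoop adj (sel := fun S => S.card = k + 1 ∧ 2 * d - (k + 1) ∈ S) (d := d)
        (m₀ := s₁.mem)
        (hs₁.congr fun r h => ?_) ?_ ?_ hS ⟨hc, hS'⟩ (hb S hS hc)).mono le_rfl ?_
      · rw [State.reg_setReg, if_neg (by omega), hr r (by omega)]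
      · intro v t ht h17 hFt
        have htr : ∀ r < 13, t.reg r = s.reg r := fun r h => by
          rw [ht r (by omega), State.reg_setReg, if_neg (by omega), hr r h, hr₁ r h]
        refine halts_extrapCell adj (l := l) hd (hs.congr fun r h => htr r (by omega)) hFt.1
          (by rw [htr 11 (by norm_num), h11, hc])
          (by rw [htr 12 (by norm_num), h12, hc]) (by rw [ht 15 (by norm_num)]; simpa using h15)
          h17 (by omega) ?_ (by rwa [hc]) (fun T hT hTs w => ?_)
        · refine ((hl.mem_iff S).1 hS).trans (Finset.range_subset_range.2 (by omega))
        · rw [hc] at hT hTs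
          rw [hFt.eq_of_not adj (fun h => absurd (Finset.mem_range.1 (hTs h.2)) (by omega))]
          exact hL₁ T hT hTs w
      · exact hF
      · rintro t ⟨kr, kF, kf, ko⟩
        refine ⟨fun r h => ?_, kF, fun _ => kf, ko⟩
        rw [kr r (by omega), State.reg_setReg, if_neg (by omega)]
  rintro s₂ ⟨hr₂, hF₂, hfill₂⟩
  refine Halts.seq_arith (k + 1 : ℕ) 1 (by rw [hr₂ 11 (by norm_num), hr₁ 11 (by norm_num), h11])
    (by rw [hr₂ 2 (by norm_num), hs₁.r2]) (small _ (by rw [Nat.abs_cast]; push_cast; omega)) b1 ?_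
  have h12' : s₂.reg 12 = 2 ^ (2 * d - (k + 1)) := by
    rw [hr₂ 12 (by norm_num), hr₁ 12 (by norm_num), h12]
  refine halts_arith _ _ (by simp [h12']; rfl) (by simp [h12']; rfl)
    (pow_two_lt_pow_allBits (by omega)) (pow_two_lt_pow_allBits (by omega)) ?_
  refine ⟨by simp [Op.eval], ?_, fun r h => ?_, hF₂.1, fun T hc hT v => ?_⟩
  · rw [show 2 * d - k = 2 * d - (k + 1) + 1 by omega, pow_succ, mul_two]
    simp [Op.eval]
  · simp only [State.reg_setReg]
    rw [if_neg (by omega), if_neg (by omega), hr₂ r (by omega), hr₁ r (by omega)]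
  · have hTl : T ∈ l := (hl.mem_iff T).2 (by rwa [hc])
    simp only [State.mem_setReg]
    by_cases h : T ⊆ Finset.range (2 * d - (k + 1))
    · rw [hF₂.eq_of_not adj (fun h' => (hsel' T hTl hc).2 h'.2 h)]
      exact hL₁ T hc h v
    · exact hfill₂ T hTl ⟨hc, (hsel' T hTl hc).1 h⟩ v

end

section

variable {n : ℕ} (adj : Fin n → Fin n → Prop) [DecidableRel adj]

/-- Levels are filled from size d down to size 1; for d = 1 the loop is empty and the base level is
read. Entries left from another start vertex do no harm: they obey the common bound and are
overwritten before their values matter. -/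
theorem halts_vertexRound {d : ℕ} {u : Fin n} {l : List (Finset ℕ)} {s : State} (hd : d ≤ n)
    (hd1 : 1 ≤ d) (hs : Setup n d s) (hl : IsFamily n d l) (h6 : s.reg 6 = l.length)
    (h9 : s.reg 9 = u) (h10 : s.reg 10 = 2 ^ d) (hm : MemSetup adj l s.mem) :
    Halts (allBits n) vertexRound (roundTime n l.length) (fun s' =>
      s'.reg 8 = (if 0 < walkWeight adj (vertexLabel u) u (d - 1) u {vertexLabel u u} then 1
        else s.reg 8) ∧
      (∀ r < 11, r ≠ 8 → s'.reg r = s.reg r) ∧ MemSetup adj l s'.mem) s := by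
  have small : ∀ a : ℤ, |a| ≤ 8 * n + 8 → |a| < 2 ^ allBits n := fun a => lt_pow_allBits_of_le'
  have b0 : |(0 : ℤ)| < 2 ^ allBits n := small _ (by norm_num; linarith)
  have b1 : |(1 : ℤ)| < 2 ^ allBits n := small _ (by norm_num; linarith)
  have bd : |(d : ℤ)| < 2 ^ allBits n := small _ (by rw [Nat.abs_cast]; omega)
  have hsub := hl.subset hd
  have hsub' : ∀ S ∈ l, S ⊆ Finset.range (2 * n + 1) := fun S hS =>
    (hsub S hS).trans (Finset.range_subset_range.2 (by omega))
  refine Halts.mono (k := l.length * (n * 9 + 2 + 12) + 2 + (((d - 1) * (levelTime n l.length + 1) + 1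
    + 5) + 2) + 1) ?_ ?_ fun _ h => h
  swap
  · have : (d - 1) * (levelTime n l.length + 1) ≤ n * (levelTime n l.length + 1) :=
      Nat.mul_le_mul_right _ (by omega)
    rw [roundTime, show n * 9 + 2 + 12 = n * 9 + 14 by ring]
    omega
  refine Halts.seq_arith d 0 hs.r1 hs.r4 bd b0 ?_
  have hs₀ : Setup n d (s.setReg 11 (Op.add.eval d 0)) := hs.congr fun r h => by
    rw [State.reg_setReg, if_neg (by omega)]
  refine Halts.seq (halts_pass adj (c := n * 9 + 2) (k := d) (u := u) (l := l)
    (sel := fun S => S.card = d) hd hs₀ (by simp [h6]) (by simp [Op.eval]) le_rfl (by omega)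
    hl.length_le hsub (fun S _ h => h) (fun S hS hc => ?_) hm) ?_
  · intro s' hr h15 hF
    refine (halts_vertexLoop adj (c := 7) (sel := fun S => S.card = d) (d := d) (m₀ := s.mem)
      (hs₀.congr fun r h => hr r (by omega)) ?_ hF hS hc
      fun v => abs_tableEntry_le adj hd u v (hsub' S hS) hc.le).mono le_rfl ?_
    · intro v t ht h17 hFt
      refine halts_baseCell adj (l := l) (hs₀.congr fun r h => ?_) hFt.1 ?_ ?_ h17 (hsub' S hS) hc
      · rw [ht r (by omega), hr r (by omega)]
      · rw [ht 9 (by norm_num), hr 9 (by norm_num)]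
        simpa using h9
      · rw [ht 15 (by norm_num), h15]
    · rintro t ⟨kr, kF, kf, ko⟩
      exact ⟨fun r h => kr r (by omega), kF, fun _ => kf, ko⟩
  rintro s₁ ⟨hr₁, hF₁, hfill₁⟩
  have hs₁ : Setup n d s₁ := hs₀.congr fun r h => hr₁ r (by omega)
  have hr₁' : ∀ r < 11, s₁.reg r = s.reg r := fun r h => by
    rw [hr₁ r (by omega), State.reg_setReg, if_neg (by omega)]
  have hL₁ : LevelDone adj d (d - 1 + 1) u s₁.mem := fun T hc hT v =>
    hfill₁ T ((hl.mem_iff T).2 (by rwa [hc])) (by omega) v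
  refine Halts.seq_arith d 1 (by rw [hr₁ 11 (by norm_num)]; simp [Op.eval]) hs₁.r2 bd b1 ?_
  refine Halts.seq_arith (2 ^ d) (2 ^ d) (by simp [hr₁', h10]) (by simp [hr₁', h10])
    (pow_two_lt_pow_allBits (by omega)) (pow_two_lt_pow_allBits (by omega)) ?_
  refine Halts.seq (k := (d - 1) * (levelTime n l.length + 1) + 1) (k' := 5)
    (halts_loop_counter (k := levelTime n l.length) (fun j s' =>
      s'.reg 12 = 2 ^ (2 * d - j) ∧ (∀ r < 11, s'.reg r = s.reg r) ∧ MemSetup adj l s'.mem ∧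
      LevelDone adj d (j + 1) u s'.mem) (d - 1) ?_ ?_ ?_ ?_ (Q := fun s' =>
      (∀ r < 11, s'.reg r = s.reg r) ∧ MemSetup adj l s'.mem ∧ LevelDone adj d 1 u s'.mem) ?_) ?_
  · refine (le_abs_self _).trans_lt (small _ ?_)
    rw [Nat.abs_cast]
    omega
  · rintro j hj s' h11 ⟨h12, hr, hm', hL⟩
    refine (halts_levelStep adj hd (hs.congr fun r h => hr r (by omega)) hl
      (by rw [hr 6 (by norm_num), h6]) (by rw [hr 9 (by norm_num), h9]) h11 h12 (by omega) hm'
      hL).mono le_rfl ?_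
    rintro t ⟨k11, k12, kr, km, kL⟩
    exact ⟨k11, k12, fun r h => by rw [kr r h, hr r h], km, kL⟩
  · simp [Op.eval]
    omega
  · refine ⟨?_, fun r h => ?_, hF₁.1, hL₁⟩
    · rw [show 2 * d - (d - 1) = d + 1 by omega, pow_succ, mul_two]
      simp [Op.eval]
    · simp only [State.reg_setReg]
      rw [if_neg (by omega), if_neg (by omega), hr₁' r h]
  · rintro s' - ⟨-, hr, hm', hL⟩
    exact ⟨hr, hm', hL⟩
  rintro s₂ ⟨hr₂, hm₂, hL₂⟩
  have hn : 0 < n := u.pos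
  have hw : ∀ m ≤ 1, ∀ v < n, |tableAddr n m v| < 2 ^ allBits n := fun m hm v hv =>
    (tableAddr_bounds (by have := Nat.one_le_two_pow (n := 2 * n + 1); omega) hv).2.2.2.2.1
  have hnn : |(n : ℤ) * n + n| < 2 ^ allBits n := by
    have := hw 1 le_rfl 0 hn
    rwa [tableAddr, Nat.cast_one, one_mul, Nat.cast_zero, add_zero, add_comm] at this
  have hn2 : |(n : ℤ) * n| < 2 ^ allBits n := by
    have := hw 0 zero_le_one 0 hn
    rwa [tableAddr, Nat.cast_zero, zero_mul, zero_add, zero_add] at this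
  have haddr : tableAddr n 1 u = (n : ℤ) * n + n + u := by
    rw [tableAddr, Nat.cast_one]
    ring
  -- Since u has label 0, the remembered set is {0}, whose mask is 1.
  have hent : s₂.mem ((n : ℤ) * n + n + u) =
      walkWeight adj (vertexLabel u) u (d - 1) u {vertexLabel u u} := by
    have h1 := hL₂ {0} (Finset.card_singleton 0)
      (Finset.singleton_subset_iff.2 (Finset.mem_range.2 (by omega))) u
    rw [show bitMask {0} = 1 by simp [bitMask], tableEntry, Finset.card_singleton, haddr] at h1
    rw [h1]
    congr 1
    simp [setLabels, vertexLabel]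
  have hval : |walkWeight adj (vertexLabel u) u (d - 1) u {vertexLabel u u}| < 2 ^ allBits n := by
    rw [← hent]
    exact lt_pow_allBits (hm₂.bound _) (by omega)
  refine Halts.seq_arith (n * n) n (by rw [hr₂ 5 (by norm_num), hs.r5])
    (by rw [hr₂ 0 (by norm_num), hs.r0]) hn2 (small _ (by rw [Nat.abs_cast]; linarith)) ?_
  refine Halts.seq_arith (n * n + n) u (by simp [Op.eval]) (by simp [hr₂, h9]) hnn
    (small _ (by rw [Nat.abs_cast]; have := u.2; omega)) ?_
  refine Halts.seq_load (n * n + n + u) _ (by simp [Op.eval]) hent (haddr ▸ hw 1 le_rfl u u.2) hval ?_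
  refine halts_cond (k := 1) (by simpa using hval) (fun h => halts_const b1 ?_)
    fun h => halts_skip ?_
  · have h' : 0 < walkWeight adj (vertexLabel u) u (d - 1) u {vertexLabel u u} := by simpa using h
    refine ⟨by rw [if_pos h']; simp, fun r h h8 => ?_, hm₂⟩
    simp only [State.reg_setReg]
    rw [if_neg (by omega), if_neg (by omega), if_neg (by omega), if_neg (by omega), hr₂ r h]
  · have h' : ¬ 0 < walkWeight adj (vertexLabel u) u (d - 1) u {vertexLabel u u} := by
      simpa using h
    refine ⟨by rw [if_neg h']; simp [hr₂], fun r h h8 => ?_, hm₂⟩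
    simp only [State.reg_setReg]
    rw [if_neg (by omega), if_neg (by omega), if_neg (by omega), hr₂ r h]

theorem halts_search {d : ℕ} {l : List (Finset ℕ)} {s : State} (hd : d ≤ n)
    (hd1 : 1 ≤ d) (hs : Setup n d s) (hl : IsFamily n d l) (h6 : s.reg 6 = l.length)
    (h8 : s.reg 8 = 0) (h10 : s.reg 10 = 2 ^ d) (hm : MemSetup adj l s.mem) :
    Halts (allBits n) search (searchTime n l.length) (fun s' =>
      ((∃ u, 0 < walkWeight adj (vertexLabel u) u (d - 1) u {vertexLabel u u}) → s'.reg 0 = 1) ∧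
      ((¬ ∃ u, 0 < walkWeight adj (vertexLabel u) u (d - 1) u {vertexLabel u u}) → s'.reg 0 = 0))
      s := by
  have small : ∀ a : ℤ, |a| ≤ 8 * n + 8 → |a| < 2 ^ allBits n := fun a => lt_pow_allBits_of_le'
  have b0 : |(0 : ℤ)| < 2 ^ allBits n := small _ (by norm_num; linarith)
  have b1 : |(1 : ℤ)| < 2 ^ allBits n := small _ (by norm_num; linarith)
  have bn : |(n : ℤ)| < 2 ^ allBits n := small _ (by rw [Nat.abs_cast]; linarith)
  refine Halts.mono (k := n * (roundTime n l.length + 1 + 1) + 1 + 1 + 1) ?_ (by rw [searchTime])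
    fun _ h => h
  refine Halts.seq_arith n 0 hs.r0 hs.r4 bn b0 ?_
  refine Halts.seq (k := n * (roundTime n l.length + 1 + 1) + 1) (k' := 1)
    (halts_loop_counter (k := roundTime n l.length + 1) (fun j s' =>
      (∀ r < 11, r ≠ 8 → r ≠ 9 → s'.reg r = s.reg r) ∧ MemSetup adj l s'.mem ∧
      ((∃ u : Fin n, j ≤ u ∧ 0 < walkWeight adj (vertexLabel u) u (d - 1) u {vertexLabel u u}) →
        s'.reg 8 = 1) ∧
      ((¬ ∃ u : Fin n, j ≤ u ∧ 0 < walkWeight adj (vertexLabel u) u (d - 1) u {vertexLabel u u}) →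
        s'.reg 8 = 0)) n ((le_abs_self _).trans_lt bn) ?_ ?_ ?_ ?_ (Q := fun s' =>
      s'.reg 4 = 0 ∧
      ((∃ u : Fin n, 0 < walkWeight adj (vertexLabel u) u (d - 1) u {vertexLabel u u}) →
        s'.reg 8 = 1) ∧
      ((¬ ∃ u : Fin n, 0 < walkWeight adj (vertexLabel u) u (d - 1) u {vertexLabel u u}) →
        s'.reg 8 = 0))) ?_
  · rintro j hj s' h9 ⟨hr, hm', hyes, hno⟩
    refine Halts.seq_arith (j + 1 : ℕ) 1 h9 (by rw [hr 2 (by norm_num) (by norm_num) (by norm_num),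
      hs.r2]) (small _ (by rw [Nat.abs_cast]; push_cast; omega)) b1 ?_
    refine (halts_vertexRound adj (u := ⟨j, hj⟩) hd hd1 (hs.congr fun r h => ?_) hl ?_ ?_ ?_
      ?_).mono le_rfl ?_
    · rw [State.reg_setReg, if_neg (by omega)]
      exact hr r (by omega) (by omega) (by omega)
    · simp [hr, h6]
    · simp [Op.eval]
    · simp [hr, h10]
    · exact hm'
    · rintro t ⟨k8, kr, km⟩
      have hsplit : (∃ u : Fin n, j ≤ u ∧
          0 < walkWeight adj (vertexLabel u) u (d - 1) u {vertexLabel u u}) ↔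
          (0 < walkWeight adj (vertexLabel ⟨j, hj⟩) ⟨j, hj⟩ (d - 1) ⟨j, hj⟩
            {vertexLabel ⟨j, hj⟩ ⟨j, hj⟩}) ∨ ∃ u : Fin n, j + 1 ≤ u ∧
          0 < walkWeight adj (vertexLabel u) u (d - 1) u {vertexLabel u u} := by
        constructor
        · rintro ⟨u, hu, h⟩
          rcases Nat.eq_or_lt_of_le hu with h' | h'
          · left
            rwa [show (⟨j, hj⟩ : Fin n) = u from Fin.ext h']
          · exact Or.inr ⟨u, h', h⟩
        · rintro (h | ⟨u, hu, h⟩)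
          · exact ⟨⟨j, hj⟩, le_rfl, h⟩
          · exact ⟨u, by omega, h⟩
      rw [State.reg_setReg, if_neg (show ¬ 8 = 9 by norm_num)] at k8
      refine ⟨by rw [kr 9 (by norm_num) (by norm_num)]; simp [Op.eval], fun r h h8 h9 => ?_, km,
        fun h => ?_, fun h => ?_⟩
      · rw [kr r h h8, State.reg_setReg, if_neg h9, hr r h h8 h9]
      · rw [k8]
        split_ifs with h'
        · rfl
        · exact hyes ((hsplit.1 h).resolve_left h')
      · rw [hsplit, not_or] at h
        rw [k8, if_neg h.1]
        exact hno h.2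
  · simp [Op.eval]
  · refine ⟨fun r h h8 h9 => ?_, hm, fun ⟨u, hu, _⟩ => absurd u.2 (by omega), fun _ => ?_⟩
    · rw [State.reg_setReg, if_neg h9]
    · rw [State.reg_setReg, if_neg (by norm_num), h8]
  · rintro s' - ⟨hr, -, hyes, hno⟩
    simp only [Nat.zero_le, true_and] at hyes hno
    exact ⟨by rw [hr 4 (by norm_num) (by norm_num) (by norm_num), hs.r4], hyes, hno⟩
  · rintro s' ⟨h4, hyes, hno⟩
    refine halts_arith (s'.reg 8) 0 rfl h4 ?_ b0 ⟨fun h => ?_, fun h => ?_⟩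
    · by_cases h : ∃ u : Fin n, 0 < walkWeight adj (vertexLabel u) u (d - 1) u {vertexLabel u u}
      · rw [hyes h]; exact b1
      · rw [hno h]; exact b0
    · simp [Op.eval, hyes h]
    · simp [Op.eval, hno h]

end

/-! ### Listing the stored sets -/

theorem Setup.congr_of_ne {n d : ℕ} {s s' : State} (h : Setup n d s)
    (hr : ∀ r < 8, r ≠ 6 → s'.reg r = s.reg r) : Setup n d s' where
  r0 := (hr 0 (by norm_num) (by norm_num)).trans h.r0
  r1 := (hr 1 (by norm_num) (by norm_num)).trans h.r1
  r2 := (hr 2 (by norm_num) (by norm_num)).trans h.r2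
  r3 := (hr 3 (by norm_num) (by norm_num)).trans h.r3
  r4 := (hr 4 (by norm_num) (by norm_num)).trans h.r4
  r5 := (hr 5 (by norm_num) (by norm_num)).trans h.r5
  r7 := (hr 7 (by norm_num) (by norm_num)).trans h.r7

/-- Appends the set with mask in register `15` and size in register `16` to the list. -/
def appendSet : Prog :=
  .arith .add 33 6 6 ;; .arith .sub 33 4 33 ;; .arith .sub 33 33 2 ;; .store 33 15 ;;
  .arith .sub 33 33 2 ;; .store 33 16 ;; .arith .add 6 6 2

/-- Appends to the list all sets obtained by adding the element `i` to a set in the list of size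
less than the content of register `11`, where register `12` holds `2 ^ i`. -/
def growList : Prog :=
  .arith .add 13 6 4 ;; .loop 13 (.arith .sub 13 13 2 ;; .arith .add 33 13 13 ;;
    .arith .sub 33 4 33 ;; .arith .sub 33 33 2 ;; .load 15 33 ;; .arith .sub 33 33 2 ;;
    .load 16 33 ;; .arith .sub 34 11 16 ;; .cond 34 (.arith .add 15 15 12 ;;
    .arith .add 16 16 2 ;; appendSet) .skip)

/-- Lists all sets whose table entries are computed. -/
def buildList : Prog :=
  .const 6 1 ;; .const 12 1 ;; .arith .add 11 7 4 ;;
  .loop 11 (growList ;; .arith .add 12 12 12 ;; .arith .sub 11 11 2)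

/-- Computes `2 ^ d` in register `10`. -/
def powerProg : Prog :=
  .const 10 1 ;; .arith .add 11 1 4 ;; .loop 11 (.arith .add 10 10 10 ;; .arith .sub 11 11 2)

/-- The list of those sets in the family that are contained in `range i`. -/
structure IsPartialFamily (d i : ℕ) (l : List (Finset ℕ)) : Prop where
  nodup : l.Nodup
  mem_iff : ∀ S, S ∈ l ↔ S ⊆ Finset.range i ∧ S ⊆ Finset.range (2 * d + 1 - S.card)

theorem isPartialFamily_zero (d : ℕ) : IsPartialFamily d 0 [∅] where
  nodup := List.nodup_singleton _
  mem_iff S := by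
    rw [List.mem_singleton, Finset.range_zero, Finset.subset_empty]
    constructor
    · rintro rfl
      exact ⟨rfl, Finset.empty_subset _⟩
    · exact fun h => h.1

/-- The list after the sets at the positions from `j` on have been processed by `growList`. -/
def grown (c i : ℕ) (l : List (Finset ℕ)) (j : ℕ) : List (Finset ℕ) :=
  l ++ ((l.drop j).reverse.filter fun S => S.card < c).map (insert i)

theorem grown_length (c i : ℕ) (l : List (Finset ℕ)) : grown c i l l.length = l := by
  simp [grown]

theorem grown_eq (c i : ℕ) (l : List (Finset ℕ)) {j : ℕ} (hj : j < l.length) :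
    grown c i l j =
      grown c i l (j + 1) ++ if l[j].card < c then [insert i l[j]] else [] := by
  rw [grown, grown, List.drop_eq_getElem_cons hj, List.reverse_cons, List.filter_append,
    List.map_append, List.append_assoc]
  congr 2
  split_ifs with h <;> simp [h]

theorem mem_grown {c i j : ℕ} {l : List (Finset ℕ)} {S : Finset ℕ} (h : S ∈ grown c i l j) :
    S ∈ l ∨ ∃ T ∈ l, T.card < c ∧ insert i T = S := by
  rw [grown, List.mem_append, List.mem_map] at h
  refine h.imp id ?_
  rintro ⟨T, hT, rfl⟩
  rw [List.mem_filter, List.mem_reverse] at hT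
  exact ⟨T, List.mem_of_mem_drop hT.1, by simpa using hT.2, rfl⟩

theorem getElem_grown (c i j k : ℕ) (l : List (Finset ℕ)) (hk : k < l.length)
    (hk' : k < (grown c i l j).length) : (grown c i l j)[k] = l[k] := by
  simp [grown, List.getElem_append_left hk]

theorem IsPartialFamily.not_mem {d i : ℕ} {l : List (Finset ℕ)} (h : IsPartialFamily d i l)
    {S : Finset ℕ} (hS : S ∈ l) : i ∉ S := fun hi =>
  (Finset.mem_range.1 (((h.mem_iff S).1 hS).1 hi)).ne rfl

/-- After i is added, the size is |S| + 1 and the condition i < 2d + 1 - (|S| + 1) amounts to |S| <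
2d - i; this is the threshold in register 11. -/
theorem IsPartialFamily.insert_subset {d i : ℕ} {l : List (Finset ℕ)} (h : IsPartialFamily d i l)
    {S : Finset ℕ} (hS : S ∈ l) (hc : S.card < 2 * d - i) :
    insert i S ⊆ Finset.range (i + 1) ∧
      insert i S ⊆ Finset.range (2 * d + 1 - (insert i S).card) := by
  have h1 : insert i S ⊆ Finset.range (i + 1) := by
    rw [Finset.range_add_one]
    exact Finset.insert_subset_insert i ((h.mem_iff S).1 hS).1
  refine ⟨h1, h1.trans (Finset.range_subset_range.2 ?_)⟩
  rw [Finset.card_insert_of_notMem (h.not_mem hS)]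
  omega

theorem IsPartialFamily.grown_subset {d i j : ℕ} {l : List (Finset ℕ)} (h : IsPartialFamily d i l)
    {S : Finset ℕ} (hS : S ∈ grown (2 * d - i) i l j) :
    S ⊆ Finset.range (i + 1) ∧ S ⊆ Finset.range (2 * d + 1 - S.card) := by
  obtain hS | ⟨T, hT, hc, rfl⟩ := mem_grown hS
  · obtain ⟨h1, h2⟩ := (h.mem_iff S).1 hS
    exact ⟨h1.trans (Finset.range_subset_range.2 (by omega)), h2⟩
  · exact h.insert_subset hT hc

/-- Stated for every intermediate list, because the Fibonacci bound must already control the length,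
and with it the addresses, during growth. -/
theorem IsPartialFamily.nodup_grown {d i : ℕ} {l : List (Finset ℕ)} (h : IsPartialFamily d i l)
    (c j : ℕ) : (grown c i l j).Nodup := by
  have hmem : ∀ T ∈ (l.drop j).reverse.filter fun S => S.card < c, i ∉ T := fun T hT =>
    h.not_mem (List.mem_of_mem_drop (List.mem_reverse.1 (List.mem_filter.1 hT).1))
  refine List.Nodup.append h.nodup (List.Nodup.map_on (fun S hS T hT hST => ?_) ?_) ?_
  · rw [← Finset.erase_insert (hmem S hS), hST, Finset.erase_insert (hmem T hT)]
  · exact ((List.nodup_reverse.2 (h.nodup.sublist (List.drop_sublist _ _))).filter _)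
  · intro S hS hS'
    obtain ⟨T, hT, rfl⟩ := List.mem_map.1 hS'
    exact h.not_mem hS (Finset.mem_insert_self i T)

/-- The family is closed under deleting elements, so each new set containing i arises from one
already listed. -/
theorem IsPartialFamily.grown {d i : ℕ} {l : List (Finset ℕ)} (h : IsPartialFamily d i l) :
    IsPartialFamily d (i + 1) (grown (2 * d - i) i l 0) where
  nodup := h.nodup_grown _ _
  mem_iff S := by
    refine ⟨h.grown_subset, fun ⟨h1, h2⟩ => ?_⟩
    rw [Ram.grown, List.mem_append, List.mem_map]
    by_cases hi : i ∈ S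
    · right
      have hc := Finset.card_erase_add_one hi
      have hi' := Finset.mem_range.1 (h2 hi)
      refine ⟨S.erase i, ?_, Finset.insert_erase hi⟩
      rw [List.mem_filter, List.mem_reverse, List.drop_zero, h.mem_iff, decide_eq_true_eq]
      refine ⟨⟨?_, ?_⟩, by omega⟩
      · rw [← Finset.subset_insert_iff, ← Finset.range_add_one]
        exact h1
      · exact (Finset.erase_subset _ _).trans (h2.trans (Finset.range_subset_range.2 (by omega)))
    · left
      refine (h.mem_iff S).2 ⟨fun k hk => ?_, h2⟩
      have := Finset.mem_range.1 (h1 hk)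
      have : k ≠ i := fun h' => hi (h' ▸ hk)
      exact Finset.mem_range.2 (by omega)

/-- A crude bound, sufficient to keep the list addresses within the bit bound. -/
theorem fib_two_mul_add_two_le (d : ℕ) : Nat.fib (2 * d + 2) ≤ 2 ^ (2 * d + 1) := by
  induction d with
  | zero => simp
  | succ d ih =>
    have h1 := Nat.fib_add_two (n := 2 * d + 2)
    have h2 := Nat.fib_add_two (n := 2 * d + 1)
    have h3 := Nat.fib_le_fib_succ (n := 2 * d + 1)
    rw [show 2 * (d + 1) + 2 = 2 * d + 2 + 2 by ring, h1,
      show 2 * (d + 1) + 1 = 2 * d + 1 + 2 by ring, pow_add]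
    simp only [show 2 * d + 1 + 2 = 2 * d + 3 by ring,   show 2 * d + 1 + 1 = 2 * d + 2 by ring] at *
    omega

section

variable {n : ℕ} (adj : Fin n → Fin n → Prop) [DecidableRel adj]

theorem MemSetup.append {l : List (Finset ℕ)} {m : ℤ → ℤ} (h : MemSetup adj l m) {S : Finset ℕ}
    (hS : S ⊆ Finset.range (2 * n + 1)) (hn : 1 ≤ n) :
    MemSetup adj (l ++ [S]) (Function.update (Function.update m (-(2 * l.length + 1)) (bitMask S))
      (-(2 * l.length + 2)) S.card) where
  adj i j := by
    have h1 : (0 : ℤ) ≤ i * n + j := by positivity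
    rw [Function.update_of_ne (by omega), Function.update_of_ne (by omega), h.adj]
  mask i hi := by
    rw [List.length_append, List.length_singleton] at hi
    rw [Function.update_of_ne (by omega)]
    rcases Nat.lt_succ_iff_lt_or_eq.1 hi with h' | rfl
    · rw [Function.update_of_ne (by omega), h.mask i h', List.getElem_append_left h']
    · simp
  card i hi := by
    rw [List.length_append, List.length_singleton] at hi
    rcases Nat.lt_succ_iff_lt_or_eq.1 hi with h' | rfl
    · rw [Function.update_of_ne (by omega), Function.update_of_ne (by omega), h.card i h',
        List.getElem_append_left h']
    · simp
  bound a := by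
    have h1 : 2 * n + 1 ≤ prodBits n * n := by
      rw [prodBits]
      calc 2 * n + 1 = 1 * (2 * n + 1) * 1 := by ring
        _ ≤ (n + 2) * (2 * n + 1) * n := by gcongr; omega
    have h2 : ∀ b : ℕ, b ≤ 2 ^ (2 * n + 1) → |(b : ℤ)| ≤ 2 ^ (prodBits n * n) := by
      intro b hb
      rw [Nat.abs_cast]
      exact_mod_cast hb.trans (Nat.pow_le_pow_right (by norm_num) h1)
    rw [Function.update_apply, Function.update_apply]
    split_ifs
    · refine h2 _ ((Finset.card_le_card hS).trans ?_)
      rw [Finset.card_range]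
      exact Nat.lt_two_pow_self.le
    · exact h2 _ (bitMask_lt_iff.2 hS).le
    · exact h.bound a

theorem halts_appendSet {d : ℕ} {l : List (Finset ℕ)} {S : Finset ℕ} {s : State}
    (hs : Setup n d s) (hn : 1 ≤ n) (h6 : s.reg 6 = l.length) (h15 : s.reg 15 = bitMask S)
    (h16 : s.reg 16 = S.card) (hlen : l.length < 2 ^ (2 * n + 1))
    (hS : S ⊆ Finset.range (2 * n + 1)) (hm : MemSetup adj l s.mem) :
    Halts (allBits n) appendSet 7 (fun s' => (∀ r < 14, r ≠ 6 → s'.reg r = s.reg r) ∧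
      s'.reg 6 = (l ++ [S]).length ∧ MemSetup adj (l ++ [S]) s'.mem) s := by
  have small : ∀ a : ℤ, |a| ≤ 8 * n + 8 → |a| < 2 ^ allBits n := fun a => lt_pow_allBits_of_le'
  have b0 : |(0 : ℤ)| < 2 ^ allBits n := small _ (by norm_num; linarith)
  have b1 : |(1 : ℤ)| < 2 ^ allBits n := small _ (by norm_num; linarith)
  have bS := cast_lt_pow_allBits (bitMask_lt_iff.2 hS)
  have bc : |(S.card : ℤ)| < 2 ^ allBits n := small _ (by
    have := Finset.card_le_card hS
    rw [Finset.card_range] at this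
    rw [Nat.abs_cast]
    omega)
  obtain ⟨c1, c2, c3, c4, c5, c6⟩ := listAddr_lt hlen hn
  refine Halts.seq_arith l.length l.length h6 h6 c1 c1 ?_
  refine Halts.seq_arith 0 (2 * l.length) (by simp [hs.r4]) (by simp [Op.eval]; ring) b0
    (by rwa [abs_neg] at c3) ?_
  refine Halts.seq_arith (-(2 * l.length)) 1 (by simp [Op.eval]) (by simp [hs.r2]) c3 b1 ?_
  refine Halts.seq_store (-(2 * l.length + 1)) (bitMask S) (by simp [Op.eval]; ring)
    (by simp [h15]) c4 bS ?_
  refine Halts.seq_arith (-(2 * l.length + 1)) 1 (by simp [Op.eval]; ring) (by simp [hs.r2]) c4 b1 ?_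
  refine Halts.seq_store (-(2 * l.length + 2)) S.card (by simp [Op.eval]; ring)
    (by simp [h16]) c5 bc ?_
  refine halts_arith l.length 1 (by simp [h6]) (by simp [hs.r2]) c1 b1 ⟨fun r h h' => ?_, ?_, ?_⟩
  · simp only [State.reg_setReg, State.reg_setMem]
    rw [if_neg h', if_neg (by omega), if_neg (by omega), if_neg (by omega), if_neg (by omega)]
  · simp [Op.eval]
  · exact hm.append adj hS hn

/-- The counter runs over the positions of the old list only, and new sets are appended behind them,
so they are not processed again. Each intermediate list is part of the family, hence of at most
Fibonacci length. -/
theorem halts_growList {d i : ℕ} {l : List (Finset ℕ)} {s : State} (hd : d ≤ n) (hn : 1 ≤ n)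
    (hs : Setup n d s) (hi : i < 2 * d) (hl : IsPartialFamily d i l) (h6 : s.reg 6 = l.length)
    (h11 : s.reg 11 = (2 * d - i : ℕ)) (h12 : s.reg 12 = 2 ^ i) (hm : MemSetup adj l s.mem) :
    Halts (allBits n) growList (Nat.fib (2 * d + 2) * 19 + 2) (fun s' =>
      (∀ r < 13, r ≠ 6 → s'.reg r = s.reg r) ∧ s'.reg 6 = (grown (2 * d - i) i l 0).length ∧
      MemSetup adj (grown (2 * d - i) i l 0) s'.mem) s := by
  have small : ∀ a : ℤ, |a| ≤ 8 * n + 8 → |a| < 2 ^ allBits n := fun a => lt_pow_allBits_of_le'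
  have b0 : |(0 : ℤ)| < 2 ^ allBits n := small _ (by norm_num; linarith)
  have b1 : |(1 : ℤ)| < 2 ^ allBits n := small _ (by norm_num; linarith)
  have hfib : Nat.fib (2 * d + 2) ≤ 2 ^ (2 * n + 1) :=
    (fib_two_mul_add_two_le d).trans (Nat.pow_le_pow_right (by norm_num) (by omega))
  have hlen : ∀ j, (grown (2 * d - i) i l j).length ≤ Nat.fib (2 * d + 2) := fun j =>
    List.length_le_fib _ _ (hl.nodup_grown _ j) fun S hS => (hl.grown_subset hS).2
  have hlen' : l.length ≤ Nat.fib (2 * d + 2) := by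
    rw [← grown_length (2 * d - i) i l]
    exact hlen _
  have hsub : ∀ j, ∀ S ∈ grown (2 * d - i) i l j, S ⊆ Finset.range (2 * n + 1) := fun j S hS =>
    (hl.grown_subset hS).1.trans (Finset.range_subset_range.2 (by omega))
  have blen : |(l.length : ℤ)| < 2 ^ allBits n := by
    rcases Nat.eq_zero_or_pos l.length with h | h
    · rw [h]; exact b0
    · have := (listAddr_lt (i := l.length - 1) (by omega) hn).2.2.2.2.2
      rwa [Nat.sub_add_cancel h] at this
  refine Halts.mono (k := l.length * (18 + 1) + 1 + 1) ?_ (by omega) fun _ h => h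
  refine Halts.seq_arith l.length 0 h6 hs.r4 blen b0 ?_
  refine halts_loop_counter (k := 18) (fun j s' => (∀ r < 13, r ≠ 6 → s'.reg r = s.reg r) ∧
      s'.reg 6 = (grown (2 * d - i) i l j).length ∧
      MemSetup adj (grown (2 * d - i) i l j) s'.mem) l.length
    ((le_abs_self _).trans_lt blen) ?_ ?_ ?_ ?_
  · rintro j hj s' h13 ⟨hr, hr6, hm'⟩
    have hs' : s'.reg 2 = 1 ∧ s'.reg 4 = 0 := by
      rw [hr 2 (by norm_num) (by norm_num), hr 4 (by norm_num) (by norm_num)]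
      exact ⟨hs.r2, hs.r4⟩
    obtain ⟨c1, c2, c3, c4, c5, c6⟩ := listAddr_lt (i := j) (by omega) hn
    have hSl : l[j] ∈ l := List.getElem_mem hj
    have hjg : j < (grown (2 * d - i) i l (j + 1)).length := by
      rw [grown, List.length_append]
      omega
    have hmask := hm'.mask j hjg
    have hcard := hm'.card j hjg
    rw [getElem_grown _ _ _ _ _ hj] at hmask hcard
    have hSr : l[j] ⊆ Finset.range i := ((hl.mem_iff _).1 hSl).1
    have hc : l[j].card ≤ 2 * n := by
      have := Finset.card_le_card hSr
      rw [Finset.card_range] at this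
      omega
    have bS := cast_lt_pow_allBits (n := n)
      (bitMask_lt_iff.2 (hSr.trans (Finset.range_subset_range.2 (by omega))))
    have bc : |(l[j].card : ℤ)| < 2 ^ allBits n := small _ (by rw [Nat.abs_cast]; omega)
    have hr11 : s'.reg 11 = (2 * d - i : ℕ) := by rw [hr 11 (by norm_num) (by norm_num), h11]
    have hr12 : s'.reg 12 = 2 ^ i := by rw [hr 12 (by norm_num) (by norm_num), h12]
    have b34 : |((2 * d - i : ℕ) : ℤ) - l[j].card| < 2 ^ allBits n :=
      small _ (by rw [abs_le]; omega)
    refine Halts.seq_arith (j + 1 : ℕ) 1 h13 hs'.1 c6 b1 ?_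
    refine Halts.seq_arith j j (by simp [Op.eval]) (by simp [Op.eval]) c1 c1 ?_
    refine Halts.seq_arith 0 (2 * j) (by simp [hs'.2]) (by simp [Op.eval]; ring) b0
      (by rwa [abs_neg] at c3) ?_
    refine Halts.seq_arith (-(2 * j)) 1 (by simp [Op.eval]) (by simp [hs'.1]) c3 b1 ?_
    refine Halts.seq_load (-(2 * j + 1)) (bitMask l[j]) (by simp [Op.eval]; ring)
      (by simpa using hmask) c4 bS ?_
    refine Halts.seq_arith (-(2 * j + 1)) 1 (by simp [Op.eval]; ring) (by simp [hs'.1]) c4 b1 ?_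
    refine Halts.seq_load (-(2 * j + 2)) l[j].card (by simp [Op.eval]; ring)
      (by simpa using hcard) c5 bc ?_
    refine Halts.seq_arith ((2 * d - i : ℕ) : ℤ) l[j].card
      (by simp only [State.reg_setReg, Nat.reduceEqDiff, ↓reduceIte, hr11])
      (by simp) (small _ (by rw [Nat.abs_cast]; omega)) bc ?_
    refine halts_cond (k := 9)
      (by simpa only [State.reg_setReg, Op.eval, Nat.reduceEqDiff, ↓reduceIte] using b34) (fun h => ?_) fun h => ?_
    · have h' : l[j].card < 2 * d - i := by
        simp only [State.reg_setReg, Op.eval, ↓reduceIte] at h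
        omega
      have hg := grown_eq (2 * d - i) i l hj
      rw [if_pos h'] at hg
      have hi' := hl.not_mem hSl
      refine Halts.seq_arith (bitMask l[j]) (2 ^ i) (by simp) (by simp [hr12]) bS
        (pow_two_lt_pow_allBits (by omega)) ?_
      refine Halts.seq_arith l[j].card 1 (by simp) (by simp [hs'.1]) bc b1 ?_
      refine (halts_appendSet adj (d := d) (l := grown (2 * d - i) i l (j + 1))
        (S := insert i l[j]) (hs.congr_of_ne fun r h h' => ?_) hn ?_ ?_ ?_ ?_ ?_ ?_).mono le_rfl ?_
      · simp only [State.reg_setReg]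
        rw [if_neg (by omega), if_neg (by omega), if_neg (by omega), if_neg (by omega),
          if_neg (by omega), if_neg (by omega), if_neg (by omega), if_neg (by omega),
          if_neg (by omega), if_neg (by omega), hr r (by omega) h']
      · simpa using hr6
      · rw [bitMask_insert hi']
        simp [Op.eval, add_comm]
      · rw [Finset.card_insert_of_notMem hi']
        simp [Op.eval]
      · have := hlen j
        rw [hg, List.length_append, List.length_singleton] at this
        omega
      · refine hsub j _ ?_
        rw [hg]
        exact List.mem_append_right _ (List.mem_singleton_self _)
      · exact hm'
      rintro t ⟨kr, k6, km⟩
      refine ⟨?_, fun r h h' => ?_, ?_, ?_⟩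
      · rw [kr 13 (by norm_num) (by norm_num)]
        simp [Op.eval]
      · rw [kr r (by omega) h']
        simp only [State.reg_setReg]
        rw [if_neg (by omega), if_neg (by omega), if_neg (by omega), if_neg (by omega),
          if_neg (by omega), if_neg (by omega), if_neg (by omega), if_neg (by omega),
          if_neg (by omega), if_neg (by omega), hr r h h']
      · rw [hg, k6]
      · rw [hg]
        exact km
    · have h' : ¬ l[j].card < 2 * d - i := by
        simp only [State.reg_setReg, Op.eval, ↓reduceIte] at h
        omega
      have hg := grown_eq (2 * d - i) i l hj
      rw [if_neg h', List.append_nil] at hg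
      refine (halts_skip ?_ : Halts _ _ 1 _ _).mono (by omega) fun _ h => h
      refine ⟨by simp [Op.eval], fun r h h' => ?_, ?_, ?_⟩
      · simp only [State.reg_setReg]
        rw [if_neg (by omega), if_neg (by omega), if_neg (by omega), if_neg (by omega),
          if_neg (by omega), if_neg (by omega), if_neg (by omega), if_neg (by omega), hr r h h']
      · rw [hg]
        simpa using hr6
      · rw [hg]
        exact hm'
  · simp [Op.eval]
  · refine ⟨fun r h h' => ?_, ?_, ?_⟩
    · rw [State.reg_setReg, if_neg (by omega)]
    · rw [grown_length]
      simpa using h6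
    · rw [grown_length]
      exact hm
  · rintro s' - h
    exact h

theorem halts_buildList {d : ℕ} {s : State} (hd : d ≤ n) (hn : 1 ≤ n) (hs : Setup n d s)
    (hm : MemSetup adj [∅] s.mem) :
    Halts (allBits n) buildList (2 * d * (Nat.fib (2 * d + 2) * 19 + 5) + 4) (fun s' =>
      (∀ r < 11, r ≠ 6 → s'.reg r = s.reg r) ∧ ∃ l, l.length ≤ Nat.fib (2 * d + 2) ∧
        IsFamily n d l ∧ s'.reg 6 = l.length ∧ MemSetup adj l s'.mem) s := by
  have small : ∀ a : ℤ, |a| ≤ 8 * n + 8 → |a| < 2 ^ allBits n := fun a => lt_pow_allBits_of_le'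
  have b0 : |(0 : ℤ)| < 2 ^ allBits n := small _ (by norm_num; linarith)
  have b1 : |(1 : ℤ)| < 2 ^ allBits n := small _ (by norm_num; linarith)
  have bd : |2 * (d : ℤ)| < 2 ^ allBits n := small _ (by rw [abs_le]; omega)
  refine Halts.mono (k := 2 * d * (Nat.fib (2 * d + 2) * 19 + 2 + 1 + 1 + 1) + 1 + 1 + 1 + 1) ?_
    le_rfl fun _ h => h
  refine Halts.seq_const b1 (Halts.seq_const b1 ?_)
  refine Halts.seq_arith (2 * d) 0 (by simp [hs.r7]) (by simp [hs.r4]) bd b0 ?_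
  -- The element being added is i = 2d - (j + 1), so the counter j + 1 is also the size threshold 2d
  -- - i.
  refine halts_loop_counter (k := Nat.fib (2 * d + 2) * 19 + 2 + 1 + 1) (fun j s' =>
      s'.reg 12 = 2 ^ (2 * d - j) ∧ (∀ r < 11, r ≠ 6 → s'.reg r = s.reg r) ∧
      ∃ l, IsPartialFamily d (2 * d - j) l ∧ s'.reg 6 = l.length ∧ MemSetup adj l s'.mem) (2 * d)
    ?_ ?_ ?_ ?_ ?_
  · rw [Nat.cast_mul, Nat.cast_ofNat]
    exact (le_abs_self _).trans_lt bd
  · rintro j hj s' h11 ⟨h12, hr, l, hl, h6, hm'⟩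
    have hs' : Setup n d s' := hs.congr_of_ne fun r h h' => hr r (by omega) h'
    refine Halts.seq (k' := 2) (halts_growList adj (i := 2 * d - (j + 1)) hd hn hs' (by omega) hl h6
      (by rw [h11, show 2 * d - (2 * d - (j + 1)) = j + 1 by omega]) h12 hm') ?_
    rintro t ⟨kr, k6, km⟩
    have h12' : t.reg 12 = 2 ^ (2 * d - (j + 1)) := by rw [kr 12 (by norm_num) (by norm_num), h12]
    refine Halts.seq_arith _ _ h12' h12' (pow_two_lt_pow_allBits (by omega))
      (pow_two_lt_pow_allBits (by omega)) ?_
    refine halts_arith (j + 1 : ℕ) 1 ?_ ?_ (small _ (by rw [Nat.abs_cast]; push_cast; omega)) b1 ?_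
    · rw [State.reg_setReg, if_neg (by norm_num), kr 11 (by norm_num) (by norm_num), h11]
    · rw [State.reg_setReg, if_neg (by norm_num), kr 2 (by norm_num) (by norm_num), hs'.r2]
    refine ⟨by simp [Op.eval], ?_, fun r h h' => ?_, _, ?_, ?_, km⟩
    · rw [show 2 * d - j = 2 * d - (j + 1) + 1 by omega, pow_succ, mul_two]
      simp [Op.eval]
    · simp only [State.reg_setReg]
      rw [if_neg (by omega), if_neg (by omega), kr r (by omega) h', hr r h h']
    · rw [show 2 * d - j = 2 * d - (j + 1) + 1 by omega]
      exact hl.grown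
    · simpa using k6
  · simp [Op.eval]
  · refine ⟨by simp, fun r h h' => ?_, [∅], ?_, by simp, hm⟩
    · simp only [State.reg_setReg]
      rw [if_neg (by omega), if_neg (by omega), if_neg h']
    · rw [Nat.sub_self]
      exact isPartialFamily_zero d
  · rintro s' - ⟨-, hr, l, hl, h6, hm'⟩
    have hlen : l.length ≤ Nat.fib (2 * d + 2) :=
      List.length_le_fib _ _ hl.nodup fun S hS => ((hl.mem_iff S).1 hS).2
    refine ⟨hr, l, hlen, ⟨fun S => ?_, ?_⟩, h6, hm'⟩
    -- A nonempty stored set has at least one element and therefore lies below 2d, so 2d rounds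
    -- reach all of them.
    · rw [hl.mem_iff, and_iff_right_iff_imp]
      intro h i hi
      have h1 := Finset.mem_range.1 (h hi)
      have h2 := Finset.card_pos.2 ⟨i, hi⟩
      exact Finset.mem_range.2 (by omega)
    · exact hlen.trans ((fib_two_mul_add_two_le d).trans
        (Nat.pow_le_pow_right (by norm_num) (by omega)))

end

theorem halts_powerProg {n d : ℕ} {s : State} (hd : d ≤ n) (hs : Setup n d s) :
    Halts (allBits n) powerProg (d * 3 + 3) (fun s' => s'.reg 10 = 2 ^ d ∧
      (∀ r < 10, s'.reg r = s.reg r) ∧ s'.mem = s.mem) s := by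
  have small : ∀ a : ℤ, |a| ≤ 8 * n + 8 → |a| < 2 ^ allBits n := fun a => lt_pow_allBits_of_le'
  have b0 : |(0 : ℤ)| < 2 ^ allBits n := small _ (by norm_num; linarith)
  have b1 : |(1 : ℤ)| < 2 ^ allBits n := small _ (by norm_num; linarith)
  have bd : |(d : ℤ)| < 2 ^ allBits n := small _ (by rw [Nat.abs_cast]; omega)
  refine Halts.mono (k := d * (2 + 1) + 1 + 1 + 1) ?_ le_rfl fun _ h => h
  refine Halts.seq_const b1 ?_
  refine Halts.seq_arith d 0 (by simp [hs.r1]) (by simp [hs.r4]) bd b0 ?_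
  refine halts_loop_counter (k := 2) (fun j s' => s'.reg 10 = 2 ^ (d - j) ∧
    (∀ r < 10, s'.reg r = s.reg r) ∧ s'.mem = s.mem) d ((le_abs_self _).trans_lt bd) ?_ ?_ ?_ ?_
  · rintro j hj s' h11 ⟨h10, hr, hm⟩
    refine Halts.seq_arith _ _ h10 h10 (pow_two_lt_pow_allBits (by omega))
      (pow_two_lt_pow_allBits (by omega)) ?_
    refine halts_arith (j + 1 : ℕ) 1 (by simp [h11]) (by simp [hr, hs.r2])
      (small _ (by rw [Nat.abs_cast]; push_cast; omega)) b1 ?_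
    refine ⟨by simp [Op.eval], ?_, fun r h => ?_, hm⟩
    · rw [show d - j = d - (j + 1) + 1 by omega, pow_succ, mul_two]
      simp [Op.eval]
    · simp only [State.reg_setReg]
      rw [if_neg (by omega), if_neg (by omega), hr r h]
  · simp [Op.eval]
  · refine ⟨by simp, fun r h => ?_, rfl⟩
    simp only [State.reg_setReg]
    rw [if_neg (by omega), if_neg (by omega)]
  · rintro s' - ⟨h10, hr, hm⟩
    exact ⟨by rwa [Nat.sub_zero] at h10, hr, hm⟩

/-! ### Complete programs and early rejection -/

/-- Sets up the registers and the list of sets, and searches for a cycle. -/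
def mainProg : Prog :=
  .const 2 1 ;; .const 3 2 ;; .const 4 0 ;; .arith .mul 5 0 0 ;; .arith .add 7 1 1 ;;
  buildList ;; powerProg ;; search

/-- Decides whether a directed graph has a simple cycle of a given length. -/
def cycleProg : Prog :=
  .const 2 1 ;; .arith .sub 33 0 1 ;; .arith .add 33 33 2 ;;
  .cond 1 (.cond 33 mainProg (.const 0 0)) (.const 0 0)

/-- Decides whether an undirected graph has a simple cycle of a given length. -/
def undirectedCycleProg : Prog :=
  .const 2 2 ;; .arith .sub 33 1 2 ;; .cond 33 cycleProg (.const 0 0)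

/-- Of the 51 n steps, 48 n are for listing the sets and 3 n for the power of two; the constant pays
for setup and tests. All this gets multiplied by the Fibonacci number. -/
def cycleTime (n : ℕ) : ℕ := 51 * n + searchTime n 1 + 25

/-- The running times are affine in the length of the list, with nonnegative coefficients, so a
factor F ≥ 1 can be taken out of the whole expression. -/
theorem levelTime_le (n : ℕ) {len F : ℕ} (h : len ≤ F) (hF : 1 ≤ F) :
    levelTime n len ≤ F * levelTime n 1 := by
  have h1 := Nat.mul_le_mul_right (innerTime n + 12) h
  have h2 := Nat.mul_le_mul_right (outerTime n + 12) h
  simp only [levelTime]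
  linarith

theorem roundTime_le (n : ℕ) {len F : ℕ} (h : len ≤ F) (hF : 1 ≤ F) :
    roundTime n len ≤ F * roundTime n 1 := by
  have h1 := Nat.mul_le_mul_left n (levelTime_le n h hF)
  have h2 := Nat.mul_le_mul_right (n * 9 + 14) h
  have h3 := Nat.mul_le_mul_right n hF
  simp only [roundTime]
  linarith

theorem searchTime_le (n : ℕ) {len F : ℕ} (h : len ≤ F) (hF : 1 ≤ F) :
    searchTime n len ≤ F * searchTime n 1 := by
  have h1 := Nat.mul_le_mul_left n (roundTime_le n h hF)
  have h3 := Nat.mul_le_mul_right n hF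
  simp only [searchTime]
  linarith

section

variable {n : ℕ} (adj : Fin n → Fin n → Prop)

/-- Cells -1 and -2 are zero in the input, and zero is both the mask and the size of the empty set,
so the list `[∅]` is present without any write. -/
theorem memSetup_graphInput [DecidableRel adj] (d : ℕ) :
    MemSetup adj [∅] (graphInput n d adj).mem := by
  classical
  have hneg : ∀ a < 0, (graphInput n d adj).mem a = 0 := by
    intro a ha
    refine if_neg ?_
    rintro ⟨i, j, -, rfl⟩
    have : (0 : ℤ) ≤ i * n + j := by positivity
    omega
  refine ⟨fun i j => ?_, fun i hi => ?_, fun i hi => ?_, fun a => ?_⟩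
  · have key : (∃ i' j' : Fin n, adj i' j' ∧ (i : ℤ) * n + j = (i' : ℤ) * n + j') ↔ adj i j := by
      constructor
      · rintro ⟨i', j', h, h'⟩
        have h1 : (tableAddr n i j) = tableAddr n i' j' := by
          rw [tableAddr, tableAddr, h']
        obtain ⟨h2, h3⟩ := tableAddr_inj j.2 j'.2 h1
        rwa [Fin.ext h2, Fin.ext h3]
      · exact fun h => ⟨i, j, h, rfl⟩
    simp only [graphInput, key]
  · rw [hneg _ (by omega)]
    rw [List.length_singleton, Nat.lt_one_iff] at hi
    subst hi
    simp [bitMask]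
  · rw [hneg _ (by omega)]
    rw [List.length_singleton, Nat.lt_one_iff] at hi
    subst hi
    simp
  · have h1 : (1 : ℤ) ≤ 2 ^ (prodBits n * n) := one_le_pow₀ (by norm_num)
    rw [graphInput]
    dsimp only
    split_ifs
    · simpa using h1
    · rw [abs_zero]
      linarith

/-- The part of the input that is not changed before the main part of the program. -/
structure Input [DecidableRel adj] (d : ℕ) (s : State) : Prop where
  r0 : s.reg 0 = n
  r1 : s.reg 1 = d
  r8 : s.reg 8 = 0
  mem : MemSetup adj [∅] s.mem

theorem Input.congr [DecidableRel adj] {d : ℕ} {s s' : State} (h : Input adj d s)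
    (h0 : s'.reg 0 = s.reg 0) (h1 : s'.reg 1 = s.reg 1) (h8 : s'.reg 8 = s.reg 8)
    (hm : s'.mem = s.mem) : Input adj d s' :=
  ⟨h0.trans h.r0, h1.trans h.r1, h8.trans h.r8, hm ▸ h.mem⟩

theorem input_graphInput [DecidableRel adj] (d : ℕ) : Input adj d (graphInput n d adj) where
  r0 := rfl
  r1 := rfl
  r8 := rfl
  mem := memSetup_graphInput adj d

/-- Register `0` holds the answer to the question whether `A` is true. -/
def Answers (A : Prop) (s : State) : Prop := (A → s.reg 0 = 1) ∧ (¬ A → s.reg 0 = 0)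

theorem halts_const_answers {b : ℕ} {A : Prop} {s : State} (hA : ¬ A) :
    Halts b (.const 0 0) 1 (Answers A) s := by
  refine halts_const (by simp) ⟨fun h => absurd h hA, fun _ => by simp⟩

theorem halts_mainProg [DecidableRel adj] {d : ℕ} {s : State} (hd : d ≤ n) (hd1 : 1 ≤ d)
    (hs : Input adj d s) :
    Halts (allBits n) mainProg (Nat.fib (2 * d + 2) * (51 * n + searchTime n 1 + 12))
      (Answers (Digraph.HasSimpleCycle ⟨adj⟩ d)) s := by
  have hn : 1 ≤ n := hd1.trans hd
  have small : ∀ a : ℤ, |a| ≤ 8 * n + 8 → |a| < 2 ^ allBits n := fun a => lt_pow_allBits_of_le'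
  have b0 : |(0 : ℤ)| < 2 ^ allBits n := small _ (by norm_num; linarith)
  have b1 : |(1 : ℤ)| < 2 ^ allBits n := small _ (by norm_num; linarith)
  have b2 : |(2 : ℤ)| < 2 ^ allBits n := small _ (by norm_num; linarith)
  have bn : |(n : ℤ)| < 2 ^ allBits n := small _ (by rw [Nat.abs_cast]; linarith)
  have bd : |(d : ℤ)| < 2 ^ allBits n := small _ (by rw [Nat.abs_cast]; omega)
  have hA : Digraph.HasSimpleCycle ⟨adj⟩ d ↔
      ∃ u, 0 < walkWeight adj (vertexLabel u) u (d - 1) u {vertexLabel u u} := by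
    have := hasSimpleCycle_iff_exists_walkWeight_pos (Digraph.mk adj) vertexLabel
      vertexLabel_injective (d - 1)
    rwa [Nat.sub_add_cancel hd1] at this
  have hF : 1 ≤ Nat.fib (2 * d + 2) := Nat.fib_pos.2 (by omega)
  refine Halts.mono (k := 2 * d * (Nat.fib (2 * d + 2) * 19 + 5) + 4 +
    (d * 3 + 3 + Nat.fib (2 * d + 2) * searchTime n 1) + 1 + 1 + 1 + 1 + 1) ?_ ?_ fun _ h => h
  swap
  · generalize Nat.fib (2 * d + 2) = F at hF
    have h1 : 2 * d * (F * 19 + 5) ≤ 2 * n * (F * 24) := by gcongr; omega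
    have h2 : d * 3 ≤ F * (3 * n) := by nlinarith
    nlinarith
  refine Halts.seq_const b1 (Halts.seq_const b2 (Halts.seq_const b0 ?_))
  refine Halts.seq_arith n n (by simp [hs.r0]) (by simp [hs.r0]) bn bn ?_
  refine Halts.seq_arith d d (by simp [hs.r1]) (by simp [hs.r1]) bd bd ?_
  have hs₀ : Setup n d (((((s.setReg 2 1).setReg 3 2).setReg 4 0).setReg 5
      (Op.mul.eval n n)).setReg 7 (Op.add.eval d d)) := by
    constructor <;> simp [hs.r0, hs.r1, Op.eval]
    ring
  refine Halts.seq (halts_buildList adj hd hn hs₀ hs.mem) ?_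
  rintro s₁ ⟨hr₁, l, hlen, hl, h6, hm₁⟩
  have hs₁ : Setup n d s₁ := hs₀.congr_of_ne fun r h h' => hr₁ r (by omega) h'
  refine Halts.seq (halts_powerProg hd hs₁) ?_
  rintro s₂ ⟨h10, hr₂, hm₂⟩
  rw [hA]
  refine (halts_search adj hd hd1 (hs₁.congr fun r h => hr₂ r (by omega)) hl
    (by rw [hr₂ 6 (by norm_num), h6]) ?_ h10 (hm₂ ▸ hm₁)).mono (searchTime_le n hlen hF)
    fun _ h => h
  rw [hr₂ 8 (by norm_num), hr₁ 8 (by norm_num) (by norm_num)]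
  simp [hs.r8]

theorem halts_cycleProg [DecidableRel adj] {d : ℕ} {s : State} (hd : d ≤ n) (hd1 : 1 ≤ d)
    (hs : Input adj d s) :
    Halts (allBits n) cycleProg (Nat.fib (2 * d + 2) * (51 * n + searchTime n 1 + 17))
      (Answers (Digraph.HasSimpleCycle ⟨adj⟩ d)) s := by
  have small : ∀ a : ℤ, |a| ≤ 8 * n + 8 → |a| < 2 ^ allBits n := fun a => lt_pow_allBits_of_le'
  have b1 : |(1 : ℤ)| < 2 ^ allBits n := small _ (by norm_num; linarith)
  have bn : |(n : ℤ)| < 2 ^ allBits n := small _ (by rw [Nat.abs_cast]; linarith)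
  have bd : |(d : ℤ)| < 2 ^ allBits n := small _ (by rw [Nat.abs_cast]; omega)
  have hF : 1 ≤ Nat.fib (2 * d + 2) := Nat.fib_pos.2 (by omega)
  refine Halts.mono (k := Nat.fib (2 * d + 2) * (51 * n + searchTime n 1 + 12) + 1 + 1 + 1 + 1 + 1)
    ?_ (by nlinarith) fun _ h => h
  refine Halts.seq_const b1 ?_
  refine Halts.seq_arith n d (by simp [hs.r0]) (by simp [hs.r1]) bn bd ?_
  refine Halts.seq_arith (n - d) 1 (by simp [Op.eval]) (by simp)
    (small _ (by rw [abs_le]; omega)) b1 ?_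
  refine halts_cond (by simpa [hs.r1] using bd) (fun _ => ?_) fun h => ?_
  · refine halts_cond ?_ (fun _ => ?_) fun h => ?_
    · refine small _ ?_
      simp [Op.eval]
      rw [abs_le]
      omega
    · refine halts_mainProg adj hd hd1 (hs.congr adj ?_ ?_ ?_ rfl) <;> simp
    · exfalso
      simp [Op.eval] at h
      omega
  · exfalso
    simp [hs.r1] at h
    omega

theorem halts_undirectedCycleProg [DecidableRel adj] {d : ℕ} {s : State} (hd : d ≤ n)
    (hd1 : 3 ≤ d) (hs : Input adj d s) :
    Halts (allBits n) undirectedCycleProg (Nat.fib (2 * d + 2) * cycleTime n)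
      (Answers (Digraph.HasSimpleCycle ⟨adj⟩ d)) s := by
  have small : ∀ a : ℤ, |a| ≤ 8 * n + 8 → |a| < 2 ^ allBits n := fun a => lt_pow_allBits_of_le'
  have b2 : |(2 : ℤ)| < 2 ^ allBits n := small _ (by norm_num; linarith)
  have bd : |(d : ℤ)| < 2 ^ allBits n := small _ (by rw [Nat.abs_cast]; omega)
  have hF : 1 ≤ Nat.fib (2 * d + 2) := Nat.fib_pos.2 (by omega)
  refine Halts.mono (k := Nat.fib (2 * d + 2) * (51 * n + searchTime n 1 + 17) + 1 + 1 + 1)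
    ?_ (by rw [cycleTime]; nlinarith) fun _ h => h
  refine Halts.seq_const b2 ?_
  refine Halts.seq_arith d 2 (by simp [hs.r1]) (by simp) bd b2 ?_
  refine halts_cond ?_ (fun _ => ?_) fun h => ?_
  · refine small _ ?_
    simp only [State.reg_setReg, ↓reduceIte, Op.eval]
    rw [abs_le]
    omega
  · refine halts_cycleProg adj hd (by omega) (hs.congr adj ?_ ?_ ?_ rfl) <;> simp
  · exfalso
    simp only [State.reg_setReg, ↓reduceIte, Op.eval] at h
    omega

/-- For d > n the bound `allBits n` need not cover d, hence the separate bit bound n + d + 3. -/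
theorem halts_cycleProg_of_not {d : ℕ} {s : State} (h0 : s.reg 0 = n) (h1 : s.reg 1 = d)
    (hd : d = 0 ∨ n < d) {A : Prop} (hA : ¬ A) :
    Halts (n + d + 3) cycleProg 6 (Answers A) s := by
  have small : ∀ a : ℤ, |a| ≤ n + d + 3 → |a| < 2 ^ (n + d + 3) := fun a h => by
    refine h.trans_lt ?_
    exact_mod_cast (Nat.lt_two_pow_self : n + d + 3 < 2 ^ (n + d + 3))
  have b1 : |(1 : ℤ)| < 2 ^ (n + d + 3) := small _ (by rw [abs_le]; omega)
  have bn : |(n : ℤ)| < 2 ^ (n + d + 3) := small _ (by rw [abs_le]; omega)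
  have bd : |(d : ℤ)| < 2 ^ (n + d + 3) := small _ (by rw [abs_le]; omega)
  refine Halts.mono (k := 2 + 1 + 1 + 1 + 1) ?_ le_rfl fun _ h => h
  refine Halts.seq_const b1 ?_
  refine Halts.seq_arith n d (by simp [h0]) (by simp [h1]) bn bd ?_
  refine Halts.seq_arith (n - d) 1 (by simp [Op.eval]) (by simp)
    (small _ (by rw [abs_le]; omega)) b1 ?_
  refine halts_cond (by simpa [h1] using bd) (fun h => ?_) fun h =>
    (halts_const_answers hA).mono (by omega) fun _ h => h
  refine halts_cond ?_ (fun h' => ?_) fun h => halts_const_answers hA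
  · refine small _ ?_
    simp only [State.reg_setReg, ↓reduceIte, Op.eval]
    rw [abs_le]
    omega
  · exfalso
    simp [h1] at h
    simp only [State.reg_setReg, ↓reduceIte, Op.eval] at h'
    omega

theorem halts_undirectedCycleProg_of_not {d : ℕ} {s : State} (h0 : s.reg 0 = n)
    (h1 : s.reg 1 = d) (hd : d < 3 ∨ n < d) {A : Prop} (hA : ¬ A) :
    Halts (n + d + 3) undirectedCycleProg 9 (Answers A) s := by
  have small : ∀ a : ℤ, |a| ≤ n + d + 3 → |a| < 2 ^ (n + d + 3) := fun a h => by
    refine h.trans_lt ?_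
    exact_mod_cast (Nat.lt_two_pow_self : n + d + 3 < 2 ^ (n + d + 3))
  have b2 : |(2 : ℤ)| < 2 ^ (n + d + 3) := small _ (by rw [abs_le]; omega)
  have bd : |(d : ℤ)| < 2 ^ (n + d + 3) := small _ (by rw [abs_le]; omega)
  refine Halts.mono (k := 6 + 1 + 1 + 1) ?_ le_rfl fun _ h => h
  refine Halts.seq_const b2 ?_
  refine Halts.seq_arith d 2 (by simp [h1]) (by simp) bd b2 ?_
  refine halts_cond ?_ (fun h => ?_) fun h =>
    (halts_const_answers hA).mono (by omega) fun _ h => h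
  · refine small _ ?_
    simp only [State.reg_setReg, ↓reduceIte, Op.eval]
    rw [abs_le]
    omega
  · simp only [State.reg_setReg, ↓reduceIte, Op.eval] at h
    refine halts_cycleProg_of_not ?_ ?_ (by omega) hA <;> simp [h0, h1]

end

/-! ### Polynomial time bounds and conclusion -/

/-- A function that is given by a polynomial. -/
def IsPoly (f : ℕ → ℕ) : Prop := ∃ p : Polynomial ℕ, ∀ n, p.eval n = f n

theorem isPoly_const (c : ℕ) : IsPoly fun _ => c := ⟨.C c, fun n => by simp⟩

theorem isPoly_id : IsPoly fun n => n := ⟨.X, fun n => by simp⟩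

theorem IsPoly.add {f g : ℕ → ℕ} (hf : IsPoly f) (hg : IsPoly g) : IsPoly fun n => f n + g n := by
  obtain ⟨p, hp⟩ := hf
  obtain ⟨q, hq⟩ := hg
  exact ⟨p + q, fun n => by simp [hp, hq]⟩

theorem IsPoly.mul {f g : ℕ → ℕ} (hf : IsPoly f) (hg : IsPoly g) : IsPoly fun n => f n * g n := by
  obtain ⟨p, hp⟩ := hf
  obtain ⟨q, hq⟩ := hg
  exact ⟨p * q, fun n => by simp [hp, hq]⟩

/-- A bound on the running time, up to a power of the golden ratio. -/
def timeBound (n : ℕ) : ℕ :=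
  4 * cycleTime n * ((allBits n + 1) * (allBits n + 1)) + 36 * ((n + 4) * (n + 4))

/-- All time functions unfold to sums and products of n and constants; squares are written as
products in `timeBound` for this purpose. -/
theorem isPoly_timeBound : IsPoly timeBound := by
  unfold timeBound cycleTime searchTime roundTime levelTime innerTime outerTime edgeCellTime
    extrapCellTime edgeStepTime interpTime interpStepTime bitProdCallTime allBits prodBits
  repeat first
    | exact isPoly_const _
    | exact isPoly_id
    | refine IsPoly.add ?_ ?_
    | refine IsPoly.mul ?_ ?_

/-- The coefficient 4 in `timeBound` is the 2 from the Fibonacci estimate times the 2 from the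
instruction cost. -/
theorem Halts.decidesWithin {n d : ℕ} {P : Prog} {s : State} {A : Prop}
    (h : Halts (allBits n) P (Nat.fib (2 * d + 2) * cycleTime n) (Answers A) s) :
    DecidesWithin P s A (Real.goldenRatio ^ (2 * d) * (timeBound n : ℕ)) := by
  obtain ⟨s', t, hr, ht, hA⟩ := h
  refine ⟨s', t, hr, ?_, hA⟩
  have h1 : (t : ℝ) ≤ Nat.fib (2 * d + 2) * cycleTime n * (2 * (allBits n + 1) ^ 2) := by
    exact_mod_cast ht
  have h2 : (Nat.fib (2 * d + 2) : ℝ) * cycleTime n * (2 * (allBits n + 1) ^ 2) ≤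
      2 * Real.goldenRatio ^ (2 * d) * cycleTime n * (2 * (allBits n + 1) ^ 2) := by
    gcongr
    exact Nat.fib_le_two_mul_goldenRatio_pow d
  have h3 : 0 ≤ Real.goldenRatio ^ (2 * d) * (36 * (((n : ℝ) + 4) * (n + 4))) := by
    have := Real.goldenRatio_pos
    positivity
  rw [timeBound]
  push_cast
  linarith

/-- At most nine instructions cost at most 18 (n + d + 4) ^ 2. Since n + d + 4 ≤ (n + 4) (d + 1),
the part depending on d is at most 2 φ^(2d), which gives the coefficient 36 in `timeBound`. -/
theorem Halts.decidesWithin_of_le {n d k : ℕ} {P : Prog} {s : State} {A : Prop} (hk : k ≤ 9)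
    (h : Halts (n + d + 3) P k (Answers A) s) :
    DecidesWithin P s A (Real.goldenRatio ^ (2 * d) * (timeBound n : ℕ)) := by
  obtain ⟨s', t, hr, ht, hA⟩ := h
  refine ⟨s', t, hr, ?_, hA⟩
  have h0 : t ≤ 18 * ((n + 4) * (d + 1)) ^ 2 := by
    calc t ≤ 9 * (2 * (n + d + 3 + 1) ^ 2) := ht.trans (Nat.mul_le_mul_right _ hk)
      _ = 18 * (n + d + 4) ^ 2 := by ring
      _ ≤ 18 * ((n + 4) * (d + 1)) ^ 2 := by gcongr; nlinarith
  have h1 : (t : ℝ) ≤ 18 * ((n + 4) * (d + 1)) ^ 2 := by exact_mod_cast h0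
  have h2 : (18 : ℝ) * (n + 4) ^ 2 * (d + 1) ^ 2 ≤
      18 * (n + 4) ^ 2 * (2 * Real.goldenRatio ^ (2 * d)) := by
    gcongr
    exact succ_sq_le_two_mul_goldenRatio_pow d
  have h3 : 0 ≤ Real.goldenRatio ^ (2 * d) *
      (4 * cycleTime n * (((allBits n : ℝ) + 1) * (allBits n + 1))) := by
    have := Real.goldenRatio_pos
    positivity
  rw [timeBound]
  push_cast
  linarith

end Ram

theorem Digraph.HasSimpleCycle.le_card {n d : ℕ} {G : Digraph (Fin n)} (h : G.HasSimpleCycle d) :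
    1 ≤ d ∧ d ≤ n := by
  obtain ⟨h1, v, -, -, hv⟩ := h
  refine ⟨h1, ?_⟩
  have := Finset.card_le_card_of_injOn (s := Finset.range d) (t := Finset.univ) v
    (fun _ _ => Finset.mem_coe.2 (Finset.mem_univ _)) (by rwa [Finset.coe_range])
  simpa using this

theorem mainTheorem10 :
    (∃ (P : Ram.Prog) (p : Polynomial ℕ), ∀ (n d : ℕ) (G : Digraph (Fin n)),
      Ram.DecidesWithin P (Ram.graphInput n d G.Adj) (G.HasSimpleCycle d)
        (Real.goldenRatio ^ (2 * d) * ((p.eval n : ℕ) : ℝ))) ∧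
    (∃ (P : Ram.Prog) (p : Polynomial ℕ), ∀ (n d : ℕ) (G : SimpleGraph (Fin n)),
      Ram.DecidesWithin P (Ram.graphInput n d G.Adj) (G.HasSimpleCycle d)
        (Real.goldenRatio ^ (2 * d) * ((p.eval n : ℕ) : ℝ))) := by
  classical
  obtain ⟨p, hp⟩ := Ram.isPoly_timeBound
  refine ⟨⟨Ram.cycleProg, p, fun n d G => ?_⟩, Ram.undirectedCycleProg, p, fun n d G => ?_⟩
  · rw [hp]
    by_cases hd : 1 ≤ d ∧ d ≤ n
    · refine ((Ram.halts_cycleProg G.Adj hd.2 hd.1 (Ram.input_graphInput G.Adj d)).mono ?_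
        fun _ h => h).decidesWithin
      exact Nat.mul_le_mul_left _ (by rw [Ram.cycleTime]; omega)
    · exact (Ram.halts_cycleProg_of_not (n := n) (d := d) rfl rfl (by omega)
        fun h => hd h.le_card).decidesWithin_of_le (by norm_num)
  · rw [hp, SimpleGraph.hasSimpleCycle_iff]
    by_cases hd : 3 ≤ d ∧ d ≤ n
    · rw [and_iff_right hd.1]
      exact (Ram.halts_undirectedCycleProg G.Adj hd.2 hd.1
        (Ram.input_graphInput G.Adj d)).decidesWithin
    · exact (Ram.halts_undirectedCycleProg_of_not (n := n) (d := d) rfl rfl (by omega)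
        fun h => hd ⟨h.1, h.2.le_card.2⟩).decidesWithin_of_le le_rfl
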